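/- **Setting.** Let $V=\mathbb R^3$, $\Lambda=\mathbb Z^3\subset V$, and let $G$ be the Lie group $V^*\times V$ with multiplication $(v^*,v)(w^*,w)=(v^*+w^*+\tfrac12\det(v,w,\cdot),\,v+w)$. Let $\Gamma\subset G$ be the lattice generated by the standard bases of $\Lambda$ and $\Lambda^\vee$, $X=\Gamma\backslash G$ and $T^2=\mathbb Z^2\backslash\mathbb R^2$. The Lie algebra $\mathfrak d=\mathfrak g\oplus\mathfrak t^2$ of $G\times\mathbb R^2$ has a basis $\alpha^i,\beta_i$ ($0\le i\le 3$) whose only non-zero brackets are $[\beta_i,\beta_j]=\sum_k\varepsilon_{ijk}\alpha^k$ ($\varepsilon$ is totally antisymmetric in $1,2,3$, $\varepsilon_{123}=1$, and zero if an index is $0$), and an invariant pairing with $(\alpha^i,\beta_j)=\delta^i_j$, $(\alpha^i,\alpha^j)=(\beta_i,\beta_j)=0$. Left-invariant vector fields give $T(X\times T^2)\cong (X\times T^2)\times\mathfrak d$. Let $Y=(\Lambda\oplus\mathbb Z)\backslash(V\oplus\mathbb R)$ be the four-torus with the closed $3$-form $\det=dx^1\wedge dx^2\wedge dx^3$; the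 frame $\alpha^i=dx^i$, $\beta_i=\partial_{x^i}$ gives $TY\oplus T^*Y\cong Y\times\mathfrak d$. *Structures.* An equivariant generalized complex structure on $(Y,\det)$ is a translation-invariant smooth orthogonal endomorphism $\mathcal J$ of $TY\oplus T^*Y$ with $\mathcal J^2=-1$ whose $\sqrt{-1}$-eigenbundle is closed under the Dorfman bracket $[\tau+\zeta,\tau'+\zeta']=[\tau,\tau']+\mathrm{Lie}_\tau\zeta'-\iota_{\tau'}d\zeta+\det(\tau,\tau',\cdot)$. It is an equivariant generalized Calabi–Yau structure if its canonical line bundle has a translation-invariant nowhere vanishing section closed under the $\det$-twisted de Rham differential. An equivariant complex structure on $X\times T^2$ compatible with the tautological pairing is an integrable almost complex structure which is constant in the trivialization $T(X\times T^2)\cong(X\times T^2)\times\mathfrak d$ and orthogonal for $(\cdot,\cdot)$. *Modules.* The modes of $V(\mathfrak d_{\rm super})$ are, for $u\in\mathfrak d\otimes\mathbb C$, the even $u_n$ ($n\in\mathbb Z$) and the odd $\bar u_r$ ($r\in\frac12+\mathbb Z$), linear in $u$, with super-commutators $[u_m,v_n]=[u,v]_{m+n}+m(u,v)\delta_{m,-n}$,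 $[u_m,\bar v_r]=\overline{[u,v]}_{m+r}$, $[\bar u_r,\bar v_s]=(u,v)\delta_{r,-s}$. A space with an action of $\mathfrak d$ induces a module over these modes: the modes of positive degree annihilate the space and $u_0$ acts on it as $u$. Let $\mathscr H\otimes\mathscr H_{T^2}$ be (completed in the zero modes) the module induced from $C^\infty(X\times T^2)$, on which $\mathfrak d$ acts by the left-invariant vector fields. Let $\mathscr H_Y$ be the module induced from the smooth vectors of $\bigoplus_{\omega\in\Lambda\oplus\mathbb Z}L^2(Y,\mathscr L_\omega)$. Here $\mathscr L_\omega$ is the line bundle on $Y$ with $c_1(\mathscr L_\omega)=\iota_\omega\det$ whose sections are the functions $s$ on $\mathbb R^4$ with $s(x+e_i)=e^{\pi\sqrt{-1}\det(e_i,x,\omega)}s(x)$, and on its sections $\alpha^i$ acts as $-2\pi\sqrt{-1}\,\omega^i$ and $\beta_i$ as $\nabla_i=\partial_{x^i}+\pi\sqrt{-1}\det(e_i,x,\omega)$; the smooth vectors are the families of smooth sections that are square-summable together with all their images under products of elements of $\mathfrak d$. *$N=2$ structures.* An $N=2$ structure of central charge $c$ on such a module consists of even fields $L(z)=\sum L_nz^{-n-2}$,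 $J(z)=\sum J_nz^{-n-1}$ and odd fields $G^\pm(z)=\sum_{r\in\frac12+\mathbb Z}G^\pm_rz^{-r-3/2}$ whose modes satisfy the $N=2$ super-conformal algebra: $L$ is Virasoro of central charge $c$, $J$ and $G^\pm$ are primary of weights $1$ and $\frac32$, $[J_m,J_n]=\frac c3m\delta_{m,-n}$, $[J_m,G^\pm_r]=\pm G^\pm_{m+r}$, $[G^\pm_r,G^\pm_s]=0$, $[G^+_r,G^-_s]=L_{r+s}+\frac{r-s}2J_{r+s}+\frac c6(r^2-\frac14)\delta_{r,-s}$. If $\mathfrak l\subset\mathfrak d\otimes\mathbb C$ is the $\sqrt{-1}$-eigenspace of an equivariant structure of either kind, an $N=2$ structure is *associated* with it if $J(z)+\theta(G^-(z)-G^+(z))$ is the super-field $\sum_i\bar e^i\bar e_i$, that is, $J=\sum_i{:}\bar e^i\bar e_i{:}$ and $G^--G^+=\sum_i({:}e^i\bar e_i{:}-{:}\bar e^ie_i{:})$, for bases $(e_i)$ of $\mathfrak l$ and dual bases $(e^i)$ of $\overline{\mathfrak l}\cong\mathfrak l^*$. **Proposition.** (a) For each equivariant generalized Calabi–Yau structure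 on $(Y,\det)$ there is exactly one associated $N=2$ structure of central charge $12$ on $\mathscr H_Y$. (b) There is a bijection between the equivariant generalized Calabi–Yau structures on $(Y,\det)$ and the equivariant complex structures on $X\times T^2$ compatible with the tautological pairing; corresponding structures are given by the same endomorphism of $\mathfrak d$ in the trivializations above. (c) The Fourier transform along the fibres of $X\times T^2\to Y$, $f\mapsto\big(\int f(x^*,x)\,e^{2\pi\sqrt{-1}\,\omega\cdot x^*}dx^*\big)_\omega$, is an $L^2$-isometric isomorphism of $C^\infty(X\times T^2)$ onto the zero modes of $\mathscr H_Y$, and it extends to a parity-preserving isomorphism $\mathscr H\otimes\mathscr H_{T^2}\cong\mathscr H_Y$ of modules over the modes of $V(\mathfrak d_{\rm super})$. For structures corresponding under (b) there is exactly one associated $N=2$ structure of central charge $12$ on $\mathscr H\otimes\mathscr H_{T^2}$, and the isomorphism intertwines it with the one on $\mathscr H_Y$. -/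

import Mathlib

open scoped TensorProduct ContDiff

noncomputable section

namespace GerbyTorus

/-! ## The eight-dimensional Lie algebra with its pairing -/

/-- Index set of the basis: `Sum.inl i` stands for `α^i` (and for the coordinate `x^*_i`),
`Sum.inr i` stands for `β_i` (and for the coordinate `x^i`), `i = 0, 1, 2, 3`. -/
abbrev Idx : Type := Fin 4 ⊕ Fin 4

/-- The underlying `K`-module of the Lie algebra `𝔤 ⊕ 𝔱²`, in the basis `α^i, β_i`. -/
abbrev DD (K : Type) : Type := Idx → K

/-- The components `ε_{ijk} v^i w^j`, with `ε` the totally antisymmetric tensor in the indices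
`1, 2, 3`, extended by zero to the index `0`; that is, the covector `det (v, w, ·)`. -/
def cross {K : Type} [CommRing K] (v w : Fin 4 → K) : Fin 4 → K :=
  ![0, v 2 * w 3 - v 3 * w 2, v 3 * w 1 - v 1 * w 3, v 1 * w 2 - v 2 * w 1]

/-- The trilinear form `det (u, v, w)`. -/
def det3 {K : Type} [CommRing K] (u v w : Fin 4 → K) : K := ∑ k, cross u v k * w k

/-- The `β`-components of an element of `𝔤 ⊕ 𝔱²`. -/
def vec {K : Type} (u : DD K) : Fin 4 → K := fun i => u (Sum.inr i)

/-- The `α`-components of an element of `𝔤 ⊕ 𝔱²`. -/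
def cov {K : Type} (u : DD K) : Fin 4 → K := fun i => u (Sum.inl i)

/-- The Lie bracket: `[β_i, β_j] = ε_{ijk} α^k`, all other brackets of basis vectors vanish. -/
def bracket {K : Type} [CommRing K] (u v : DD K) : DD K :=
  Sum.elim (cross (vec u) (vec v)) 0

/-- The invariant symmetric pairing: `(α^i, β_j) = δ^i_j`, `(α^i, α^j) = (β_i, β_j) = 0`. -/
def pair {K : Type} [CommRing K] (u v : DD K) : K :=
  ∑ i : Fin 4, (u (Sum.inl i) * v (Sum.inr i) + u (Sum.inr i) * v (Sum.inl i))

/-- The `√-1`-eigenspace, in the complexification, of a real endomorphism. -/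
def plusEigen (M : Matrix Idx Idx ℝ) : Submodule ℂ (DD ℂ) :=
  Module.End.eigenspace (Matrix.toLin' (M.map Complex.ofReal)) Complex.I

/-- The `-√-1`-eigenspace, in the complexification, of a real endomorphism. -/
def minusEigen (M : Matrix Idx Idx ℝ) : Submodule ℂ (DD ℂ) :=
  Module.End.eigenspace (Matrix.toLin' (M.map Complex.ofReal)) (-Complex.I)

/-! ## Generalized geometry of the gerby torus

Tensor fields on `Y = ℤ⁴ \ ℝ⁴` are `ℤ⁴`-periodic tensor fields on `ℝ⁴`; the fibre of
`(TY ⊕ T^*Y) ⊗ ℂ` is `DD ℂ` through the frame `β_i = ∂/∂x^i`, `α^i = dx^i`. -/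

/-- The partial derivative `∂f/∂x^i`. -/
def pd (i : Fin 4) (f : (Fin 4 → ℝ) → ℂ) (x : Fin 4 → ℝ) : ℂ :=
  fderiv ℝ f x (Pi.single i 1)

/-- A lattice vector as a vector. -/
def latt (n : Fin 4 → ℤ) : Fin 4 → ℝ := fun i => (n i : ℝ)

/-- The Dorfman bracket twisted by the three-form `det`,
`[X + ξ, Z + η] = [X, Z] + Lie_X η - ι_Z dξ + det (X, Z, ·)`, in coordinates. -/
def dorfman (s t : (Fin 4 → ℝ) → DD ℂ) (x : Fin 4 → ℝ) : DD ℂ :=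
  Sum.elim
    (fun i => (∑ j : Fin 4,
        (s x (Sum.inr j) * pd j (fun y => t y (Sum.inl i)) x
          + t x (Sum.inl j) * pd i (fun y => s y (Sum.inr j)) x
          - t x (Sum.inr j) *
              (pd j (fun y => s y (Sum.inl i)) x - pd i (fun y => s y (Sum.inl j)) x)))
        + cross (vec (s x)) (vec (t x)) i)
    (fun i => ∑ j : Fin 4,
        (s x (Sum.inr j) * pd j (fun y => t y (Sum.inr i)) x
          - t x (Sum.inr j) * pd j (fun y => s y (Sum.inr i)) x))

/-- A generalized complex structure on `(Y, det)`: a smooth orthogonal endomorphism of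
`TY ⊕ T^*Y` with square `-1` whose `√-1`-eigenbundle is closed under the twisted Dorfman
bracket. -/
structure IsGenComplex (J : (Fin 4 → ℝ) → Matrix Idx Idx ℝ) : Prop where
  smooth : ∀ a b, ContDiff ℝ ∞ (fun x => J x a b)
  periodic : ∀ (n : Fin 4 → ℤ) (x : Fin 4 → ℝ), J (x + latt n) = J x
  square : ∀ x, J x * J x = -1
  orthogonal : ∀ (x : Fin 4 → ℝ) (u v : DD ℝ),
    pair (Matrix.mulVec (J x) u) (Matrix.mulVec (J x) v) = pair u v
  involutive : ∀ s t : (Fin 4 → ℝ) → DD ℂ, ContDiff ℝ ∞ s → ContDiff ℝ ∞ t →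
    (∀ (n : Fin 4 → ℤ) (x : Fin 4 → ℝ), s (x + latt n) = s x) →
    (∀ (n : Fin 4 → ℤ) (x : Fin 4 → ℝ), t (x + latt n) = t x) →
    (∀ x, s x ∈ plusEigen (J x)) → (∀ x, t x ∈ plusEigen (J x)) →
    ∀ x, dorfman s t x ∈ plusEigen (J x)

/-- Exterior forms at a point: the coefficient of `dx^I`, `I ⊆ {0, 1, 2, 3}`. -/
abbrev Spinor : Type := Finset (Fin 4) → ℂ

/-- The sign `(-1)^{#{j ∈ I : j < i}}`. -/
def koszul (i : Fin 4) (I : Finset (Fin 4)) : ℂ := (-1) ^ (I.filter (fun j => j < i)).card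

/-- Exterior multiplication `ρ ↦ dx^i ∧ ρ`. -/
def wedge (i : Fin 4) (ρ : Spinor) : Spinor := fun I =>
  if i ∈ I then koszul i I * ρ (I.erase i) else 0

/-- Contraction `ρ ↦ ι_{∂/∂x^i} ρ`. -/
def contr (i : Fin 4) (ρ : Spinor) : Spinor := fun I =>
  if i ∈ I then 0 else koszul i I * ρ (insert i I)

/-- The Clifford action `(X + ξ) · ρ = ι_X ρ + ξ ∧ ρ`. -/
def clifford (v : DD ℂ) (ρ : Spinor) : Spinor :=
  ∑ i : Fin 4, (v (Sum.inr i) • contr i ρ + v (Sum.inl i) • wedge i ρ)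

/-- The twisted de Rham differential `ρ ↦ dρ - det ∧ ρ`, whose derived bracket is the Dorfman
bracket above. On translation-invariant forms `dρ = 0`, so there the sign in front of `det`
does not affect closedness. -/
def twistedD (ρ : (Fin 4 → ℝ) → Spinor) (x : Fin 4 → ℝ) : Spinor :=
  (∑ i : Fin 4, wedge i (fun I => pd i (fun y => ρ y I) x))
    - wedge 1 (wedge 2 (wedge 3 (ρ x)))

/-- A generalized complex structure that is invariant under the translations of `Y` and is
generalized Calabi-Yau, equivariantly: its canonical line bundle (the forms annihilated by the
`√-1`-eigenbundle) has an invariant, nowhere vanishing global section which is closed under the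
twisted de Rham differential. A form at a point is a nonzero element of the canonical line
exactly when its annihilator is the `√-1`-eigenspace. -/
structure IsEquivariantGCY (J : (Fin 4 → ℝ) → Matrix Idx Idx ℝ) : Prop where
  genComplex : IsGenComplex J
  equivariant : ∀ v x : Fin 4 → ℝ, J (x + v) = J x
  calabiYau : ∃ ρ : (Fin 4 → ℝ) → Spinor,
    (∀ I, ContDiff ℝ ∞ (fun x => ρ x I)) ∧
    (∀ v x : Fin 4 → ℝ, ρ (x + v) = ρ x) ∧
    (∀ (x : Fin 4 → ℝ) (v : DD ℂ), clifford v (ρ x) = 0 ↔ v ∈ plusEigen (J x)) ∧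
    (∀ x, twistedD ρ x = 0)

/-! ## The nilmanifold -/

/-- Coordinates `(x^*, x)` on `G × ℝ²`. -/
abbrev Pt : Type := DD ℝ

/-- The multiplication `(v^*, v) (w^*, w) = (v^* + w^* + ½ det (v, w, ·), v + w)`. -/
def gmul (p q : Pt) : Pt :=
  Sum.elim (cov p + cov q + (1 / 2 : ℝ) • cross (vec p) (vec q)) (vec p + vec q)

/-- The nilpotent Lie group `G × ℝ²`. -/
@[ext]
structure NilGroup where
  /-- exponential coordinates -/
  coord : Pt

@[simp] lemma cross_zero' {K : Type} [CommRing K] (v w : Fin 4 → K) : cross v w 0 = 0 := rfl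

@[simp] lemma cross_one' {K : Type} [CommRing K] (v w : Fin 4 → K) :
    cross v w 1 = v 2 * w 3 - v 3 * w 2 := rfl

@[simp] lemma cross_two' {K : Type} [CommRing K] (v w : Fin 4 → K) :
    cross v w 2 = v 3 * w 1 - v 1 * w 3 := rfl

@[simp] lemma cross_three' {K : Type} [CommRing K] (v w : Fin 4 → K) :
    cross v w 3 = v 1 * w 2 - v 2 * w 1 := rfl

@[simp] lemma vec_apply {K : Type} (u : DD K) (i : Fin 4) : vec u i = u (Sum.inr i) := rfl

@[simp] lemma cov_apply {K : Type} (u : DD K) (i : Fin 4) : cov u i = u (Sum.inl i) := rfl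

@[simp] lemma gmul_inl (p q : Pt) (i : Fin 4) : gmul p q (Sum.inl i) =
    p (Sum.inl i) + q (Sum.inl i) + 1 / 2 * cross (vec p) (vec q) i := rfl

@[simp] lemma gmul_inr (p q : Pt) (i : Fin 4) : gmul p q (Sum.inr i) =
    p (Sum.inr i) + q (Sum.inr i) := rfl

lemma gmul_assoc (p q r : Pt) : gmul (gmul p q) r = gmul p (gmul q r) := by
  funext a
  rcases a with i | i
  · fin_cases i <;> simp <;> ring
  · simp [add_assoc]

lemma zero_gmul (p : Pt) : gmul 0 p = p := by
  funext a
  rcases a with i | i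
  · fin_cases i <;> simp
  · simp

lemma gmul_zero (p : Pt) : gmul p 0 = p := by
  funext a
  rcases a with i | i
  · fin_cases i <;> simp
  · simp

lemma neg_gmul (p : Pt) : gmul (-p) p = 0 := by
  funext a
  rcases a with i | i
  · fin_cases i <;> simp <;> ring
  · simp

instance : Group NilGroup where
  mul g h := ⟨gmul g.coord h.coord⟩
  one := ⟨0⟩
  inv g := ⟨-g.coord⟩
  mul_assoc a b c := NilGroup.ext (gmul_assoc a.coord b.coord c.coord)
  one_mul a := NilGroup.ext (zero_gmul a.coord)
  mul_one a := NilGroup.ext (gmul_zero a.coord)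
  inv_mul_cancel a := NilGroup.ext (neg_gmul a.coord)

/-- The lattice `Γ ⊕ ℤ²`, generated by the basis vectors of `Λ ⊕ ℤ` and of its dual. The
nilmanifold `X × T²` is the quotient of `G × ℝ²` by left multiplication with this lattice. -/
def lattice : Subgroup NilGroup :=
  Subgroup.closure (Set.range fun a : Idx => (⟨Pi.single a 1⟩ : NilGroup))

/-- The differential of left translation by `p`. -/
def leftInv (p u : Pt) : Pt :=
  Sum.elim (cov u + (1 / 2 : ℝ) • cross (vec p) (vec u)) (vec u)

@[simp] lemma leftInv_inl (p u : Pt) (i : Fin 4) : leftInv p u (Sum.inl i) =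
    u (Sum.inl i) + 1 / 2 * cross (vec p) (vec u) i := rfl

@[simp] lemma leftInv_inr (p u : Pt) (i : Fin 4) : leftInv p u (Sum.inr i) = u (Sum.inr i) := rfl

/-- Left translation is affine with linear part `leftInv p`, which is therefore its
differential. -/
lemma gmul_add (p q u : Pt) : gmul p (q + u) = gmul p q + leftInv p u := by
  funext a
  rcases a with i | i
  · fin_cases i <;> simp <;> ring
  · simp [add_assoc]

lemma gmul_eq (p q : Pt) : gmul p q = p + leftInv p q := by
  have h := gmul_add p 0 q
  rwa [zero_add, gmul_zero] at h

lemma leftInv_gmul (p q u : Pt) : leftInv (gmul p q) u = leftInv p (leftInv q u) := by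
  funext a
  rcases a with i | i
  · fin_cases i <;> simp <;> ring
  · simp

/-- `leftInv p` as a continuous linear map. -/
def leftInvL (p : Pt) : Pt →L[ℝ] Pt :=
  LinearMap.toContinuousLinearMap
    { toFun := leftInv p
      map_add' := fun u v => by
        funext a
        rcases a with i | i
        · fin_cases i <;> simp <;> ring
        · simp
      map_smul' := fun c u => by
        funext a
        rcases a with i | i
        · fin_cases i <;> simp <;> ring
        · simp }

lemma leftInvL_apply (p u : Pt) : leftInvL p u = leftInv p u := rfl

lemma hasFDerivAt_gmul (p q : Pt) : HasFDerivAt (gmul p) (leftInvL p) q := by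
  have h : gmul p = fun q => p + leftInvL p q := by
    funext q
    rw [gmul_eq, leftInvL_apply]
  rw [h]
  exact (leftInvL p).hasFDerivAt.const_add p

/-- The matrix of the differential of left translation by `p`; its columns are the values at `p`
of the left-invariant vector fields, which trivialize `T(X × T²) ≅ (X × T²) × (𝔤 ⊕ 𝔱²)`. -/
def frame (p : Pt) : Matrix Idx Idx ℝ :=
  Matrix.of fun b a => leftInv p (Pi.single a 1) b

/-- A field of endomorphisms of the tangent spaces, given in coordinates, expressed in the
left-invariant frame. -/
def inFrame (J : Pt → Matrix Idx Idx ℝ) (p : Pt) : Matrix Idx Idx ℝ :=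
  (frame p)⁻¹ * J p * frame p

/-- The tautological pairing on the tangent space at `p`: the left-invariant metric of signature
`(4,4)` with value `pair` at the identity. -/
def metric (p u v : Pt) : ℝ :=
  pair (Matrix.mulVec (frame p)⁻¹ u) (Matrix.mulVec (frame p)⁻¹ v)

/-- A complex structure on `X × T²`: a smooth lattice-invariant endomorphism of the tangent
bundle of `G × ℝ²` (given in coordinates) with square `-1` and vanishing Nijenhuis tensor. -/
structure IsComplexStructure (J : Pt → Matrix Idx Idx ℝ) : Prop where
  smooth : ∀ a b, ContDiff ℝ ∞ (fun p => J p a b)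
  invariant : ∀ γ ∈ lattice, ∀ p : Pt, J (gmul γ.coord p) * frame γ.coord = frame γ.coord * J p
  square : ∀ p, J p * J p = -1
  integrable : ∀ V W : Pt → Pt, ContDiff ℝ ∞ V → ContDiff ℝ ∞ W → ∀ p,
    VectorField.lieBracket ℝ (fun q => Matrix.mulVec (J q) (V q))
        (fun q => Matrix.mulVec (J q) (W q)) p
      - Matrix.mulVec (J p) (VectorField.lieBracket ℝ (fun q => Matrix.mulVec (J q) (V q)) W p)
      - Matrix.mulVec (J p) (VectorField.lieBracket ℝ V (fun q => Matrix.mulVec (J q) (W q)) p)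
      - VectorField.lieBracket ℝ V W p = 0

/-- A complex structure on `X × T²` compatible with the tautological pairing, and equivariant for
the right action of `G × ℝ²` on `T(X × T²) ≅ (X × T²) × (𝔤 ⊕ 𝔱²)` (the action on the first
factor): in the left-invariant frame it is the same endomorphism of `𝔤 ⊕ 𝔱²` at all points. -/
structure IsEquivariantOrthogonalComplex (J : Pt → Matrix Idx Idx ℝ) : Prop where
  complex : IsComplexStructure J
  equivariant : ∀ p g : Pt, inFrame J (gmul p g) = inFrame J p
  orthogonal : ∀ p u v : Pt, metric p (Matrix.mulVec (J p) u) (Matrix.mulVec (J p) v)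
    = metric p u v

/-! ## Zero modes -/

/-- `C^∞(X × T²)`: smooth complex functions on `G × ℝ²` invariant under the lattice. -/
def smoothX : Submodule ℂ (Pt → ℂ) where
  carrier := {f | ContDiff ℝ ∞ f ∧ ∀ γ ∈ lattice, ∀ p : Pt, f (gmul γ.coord p) = f p}
  add_mem' := fun {f g} hf hg => ⟨hf.1.add hg.1, fun γ hγ p => by
    simp only [Pi.add_apply]
    rw [hf.2 γ hγ, hg.2 γ hγ]⟩
  zero_mem' := ⟨contDiff_const, fun _ _ _ => rfl⟩
  smul_mem' := fun c f hf => ⟨contDiff_const.smul hf.1, fun γ hγ p => by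
    simp only [Pi.smul_apply]
    rw [hf.2 γ hγ]⟩

/-- `C^∞(X × T²)` as a vector space: the zero modes of `𝓗 ⊗ 𝓗_{T²}`. -/
def ZeroX : Type := smoothX

instance : AddCommGroup ZeroX := inferInstanceAs (AddCommGroup smoothX)

instance : Module ℂ ZeroX := inferInstanceAs (Module ℂ smoothX)

lemma contDiff_leftInv (u : Pt) : ContDiff ℝ ∞ (fun p : Pt => leftInv p u) := by
  rw [contDiff_pi]
  intro a
  rcases a with i | i
  · fin_cases i <;> simp <;> fun_prop
  · simp only [leftInv_inr]
    exact contDiff_const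

/-- The derivative of the right translation action of `G × ℝ²` on `C^∞(X × T²)` along a basis
vector of `𝔤 ⊕ 𝔱²`: differentiation along a left-invariant vector field. -/
def actX (a : Idx) : Module.End ℂ ZeroX where
  toFun f := ⟨fun p => fderiv ℝ f.1 p (leftInv p (Pi.single a 1)), by
    obtain ⟨f, hf, hinv⟩ := f
    refine ⟨?_, fun γ hγ p => ?_⟩
    · exact (hf.fderiv_right (m := ∞) (by simp)).clm_apply (contDiff_leftInv _)
    · have hcomp : (f ∘ gmul γ.coord) = f := funext fun p => hinv γ hγ p
      have hd : DifferentiableAt ℝ f (gmul γ.coord p) :=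
        (hf.differentiable (by simp)).differentiableAt
      have h := (hd.hasFDerivAt.comp p (hasFDerivAt_gmul γ.coord p)).fderiv
      rw [hcomp] at h
      change fderiv ℝ f (gmul γ.coord p) (leftInv (gmul γ.coord p) (Pi.single a 1)) = _
      rw [leftInv_gmul]
      exact (congrArg (fun T : Pt →L[ℝ] ℂ => T (leftInv p (Pi.single a 1))) h).symm⟩
  map_add' f g := by
    apply Subtype.ext
    funext p
    have hf : DifferentiableAt ℝ f.1 p := (f.2.1.differentiable (by simp)).differentiableAt
    have hg : DifferentiableAt ℝ g.1 p := (g.2.1.differentiable (by simp)).differentiableAt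
    change fderiv ℝ (f.1 + g.1) p _ = _
    rw [fderiv_add hf hg]
    rfl
  map_smul' c f := by
    apply Subtype.ext
    funext p
    have hf : DifferentiableAt ℝ f.1 p := (f.2.1.differentiable (by simp)).differentiableAt
    change fderiv ℝ (c • f.1) p _ = _
    rw [fderiv_const_smul hf c]
    rfl

/-- Smooth sections of the line bundle `L_ν` on `Y`, `ν ∈ Λ ⊕ ℤ`, as smooth functions on `ℝ⁴`
with the factor of automorphy `exp (π√-1 det (e_i, x, ν))` for the lattice generators `e_i`. With
the connection `∇_i = ∂_i + π√-1 det (e_i, x, ν)` its first Chern form is `ι_ν det`. -/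
def sectionsL (ν : Fin 4 → ℤ) : Submodule ℂ ((Fin 4 → ℝ) → ℂ) where
  carrier := {s | ContDiff ℝ ∞ s ∧ ∀ (i : Fin 4) (x : Fin 4 → ℝ),
    s (x + Pi.single i 1) =
      Complex.exp (Real.pi * Complex.I * (det3 (Pi.single i 1) x (latt ν) : ℝ)) * s x}
  add_mem' := fun {s t} hs ht => ⟨hs.1.add ht.1, fun i x => by
    simp only [Pi.add_apply]
    rw [hs.2, ht.2, mul_add]⟩
  zero_mem' := ⟨contDiff_const, fun _ _ => by simp⟩
  smul_mem' := fun c s hs => ⟨contDiff_const.smul hs.1, fun i x => by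
    simp only [Pi.smul_apply, smul_eq_mul]
    rw [hs.2]
    ring⟩

/-- The connection `∇_i = ∂_i + π√-1 det (e_i, x, ν)` on functions on `ℝ⁴`. -/
def nabla (ν : Fin 4 → ℤ) (i : Fin 4) (s : (Fin 4 → ℝ) → ℂ) (x : Fin 4 → ℝ) : ℂ :=
  pd i s x + Real.pi * Complex.I * (det3 (Pi.single i 1) x (latt ν) : ℝ) * s x

lemma contDiff_det3 (i : Fin 4) (w : Fin 4 → ℝ) :
    ContDiff ℝ ∞ (fun x : Fin 4 → ℝ => det3 (Pi.single i 1) x w) := by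
  simp only [det3, Fin.sum_univ_four, cross_zero', cross_one', cross_two', cross_three']
  fun_prop

lemma det3_add (u v v' w : Fin 4 → ℝ) : det3 u (v + v') w = det3 u v w + det3 u v' w := by
  simp [det3, Fin.sum_univ_four]
  ring

lemma det3_swap (u v w : Fin 4 → ℝ) : det3 u v w = -det3 v u w := by
  simp [det3, Fin.sum_univ_four]
  ring

lemma hasFDerivAt_det3 (j : Fin 4) (w x : Fin 4 → ℝ) : ∃ D : (Fin 4 → ℝ) →L[ℝ] ℝ,
    HasFDerivAt (fun x : Fin 4 → ℝ => det3 (Pi.single j 1) x w) D x ∧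
      ∀ v, D v = det3 (Pi.single j 1) v w := by
  let D : (Fin 4 → ℝ) →L[ℝ] ℝ := LinearMap.toContinuousLinearMap
    { toFun := fun v => det3 (Pi.single j 1) v w
      map_add' := fun u v => det3_add _ _ _ _
      map_smul' := fun c v => by
        simp [det3, Fin.sum_univ_four]
        ring }
  exact ⟨D, D.hasFDerivAt, fun v => rfl⟩

lemma nabla_mem (ν : Fin 4 → ℤ) (i : Fin 4) {s : (Fin 4 → ℝ) → ℂ} (hs : s ∈ sectionsL ν) :
    nabla ν i s ∈ sectionsL ν := by
  obtain ⟨hsm, hq⟩ := hs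
  refine ⟨?_, fun j x => ?_⟩
  · have h1 : ContDiff ℝ ∞ (pd i s) :=
      (hsm.fderiv_right (m := ∞) (by simp)).clm_apply contDiff_const
    have h2 : ContDiff ℝ ∞ (fun x => ((det3 (Pi.single i 1) x (latt ν) : ℝ) : ℂ)) :=
      Complex.ofRealCLM.contDiff.comp (contDiff_det3 i (latt ν))
    exact h1.add ((contDiff_const.mul h2).mul hsm)
  · obtain ⟨D, hD, hDv⟩ := hasFDerivAt_det3 j (latt ν) x
    have hd : ∀ y, DifferentiableAt ℝ s y := fun y =>
      (hsm.differentiable (by simp)).differentiableAt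
    have hexp := (((Complex.ofRealCLM.hasFDerivAt.comp x hD).const_mul
      (Real.pi * Complex.I)).cexp).mul (hd x).hasFDerivAt
    have hshift : HasFDerivAt (fun y => s (y + Pi.single j 1))
        (fderiv ℝ s (x + Pi.single j 1)) x :=
      (hasFDerivAt_comp_add_right (Pi.single j 1)).mpr (hd (x + Pi.single j 1)).hasFDerivAt
    have heq : (fun y => s (y + Pi.single j 1)) = fun y =>
        Complex.exp (Real.pi * Complex.I * (det3 (Pi.single j 1) y (latt ν) : ℝ)) * s y :=
      funext fun y => hq j y
    rw [heq] at hshift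
    have hkey := congrArg (fun T => T (Pi.single i 1)) (hshift.unique hexp)
    have hdet := det3_swap (Pi.single i 1) (Pi.single j 1) (latt ν)
    simp only [nabla, pd]
    rw [hkey, hq j x, det3_add, hdet]
    simp [hDv]
    ring

/-- The action on smooth sections of `L_ν`: `α^i` acts by the scalar `-2π√-1 ν^i` given by the
winding, `β_i` acts by the covariant derivative `∇_i`. -/
def actL (ν : Fin 4 → ℤ) : Idx → Module.End ℂ (sectionsL ν)
  | Sum.inl i => (-(2 * Real.pi * Complex.I * (ν i : ℂ))) • LinearMap.id
  | Sum.inr i =>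
    { toFun := fun s => ⟨nabla ν i s.1, nabla_mem ν i s.2⟩
      map_add' := fun s t => by
        apply Subtype.ext
        funext x
        have hs : DifferentiableAt ℝ s.1 x := (s.2.1.differentiable (by simp)).differentiableAt
        have ht : DifferentiableAt ℝ t.1 x := (t.2.1.differentiable (by simp)).differentiableAt
        change fderiv ℝ (s.1 + t.1) x _ + _ * (s.1 x + t.1 x) = (fderiv ℝ s.1 x _ + _ * s.1 x)
          + (fderiv ℝ t.1 x _ + _ * t.1 x)
        rw [fderiv_add hs ht]
        simp only [add_apply]
        ring
      map_smul' := fun c s => by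
        apply Subtype.ext
        funext x
        have hs : DifferentiableAt ℝ s.1 x := (s.2.1.differentiable (by simp)).differentiableAt
        change fderiv ℝ (c • s.1) x _ + _ * (c * s.1 x) = c * (fderiv ℝ s.1 x _ + _ * s.1 x)
        rw [fderiv_const_smul hs c]
        simp only [smul_apply, smul_eq_mul]
        ring }

/-- The action of a word in the basis of `𝔤 ⊕ 𝔱²` on smooth sections of `L_ν`. -/
def wordL (ν : Fin 4 → ℤ) (w : List Idx) : Module.End ℂ (sectionsL ν) := (w.map (actL ν)).prod

/-- The square of the `L²`-norm of a section of `L_ν`, an integral over `Y`. -/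
def normSqL (ν : Fin 4 → ℤ) (s : sectionsL ν) : ℝ :=
  ∫ x in Set.Icc (0 : Fin 4 → ℝ) 1, ‖s.1 x‖ ^ 2

lemma integrable_normSq (ν : Fin 4 → ℤ) (s : sectionsL ν) :
    MeasureTheory.IntegrableOn (fun x => ‖s.1 x‖ ^ 2) (Set.Icc (0 : Fin 4 → ℝ) 1) :=
  ((s.2.1.continuous.norm.pow 2).continuousOn).integrableOn_compact isCompact_Icc

lemma normSqL_nonneg (ν : Fin 4 → ℤ) (s : sectionsL ν) : 0 ≤ normSqL ν s :=
  MeasureTheory.integral_nonneg fun _ => by positivity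

lemma normSqL_add_le (ν : Fin 4 → ℤ) (s t : sectionsL ν) :
    normSqL ν (s + t) ≤ 2 * normSqL ν s + 2 * normSqL ν t := by
  unfold normSqL
  rw [← MeasureTheory.integral_const_mul, ← MeasureTheory.integral_const_mul,
    ← MeasureTheory.integral_add ((integrable_normSq ν s).const_mul 2)
      ((integrable_normSq ν t).const_mul 2)]
  refine MeasureTheory.integral_mono (integrable_normSq ν (s + t))
    (((integrable_normSq ν s).const_mul 2).add ((integrable_normSq ν t).const_mul 2)) ?_
  intro x
  have h1 : ‖s.1 x + t.1 x‖ ≤ ‖s.1 x‖ + ‖t.1 x‖ := norm_add_le _ _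
  have h2 := norm_nonneg (s.1 x + t.1 x)
  change ‖s.1 x + t.1 x‖ ^ 2 ≤ 2 * ‖s.1 x‖ ^ 2 + 2 * ‖t.1 x‖ ^ 2
  nlinarith [sq_nonneg (‖s.1 x‖ - ‖t.1 x‖)]

lemma normSqL_smul (ν : Fin 4 → ℤ) (c : ℂ) (s : sectionsL ν) :
    normSqL ν (c • s) = ‖c‖ ^ 2 * normSqL ν s := by
  unfold normSqL
  rw [← MeasureTheory.integral_const_mul]
  congr 1
  funext x
  change ‖c * s.1 x‖ ^ 2 = _
  rw [norm_mul, mul_pow]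

/-- The zero modes of `(Y, det)`: the smooth vectors of `⨁_ν L²(L_ν)`, that is, the families of
smooth sections of the `L_ν` that are square summable together with all their images under
products of elements of `𝔤 ⊕ 𝔱²`. -/
def zeroModesY : Submodule ℂ (∀ ν : Fin 4 → ℤ, sectionsL ν) where
  carrier := {s | ∀ w : List Idx, Summable fun ν => normSqL ν (wordL ν w (s ν))}
  add_mem' := fun {s t} hs ht w => by
    refine Summable.of_nonneg_of_le (fun ν => normSqL_nonneg ν _) (fun ν => ?_)
      (((hs w).mul_left 2).add ((ht w).mul_left 2))
    simp only [Pi.add_apply, map_add]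
    exact normSqL_add_le ν _ _
  zero_mem' := fun w => by
    have h : (fun ν => normSqL ν (wordL ν w ((0 : ∀ ν : Fin 4 → ℤ, sectionsL ν) ν)))
        = fun _ => 0 := by
      funext ν
      simp [normSqL]
    rw [h]
    exact summable_zero
  smul_mem' := fun c s hs w => by
    simp only [Pi.smul_apply, map_smul, normSqL_smul]
    exact (hs w).mul_left _

/-- The vector space of zero modes of `𝓗_Y`. -/
def ZeroY : Type := zeroModesY

instance : AddCommGroup ZeroY := inferInstanceAs (AddCommGroup zeroModesY)

instance : Module ℂ ZeroY := inferInstanceAs (Module ℂ zeroModesY)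

/-- The action of the basis of `𝔤 ⊕ 𝔱²` on the zero modes of `(Y, det)`. -/
def actY (a : Idx) : Module.End ℂ ZeroY where
  toFun s := ⟨fun ν => actL ν a (s.1 ν), fun w => by
    have h := s.2 (w ++ [a])
    simpa [wordL] using h⟩
  map_add' s t := by
    apply Subtype.ext
    funext ν
    exact map_add (actL ν a) _ _
  map_smul' c s := by
    apply Subtype.ext
    funext ν
    exact map_smul (actL ν a) _ _

/-! ## The mode algebra of `V((𝔤 ⊕ 𝔱²)_super)` and induced modules -/

/-- Generators: the even modes `u_n` of degree `n`, and the odd modes `ū_k` of degree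
`k + 1/2`. -/
inductive Gen : Type
  | even (u : DD ℂ) (n : ℤ)
  | odd (u : DD ℂ) (k : ℤ)

/-- Shorthand for the generators in the free algebra. -/
def fe (u : DD ℂ) (n : ℤ) : FreeAlgebra ℂ Gen := FreeAlgebra.ι ℂ (Gen.even u n)

/-- Shorthand for the generators in the free algebra. -/
def fo (u : DD ℂ) (k : ℤ) : FreeAlgebra ℂ Gen := FreeAlgebra.ι ℂ (Gen.odd u k)

/-- Linearity, and the super-commutators
`[u_m, v_n] = [u, v]_{m+n} + m (u, v) δ_{m,-n}`, `[u_m, v̄_r] = (overline [u, v])_{m+r}`,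
`[ū_r, v̄_s] = (u, v) δ_{r,-s}` for `r = k + 1/2`, `s = l + 1/2`. -/
inductive ModeRel : FreeAlgebra ℂ Gen → FreeAlgebra ℂ Gen → Prop
  | even_add (u v : DD ℂ) (n : ℤ) : ModeRel (fe (u + v) n) (fe u n + fe v n)
  | even_smul (c : ℂ) (u : DD ℂ) (n : ℤ) : ModeRel (fe (c • u) n) (c • fe u n)
  | odd_add (u v : DD ℂ) (k : ℤ) : ModeRel (fo (u + v) k) (fo u k + fo v k)
  | odd_smul (c : ℂ) (u : DD ℂ) (k : ℤ) : ModeRel (fo (c • u) k) (c • fo u k)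
  | even_even (u v : DD ℂ) (m n : ℤ) :
      ModeRel (fe u m * fe v n) (fe v n * fe u m + fe (bracket u v) (m + n)
        + algebraMap ℂ (FreeAlgebra ℂ Gen) (if m + n = 0 then (m : ℂ) * pair u v else 0))
  | even_odd (u v : DD ℂ) (m k : ℤ) :
      ModeRel (fe u m * fo v k) (fo v k * fe u m + fo (bracket u v) (m + k))
  | odd_odd (u v : DD ℂ) (k l : ℤ) :
      ModeRel (fo u k * fo v l) (-(fo v l * fo u k)
        + algebraMap ℂ (FreeAlgebra ℂ Gen) (if k + l + 1 = 0 then pair u v else 0))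

/-- The algebra of modes of `V((𝔤 ⊕ 𝔱²)_super)`: the enveloping algebra of the affine Lie
super-algebra with its central element set equal to `1`. -/
def ModeAlgebra : Type := RingQuot ModeRel

instance : Ring ModeAlgebra := inferInstanceAs (Ring (RingQuot ModeRel))

instance : Algebra ℂ ModeAlgebra := inferInstanceAs (Algebra ℂ (RingQuot ModeRel))

/-- A generator as an element of the mode algebra. -/
def mode (g : Gen) : ModeAlgebra := RingQuot.mkAlgHom ℂ ModeRel (FreeAlgebra.ι ℂ g)

/-- The module induced from a space `Z` on which the basis of `𝔤 ⊕ 𝔱²` acts by `E`: modes of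
positive degree annihilate `Z` and `u_0` acts on `Z` as `u`. -/
def indRelations {Z : Type} [AddCommGroup Z] [Module ℂ Z] (E : Idx → Module.End ℂ Z) :
    Submodule ModeAlgebra (ModeAlgebra ⊗[ℂ] Z) :=
  Submodule.span ModeAlgebra
    ({t | ∃ (u : DD ℂ) (n : ℤ) (z : Z), 0 < n ∧ t = mode (Gen.even u n) ⊗ₜ[ℂ] z} ∪
     {t | ∃ (u : DD ℂ) (k : ℤ) (z : Z), 0 ≤ k ∧ t = mode (Gen.odd u k) ⊗ₜ[ℂ] z} ∪
     {t | ∃ (u : DD ℂ) (z : Z),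
        t = mode (Gen.even u 0) ⊗ₜ[ℂ] z - (1 : ModeAlgebra) ⊗ₜ[ℂ] (∑ a, u a • E a z)})

/-- The induced module. -/
def Ind {Z : Type} [AddCommGroup Z] [Module ℂ Z] (E : Idx → Module.End ℂ Z) : Type :=
  (ModeAlgebra ⊗[ℂ] Z) ⧸ indRelations E

section Induced

variable {Z : Type} [AddCommGroup Z] [Module ℂ Z] (E : Idx → Module.End ℂ Z)

instance : AddCommGroup (Ind E) :=
  inferInstanceAs (AddCommGroup ((ModeAlgebra ⊗[ℂ] Z) ⧸ indRelations E))

instance : Module ModeAlgebra (Ind E) :=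
  inferInstanceAs (Module ModeAlgebra ((ModeAlgebra ⊗[ℂ] Z) ⧸ indRelations E))

instance : Module ℂ (Ind E) :=
  inferInstanceAs (Module ℂ ((ModeAlgebra ⊗[ℂ] Z) ⧸ indRelations E))

instance : IsScalarTower ℂ ModeAlgebra (Ind E) :=
  inferInstanceAs (IsScalarTower ℂ ModeAlgebra ((ModeAlgebra ⊗[ℂ] Z) ⧸ indRelations E))

/-- The canonical map from the zero modes to the induced module. -/
def incl (z : Z) : Ind E :=
  (Submodule.Quotient.mk ((1 : ModeAlgebra) ⊗ₜ[ℂ] z) : (ModeAlgebra ⊗[ℂ] Z) ⧸ indRelations E)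

/-- The `n`-th mode of a field acting on the induced module. -/
def op (g : ℤ → Gen) (n : ℤ) : Module.End ℂ (Ind E) := Algebra.lsmul ℂ ℂ (Ind E) (mode (g n))

/-- The number of odd factors of a word. -/
def oddCount : List Gen → ZMod 2
  | [] => 0
  | Gen.even _ _ :: w => oddCount w
  | Gen.odd _ _ :: w => oddCount w + 1

/-- The even and the odd part of the induced module. -/
def parityPart (p : ZMod 2) : Submodule ℂ (Ind E) :=
  Submodule.span ℂ {v | ∃ (w : List Gen) (z : Z), oddCount w = p ∧
    v = (w.map mode).prod • incl E z}

end Induced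

/-! ## `N = 2` super-conformal structures -/

/-- An `N = 2` super-conformal structure of central charge `c` on a super-space `M` with even
part `P 0` and odd part `P 1`: fields `L(z) = ∑ L_n z^{-n-2}`, `J(z) = ∑ J_n z^{-n-1}`,
`G^±(z) = ∑ G^±_r z^{-r-3/2}` on `M`, whose modes satisfy the (Neveu-Schwarz) `N = 2`
super-conformal algebra. Here `Gp k` and `Gm k` are the modes with `r = k + 1/2`. -/
@[ext]
structure N2Structure (c : ℂ) (M : Type) [AddCommGroup M] [Module ℂ M]
    (P : ZMod 2 → Submodule ℂ M) where
  L : ℤ → Module.End ℂ M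
  J : ℤ → Module.End ℂ M
  Gp : ℤ → Module.End ℂ M
  Gm : ℤ → Module.End ℂ M
  L_field : ∀ v, ∃ N : ℤ, ∀ n ≥ N, L n v = 0
  J_field : ∀ v, ∃ N : ℤ, ∀ n ≥ N, J n v = 0
  Gp_field : ∀ v, ∃ N : ℤ, ∀ k ≥ N, Gp k v = 0
  Gm_field : ∀ v, ∃ N : ℤ, ∀ k ≥ N, Gm k v = 0
  L_even : ∀ n p, ∀ v ∈ P p, L n v ∈ P p
  J_even : ∀ n p, ∀ v ∈ P p, J n v ∈ P p
  Gp_odd : ∀ k p, ∀ v ∈ P p, Gp k v ∈ P (p + 1)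
  Gm_odd : ∀ k p, ∀ v ∈ P p, Gm k v ∈ P (p + 1)
  L_L : ∀ m n : ℤ, L m * L n - L n * L m = ((m : ℂ) - n) • L (m + n)
    + (if m + n = 0 then c / 12 * ((m : ℂ) ^ 3 - m) else 0) • 1
  L_J : ∀ m n : ℤ, L m * J n - J n * L m = (-(n : ℂ)) • J (m + n)
  L_Gp : ∀ m k : ℤ, L m * Gp k - Gp k * L m = ((m : ℂ) / 2 - (k + 1 / 2)) • Gp (m + k)
  L_Gm : ∀ m k : ℤ, L m * Gm k - Gm k * L m = ((m : ℂ) / 2 - (k + 1 / 2)) • Gm (m + k)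
  J_J : ∀ m n : ℤ, J m * J n - J n * J m = (if m + n = 0 then c / 3 * (m : ℂ) else 0) • 1
  J_Gp : ∀ m k : ℤ, J m * Gp k - Gp k * J m = Gp (m + k)
  J_Gm : ∀ m k : ℤ, J m * Gm k - Gm k * J m = -Gm (m + k)
  Gp_Gp : ∀ k l : ℤ, Gp k * Gp l + Gp l * Gp k = 0
  Gm_Gm : ∀ k l : ℤ, Gm k * Gm l + Gm l * Gm k = 0
  Gp_Gm : ∀ k l : ℤ, Gp k * Gm l + Gm l * Gp k = L (k + l + 1)
    + (((k : ℂ) - l) / 2) • J (k + l + 1)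
    + (if k + l + 1 = 0 then c / 6 * (((k : ℂ) + 1 / 2) ^ 2 - 1 / 4) else 0) • 1

/-- `c(z) = ∑ c_n z^{-n-1}` is the normally ordered product `:a(z) b(z):` of
`a(z) = ∑ a_n z^{-n-1}` and `b(z) = ∑ b_n z^{-n-1}`; the sign is `-1` if both are odd, and `1`
otherwise. The sum defining each mode of the product is required to be finite on every vector. -/
def IsNormalProduct {M : Type} [AddCommGroup M] [Module ℂ M] (sign : ℂ)
    (a b c : ℤ → Module.End ℂ M) : Prop :=
  ∀ (n : ℤ) (v : M),
    (Function.support fun j : ℤ =>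
      if j < 0 then a j (b (n - 1 - j) v) else sign • b (n - 1 - j) (a j v)).Finite ∧
    c n v = ∑ᶠ j : ℤ, if j < 0 then a j (b (n - 1 - j) v) else sign • b (n - 1 - j) (a j v)

/-- `e` is a basis of the isotropic subspace `𝔩` and `e'` is the dual basis of `𝔩'`, where `𝔩'` is
identified with the dual of `𝔩` by the pairing. -/
structure IsDualBases (𝔩 𝔩' : Submodule ℂ (DD ℂ)) (e e' : Fin 4 → DD ℂ) : Prop where
  indep : LinearIndependent ℂ e
  span : Submodule.span ℂ (Set.range e) = 𝔩
  mem : ∀ i, e' i ∈ 𝔩'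
  dual : ∀ i j, pair (e' i) (e j) = if i = j then 1 else 0

/-- The super-field `J(z) + θ (G^-(z) - G^+(z))` of an `N = 2` structure on an induced module is
the super-field `∑ ē^i ē_i` given by dual bases `e_i`, `e^i`; here `ē(z, θ) = ē(z) + θ e(z)`, so
the components are `∑ :ē^i ē_i:` and `∑ (:e^i ē_i: - :ē^i e_i:)`. -/
def IsGeneratedBy {Z : Type} [AddCommGroup Z] [Module ℂ Z] {E : Idx → Module.End ℂ Z} {c : ℂ}
    (S : N2Structure c (Ind E) (parityPart E)) (e e' : Fin 4 → DD ℂ) : Prop :=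
  ∃ F A B : Fin 4 → ℤ → Module.End ℂ (Ind E),
    (∀ i, IsNormalProduct (-1) (op E (Gen.odd (e' i))) (op E (Gen.odd (e i))) (F i)) ∧
    (∀ i, IsNormalProduct 1 (op E (Gen.even (e' i))) (op E (Gen.odd (e i))) (A i)) ∧
    (∀ i, IsNormalProduct 1 (op E (Gen.odd (e' i))) (op E (Gen.even (e i))) (B i)) ∧
    (∀ n, S.J n = ∑ i, F i n) ∧
    (∀ k, S.Gm k - S.Gp k = ∑ i, (A i (k + 1) - B i (k + 1)))

/-- The `N = 2` structure on an induced module associated with the splitting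
`(𝔤 ⊕ 𝔱²) ⊗ ℂ = 𝔩 ⊕ 𝔩̄` into the `±√-1`-eigenspaces of an endomorphism: the one generated by
`∑ ē^i ē_i` for dual bases of `𝔩` and `𝔩̄`. -/
def IsAssociated {Z : Type} [AddCommGroup Z] [Module ℂ Z] {E : Idx → Module.End ℂ Z} {c : ℂ}
    (T : Matrix Idx Idx ℝ) (S : N2Structure c (Ind E) (parityPart E)) : Prop :=
  (∃ e e', IsDualBases (plusEigen T) (minusEigen T) e e') ∧
  ∀ e e', IsDualBases (plusEigen T) (minusEigen T) e e' → IsGeneratedBy S e e'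

/-- The space of states `𝓗 ⊗ 𝓗_{T²}`, induced from `C^∞(X × T²)`. -/
abbrev HX : Type := Ind actX

/-- The space of states `𝓗_Y` of `(Y, det)`, induced from the zero modes. -/
abbrev HY : Type := Ind actY

/-- The parity of `𝓗 ⊗ 𝓗_{T²}`. -/
abbrev parityX : ZMod 2 → Submodule ℂ HX := parityPart actX

/-- The parity of `𝓗_Y`. -/
abbrev parityY : ZMod 2 → Submodule ℂ HY := parityPart actY

/-- The inclusion of the zero modes of `𝓗 ⊗ 𝓗_{T²}`. -/
abbrev inclX (f : ZeroX) : HX := incl actX f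

/-- The inclusion of the zero modes of `𝓗_Y`. -/
abbrev inclY (s : ZeroY) : HY := incl actY s

/-- `N = 2` structures of central charge `12` on `𝓗 ⊗ 𝓗_{T²}`. -/
abbrev N2X : Type := N2Structure 12 HX parityX

/-- `N = 2` structures of central charge `12` on `𝓗_Y`. -/
abbrev N2Y : Type := N2Structure 12 HY parityY

/-- The `N = 2` structure `S` on `𝓗 ⊗ 𝓗_{T²}` is associated with the endomorphism `T`. -/
def AssociatedX (T : Matrix Idx Idx ℝ) (S : N2X) : Prop :=
  IsAssociated (E := actX) T S

/-- The `N = 2` structure `S` on `𝓗_Y` is associated with the endomorphism `T`. -/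
def AssociatedY (T : Matrix Idx Idx ℝ) (S : N2Y) : Prop :=
  IsAssociated (E := actY) T S

/-- The Fourier coefficient `∫ f(x^*, x) exp (2π√-1 ν·x^*) dx^*` over the fibre of
`X × T² → Y`. -/
def fourierCoeffX (f : Pt → ℂ) (ν : Fin 4 → ℤ) (x : Fin 4 → ℝ) : ℂ :=
  ∫ y in Set.Icc (0 : Fin 4 → ℝ) 1,
    f (Sum.elim y x) * Complex.exp (2 * Real.pi * Complex.I * (∑ i, latt ν i * y i : ℝ))

end GerbyTorus

end

open GerbyTorus

noncomputable section

namespace GerbyTorus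

/-! ## Locally finite sums of operators -/

section LocSum

variable {M : Type} [AddCommGroup M] [Module ℂ M]

/-! All structures on both sides come from one algebraic object: a real orthogonal endomorphism `T`
of `𝔡` with `T² = -1` whose `√-1`-eigenspace `𝔩` is a subalgebra (`IsLieComplex`). Invariance makes
each structure a constant matrix in the given frame. On `Y`, derivatives of sections of a constant
isotropic subbundle stay in it, so involutivity amounts to closedness of `𝔩` under the bracket
(`dorfman_eq`, `pdField_mem`). The Calabi–Yau condition is automatic: contractions of `det` permute
the spinors killed by `𝔩` and multiply to zero, `det` squares to zero, and so some nonzero spinor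
killed by `𝔩` is closed (`exists_closed_spinor`). On `X × T²`, the Nijenhuis tensor is computed in
the left-invariant frame (`nijenhuis_leftField`), and it vanishes exactly when `𝔩` is a subalgebra
(`closed_iff_nijenhuis`). This gives (b).

For the `N = 2` algebra, take dual bases `e_i` of `𝔩` and `e^i` of its conjugate. Let `J` and `Q =
G^- - G^+` be the prescribed normally ordered products and put `R = [Q, J_0]`. By the Wick formulas,
`J_0` gives the odd modes of `e^i`, `e_i` the charges `1`, `-1`. Closedness of both subalgebras says
that `[J_0, ·]` sends modes of `e^k`, `e_k` to operators of charge `2`, `-2` (`JJ_JJ_ev`). Together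
with `∑ [e^i, e_i] = 0` this shows that `R` turns odd modes into even ones (`RR_od`). The reverse
relation `RR_ev` would need a Wick computation with cubic fields. Instead, the defect anticommutes
with all odd modes, hence commutes with `J_0`. But by construction it only has odd charges, so it is
zero (`eq_zero_of_odd_charge`). The remaining brackets of `J`, `Q`, `R` follow by applying `[J_m,
·]`, and those of `L` follow from Jacobi identities. The level `4` of `J` is `c / 3`, so `c = 12`.
The identity `∑ [e^i, e_i] = 0` says that adjoint operators on the two subalgebras are traceless;
they are nilpotent since `𝔡` is two-step nilpotent (`sum_pair_bracket_eq_zero`).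

Uniqueness holds because `[J_0, ·]` separates `G^+` from `G^-` in their difference, and `L` is then
read off from `[G^+, G^-]`. For the same reason every module isomorphism intertwines the structures
(`intertwines_of_isGeneratedBy`).

What remains is that the fibrewise Fourier transform identifies the zero modes as representations of
`𝔡`. Equivariance is integration by parts along the fibres (`fourier_actX`), the isometry is
Parseval on each fibre (`ZeroX.hasSum_normSq`), and injectivity is uniqueness of Fourier
coefficients. For surjectivity, a Sobolev inequality with constants independent of the line bundle
(`exists_norm_section_le`), applied after multiplying by `1 - (α^i)²`, gives summable decay of a
smooth vector. Its Fourier series can therefore be differentiated term by term along the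
left-invariant frame. -/

/-- The operators `x j` are finite in number on every vector and add up to `X`. -/
def LocSum (x : ℤ → Module.End ℂ M) (X : Module.End ℂ M) : Prop :=
  ∀ v, (Function.support fun j => x j v).Finite ∧ X v = ∑ᶠ j, x j v

/-- A sequence of operators of which almost all annihilate a given vector. -/
def IsField (a : ℤ → Module.End ℂ M) : Prop := ∀ v, ∃ N : ℤ, ∀ n ≥ N, a n v = 0

lemma LocSum.unique {x : ℤ → Module.End ℂ M} {X Y : Module.End ℂ M}
    (hX : LocSum x X) (hY : LocSum x Y) : X = Y :=
  LinearMap.ext fun v => (hX v).2.trans (hY v).2.symm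

lemma LocSum.exists_of_finite {x : ℤ → Module.End ℂ M}
    (h : ∀ v, (Function.support fun j => x j v).Finite) : ∃ X, LocSum x X := by
  refine ⟨{ toFun := fun v => ∑ᶠ j, x j v, map_add' := fun v w => ?_, map_smul' := fun c v => ?_ },
    fun v => ⟨h v, rfl⟩⟩
  · simp only [map_add]
    exact finsum_add_distrib (h v) (h w)
  · simp only [map_smul, RingHom.id_apply]
    exact (smul_finsum' c (h v)).symm

lemma LocSum.add {x y : ℤ → Module.End ℂ M} {X Y : Module.End ℂ M}
    (hX : LocSum x X) (hY : LocSum y Y) : LocSum (fun j => x j + y j) (X + Y) := fun v => by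
  refine ⟨((hX v).1.union (hY v).1).subset fun j hj => ?_, ?_⟩
  · by_contra hc
    simp only [Set.mem_union, Function.mem_support, not_or, not_not] at hc
    exact hj (by simp [hc.1, hc.2])
  · simp only [LinearMap.add_apply, (hX v).2, (hY v).2]
    exact (finsum_add_distrib (hX v).1 (hY v).1).symm

lemma LocSum.mul_left {x : ℤ → Module.End ℂ M} {X : Module.End ℂ M}
    (D : Module.End ℂ M) (hX : LocSum x X) : LocSum (fun j => D * x j) (D * X) := fun v => by
  refine ⟨(hX v).1.subset fun j hj hc => hj (by simp [Module.End.mul_apply, hc]), ?_⟩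
  simp only [Module.End.mul_apply, (hX v).2]
  exact D.toAddMonoidHom.map_finsum (hX v).1

lemma LocSum.mul_right {x : ℤ → Module.End ℂ M} {X : Module.End ℂ M}
    (D : Module.End ℂ M) (hX : LocSum x X) : LocSum (fun j => x j * D) (X * D) := fun v =>
  hX (D v)

lemma LocSum.smul {x : ℤ → Module.End ℂ M} {X : Module.End ℂ M}
    (c : ℂ) (hX : LocSum x X) : LocSum (fun j => c • x j) (c • X) := by
  have h := hX.mul_left (c • 1)
  simpa using h

lemma LocSum.neg {x : ℤ → Module.End ℂ M} {X : Module.End ℂ M}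
    (hX : LocSum x X) : LocSum (fun j => -x j) (-X) := by
  simpa using hX.smul (-1)

lemma LocSum.sub {x y : ℤ → Module.End ℂ M} {X Y : Module.End ℂ M}
    (hX : LocSum x X) (hY : LocSum y Y) : LocSum (fun j => x j - y j) (X - Y) := by
  simpa [sub_eq_add_neg] using hX.add hY.neg

lemma LocSum.single (c : ℤ) (A : Module.End ℂ M) :
    LocSum (fun j => if j = c then A else 0) A := fun v => by
  constructor
  · refine (Set.finite_singleton c).subset fun j hj => ?_
    by_contra hc
    exact hj (by simp [show ¬ j = c from hc])
  · rw [finsum_eq_single _ c (fun j hj => by simp [hj])]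
    simp

lemma LocSum.shift {x : ℤ → Module.End ℂ M} {X : Module.End ℂ M}
    (m : ℤ) (hX : LocSum x X) : LocSum (fun j => x (j + m)) X := fun v => by
  constructor
  · exact ((hX v).1.preimage (add_left_injective m).injOn)
  · rw [(hX v).2]
    exact (finsum_comp_equiv (Equiv.addRight m) (f := fun j => x j v)).symm

lemma LocSum.congr {x y : ℤ → Module.End ℂ M} {X : Module.End ℂ M}
    (hX : LocSum x X) (h : ∀ j, x j = y j) : LocSum y X := by
  rwa [← funext h]

/-- Moving the place at which two orders of multiplication are separated. -/
lemma LocSum.cut {A B : ℤ → Module.End ℂ M} {X : Module.End ℂ M} {c₀ : ℤ}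
    (hX : LocSum (fun j => if j < c₀ then A j else B j) X) (P : ℤ → Module.End ℂ M)
    (h0 : P c₀ = 0) (hP : ∀ c, P (c + 1) = P c + (A c - B c)) (c : ℤ) :
    LocSum (fun j => if j < c then A j else B j) (X + P c) := by
  induction c using Int.inductionOn' (b := c₀) with
  | zero => simpa [h0] using hX
  | succ c _ ih =>
    have h := ih.add (LocSum.single c (A c - B c))
    rw [add_assoc, ← hP] at h
    refine h.congr fun j => ?_
    rcases lt_trichotomy j c with hj | hj | hj
    · simp [hj, hj.ne, hj.trans (lt_add_one c)]
    · subst hj; simp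
    · simp [hj.ne', not_lt.mpr hj.le, not_lt.mpr (Int.add_one_le_of_lt hj)]
  | pred c _ ih =>
    have h := ih.sub (LocSum.single (c - 1) (A (c - 1) - B (c - 1)))
    have h2 := hP (c - 1)
    rw [sub_add_cancel] at h2
    rw [h2, ← add_assoc, add_sub_cancel_right] at h
    refine h.congr fun j => ?_
    rcases lt_trichotomy j (c - 1) with hj | hj | hj
    · simp [hj, hj.ne, show j < c by omega]
    · subst hj; simp
    · simp [hj.ne', not_lt.mpr hj.le, show ¬ j < c by omega]

lemma finite_support_of_bounds {M : Type} [AddCommGroup M] {f : ℤ → M} {a b : ℤ} (ha : ∀ j < a, f j = 0)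
    (hb : ∀ j > b, f j = 0) : (Function.support f).Finite := by
  refine (Set.finite_Icc a b).subset fun j hj => ⟨?_, ?_⟩
  · by_contra hc; exact hj (ha j (not_le.mp hc))
  · by_contra hc; exact hj (hb j (not_le.mp hc))

/-- The terms of a normally ordered product. -/
def nterm (s : ℂ) (a b : ℤ → Module.End ℂ M) (N j : ℤ) : Module.End ℂ M :=
  if j < 0 then a j * b (N - j) else s • (b (N - j) * a j)

/-- For very negative `j` the factor `b_{N-j}` stands on the right and has large degree; for large
`j` the factor `a_j` does. -/
lemma nterm_finite (s : ℂ) {a b : ℤ → Module.End ℂ M} (ha : IsField a) (hb : IsField b) (N : ℤ)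
    (v : M) : (Function.support fun j => nterm s a b N j v).Finite := by
  obtain ⟨p, hp⟩ := ha v
  obtain ⟨q, hq⟩ := hb v
  refine finite_support_of_bounds (a := min 0 (N - q)) (b := max 0 p) (fun j hj => ?_)
    (fun j hj => ?_)
  · have h1 : j < 0 := lt_of_lt_of_le hj (min_le_left _ _)
    have h2 : N - j ≥ q := by have := lt_of_lt_of_le hj (min_le_right _ _); omega
    simp [nterm, h1, Module.End.mul_apply, hq _ h2]
  · have h1 : ¬ j < 0 := not_lt.mpr ((le_max_left _ _).trans hj.le)
    have h2 : j ≥ p := (le_max_right _ _).trans hj.le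
    simp [nterm, h1, Module.End.mul_apply, hp _ h2]

/-- The modes of the normally ordered product of two fields, `∑ a_j b_{N-j}` in normal order. -/
def NO (s : ℂ) (a b : ℤ → Module.End ℂ M) (N : ℤ) : Module.End ℂ M :=
  Classical.epsilon (LocSum (nterm s a b N))

lemma locSum_NO (s : ℂ) {a b : ℤ → Module.End ℂ M} (ha : IsField a) (hb : IsField b) (N : ℤ) :
    LocSum (nterm s a b N) (NO s a b N) :=
  Classical.epsilon_spec (LocSum.exists_of_finite (nterm_finite s ha hb N))

/-- `NO` is indexed by the sum of the two indices, which is `n - 1` in the `n`-th mode of the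
product; hence the shift by one. -/
lemma isNormalProduct_NO (s : ℂ) {a b : ℤ → Module.End ℂ M} (ha : IsField a) (hb : IsField b) :
    IsNormalProduct s a b (fun n => NO s a b (n - 1)) := fun n v => by
  have h := locSum_NO s ha hb (n - 1) v
  have e : (fun j => nterm s a b (n - 1) j v) =
      fun j : ℤ => if j < 0 then a j (b (n - 1 - j) v) else s • b (n - 1 - j) (a j v) := by
    funext j
    unfold nterm
    split_ifs <;> rfl
  rw [e] at h
  exact h

lemma IsNormalProduct.eq_NO {s : ℂ} {a b c : ℤ → Module.End ℂ M}
    (h : IsNormalProduct s a b c) (ha : IsField a) (hb : IsField b) (n : ℤ) :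
    c n = NO s a b (n - 1) :=
  LinearMap.ext fun v => (h n v).2.trans (isNormalProduct_NO s ha hb n v).2.symm

lemma IsField.add {a b : ℤ → Module.End ℂ M} (ha : IsField a) (hb : IsField b) :
    IsField fun n => a n + b n := fun v => by
  obtain ⟨p, hp⟩ := ha v
  obtain ⟨q, hq⟩ := hb v
  exact ⟨max p q, fun n hn => by
    simp [hp n (le_of_max_le_left hn), hq n (le_of_max_le_right hn)]⟩

lemma IsField.mul_left {a : ℤ → Module.End ℂ M} (ha : IsField a) (D : Module.End ℂ M) :
    IsField fun n => D * a n := fun v => by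
  obtain ⟨p, hp⟩ := ha v
  exact ⟨p, fun n hn => by simp [Module.End.mul_apply, hp n hn]⟩

lemma IsField.mul_right {a : ℤ → Module.End ℂ M} (ha : IsField a) (D : Module.End ℂ M) :
    IsField fun n => a n * D := fun v => ha (D v)

lemma IsField.smul {a : ℤ → Module.End ℂ M} (ha : IsField a) (c : ℂ) :
    IsField fun n => c • a n := by simpa using ha.mul_left (c • 1)

lemma IsField.sub {a b : ℤ → Module.End ℂ M} (ha : IsField a) (hb : IsField b) :
    IsField fun n => a n - b n := by simpa [sub_eq_add_neg] using ha.add (hb.smul (-1))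

lemma IsField.sum {ι : Type} (s : Finset ι) {a : ι → ℤ → Module.End ℂ M}
    (h : ∀ i, IsField (a i)) : IsField fun n => ∑ i ∈ s, a i n := by
  classical
  induction s using Finset.induction_on with
  | empty => exact fun v => ⟨0, fun n _ => by simp⟩
  | insert i s hi ih => simpa [Finset.sum_insert hi] using (h i).add ih

lemma IsField.shift {a : ℤ → Module.End ℂ M} (ha : IsField a) (m : ℤ) :
    IsField fun n => a (n + m) := fun v => by
  obtain ⟨p, hp⟩ := ha v
  exact ⟨p - m, fun n hn => hp _ (by omega)⟩

/-- Finitely many members of a field have a common bound beyond which a second field kills. -/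
lemma exists_uniform_bound {a b : ℤ → Module.End ℂ M} (hb : IsField b) (s : Finset ℤ) (v : M) :
    ∃ N : ℤ, ∀ j ∈ s, ∀ n ≥ N, b n (a j v) = 0 := by
  classical
  induction s using Finset.induction_on with
  | empty => exact ⟨0, by simp⟩
  | insert i s hi ih =>
    obtain ⟨p, hp⟩ := ih
    obtain ⟨q, hq⟩ := hb (a i v)
    refine ⟨max p q, fun j hj n hn => ?_⟩
    rcases Finset.mem_insert.mp hj with rfl | hj
    · exact hq n (le_of_max_le_right hn)
    · exact hp j hj n (le_of_max_le_left hn)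

lemma isField_NO (s : ℂ) {a b : ℤ → Module.End ℂ M} (ha : IsField a) (hb : IsField b) :
    IsField (NO s a b) := fun v => by
  obtain ⟨p, hp⟩ := ha v
  obtain ⟨q, hq⟩ := hb v
  -- Terms with `j < 0` vanish by `q` and terms with `j ≥ p` by `p`. The finitely many vectors `a_j
  -- v` in between need a common bound.
  obtain ⟨r, hr⟩ := exists_uniform_bound (a := a) hb (Finset.Icc 0 p) v
  refine ⟨max q (r + p), fun n hn => ?_⟩
  rw [(locSum_NO s ha hb n v).2]
  have : (fun j => nterm s a b n j v) = fun _ => 0 := by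
    funext j
    unfold nterm
    split_ifs with hj
    · have : n - j ≥ q := by have := le_of_max_le_left hn; omega
      simp [Module.End.mul_apply, hq _ this]
    · rcases le_or_gt p j with h | h
      · simp [Module.End.mul_apply, hp j h]
      · have := le_of_max_le_right hn
        simp [Module.End.mul_apply,
          hr j (Finset.mem_Icc.mpr ⟨not_lt.mp hj, h.le⟩) (n - j) (by omega)]
  rw [this, finsum_zero]

end LocSum

/-! ## Wick formulas on restricted modules -/

lemma bracket_add_left {K : Type} [CommRing K] (u u' v : DD K) :
    bracket (u + u') v = bracket u v + bracket u' v := by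
  funext a
  rcases a with i | i
  · fin_cases i <;> simp [bracket] <;> ring
  · simp [bracket]

lemma bracket_smul_left {K : Type} [CommRing K] (c : K) (u v : DD K) :
    bracket (c • u) v = c • bracket u v := by
  funext a
  rcases a with i | i
  · fin_cases i <;> simp [bracket] <;> ring
  · simp [bracket]

lemma bracket_swap {K : Type} [CommRing K] (u v : DD K) : bracket u v = -bracket v u := by
  funext a
  rcases a with i | i
  · fin_cases i <;> simp [bracket] <;> ring
  · simp [bracket]

/-- The bracket as a bilinear map. -/
def bracketL (K : Type) [CommRing K] : DD K →ₗ[K] DD K →ₗ[K] DD K :=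
  LinearMap.mk₂ K bracket bracket_add_left bracket_smul_left
    (fun u v v' => by
      rw [bracket_swap, bracket_add_left, neg_add, ← bracket_swap, ← bracket_swap])
    (fun c u v => by rw [bracket_swap, bracket_smul_left, ← smul_neg, ← bracket_swap])

@[simp] lemma bracketL_apply {K : Type} [CommRing K] (u v : DD K) :
    bracketL K u v = bracket u v := rfl

lemma pair_comm {K : Type} [CommRing K] (u v : DD K) : pair u v = pair v u := by
  simp [pair, Fin.sum_univ_four]; ring

/-- The pairing as a bilinear form. -/
def pairL (K : Type) [CommRing K] : DD K →ₗ[K] DD K →ₗ[K] K :=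
  LinearMap.mk₂ K pair
    (fun u u' v => by simp [pair, Fin.sum_univ_four]; ring)
    (fun c u v => by simp [pair, Fin.sum_univ_four]; ring)
    (fun u v v' => by simp [pair, Fin.sum_univ_four]; ring)
    (fun c u v => by simp [pair, Fin.sum_univ_four]; ring)

@[simp] lemma pairL_apply {K : Type} [CommRing K] (u v : DD K) : pairL K u v = pair u v := rfl

/-- The pairing is invariant. -/
lemma pair_bracket {K : Type} [CommRing K] (u v w : DD K) :
    pair (bracket u v) w = pair u (bracket v w) := by
  simp [pair, bracket, Fin.sum_univ_four]; ring

lemma pair_bracket_swap {K : Type} [CommRing K] (u v w : DD K) :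
    pair (bracket u v) w = -pair (bracket u w) v := by
  simp [pair, bracket, Fin.sum_univ_four]; ring

/-- The Lie algebra is two-step nilpotent, since brackets lie in the central span of the `α^k`. This
forces unimodularity of the eigenspaces and keeps the left-invariant frame linear in the
coordinates. -/
lemma bracket_bracket {K : Type} [CommRing K] (u v w : DD K) :
    bracket (bracket u v) w = 0 := by
  funext a
  rcases a with i | i
  · fin_cases i <;> simp [bracket]
  · simp [bracket]

/-! ## Super-derivations of products -/

section Leibniz

variable {R : Type} [Ring R] {D a b a' b' : R}

lemma leibniz_even (ha : D * a = a * D + a') (hb : D * b = b * D + b') :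
    D * (a * b) - a * b * D = a' * b + a * b' := by
  rw [← mul_assoc, ha, add_mul, mul_assoc a D b, hb]; noncomm_ring

lemma leibniz_odd_odd (ha : D * a = -(a * D) + a') (hb : D * b = -(b * D) + b') :
    D * (a * b) - a * b * D = a' * b - a * b' := by
  rw [← mul_assoc, ha, add_mul, neg_mul, mul_assoc a D b, hb]; noncomm_ring

lemma leibniz_even_odd (ha : D * a = a * D + a') (hb : D * b = -(b * D) + b') :
    D * (a * b) + a * b * D = a' * b + a * b' := by
  rw [← mul_assoc, ha, add_mul, mul_assoc a D b, hb]; noncomm_ring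

lemma leibniz_odd_even (ha : D * a = -(a * D) + a') (hb : D * b = b * D + b') :
    D * (a * b) + a * b * D = a' * b - a * b' := by
  rw [← mul_assoc, ha, add_mul, neg_mul, mul_assoc a D b, hb]; noncomm_ring

lemma comm_neg : D * -a - -a * D = -(D * a - a * D) := by noncomm_ring

end Leibniz

/-- The Wick formulas below are all proved in this way: both sides are exhibited as locally finite
sums that agree index by index, after moving cuts with `LocSum.cut`. -/
lemma LocSum.eq_of_terms {M : Type} [AddCommGroup M] [Module ℂ M] {x y : ℤ → Module.End ℂ M}
    {X Y : Module.End ℂ M} (hX : LocSum x X) (hY : LocSum y Y) (h : ∀ j, x j = y j) : X = Y :=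
  hX.unique (hY.congr fun j => (h j).symm)

/-- A module over the modes on which they form fields. -/
structure ModeRep (M : Type) [AddCommGroup M] [Module ℂ M] where
  /-- even modes -/
  ev : ℤ → DD ℂ →ₗ[ℂ] Module.End ℂ M
  /-- odd modes -/
  od : ℤ → DD ℂ →ₗ[ℂ] Module.End ℂ M
  ev_ev : ∀ m n u v, ev m u * ev n v = ev n v * ev m u + ev (m + n) (bracket u v)
    + (if m + n = 0 then (m : ℂ) * pair u v else 0) • 1
  ev_od : ∀ m k u v, ev m u * od k v = od k v * ev m u + od (m + k) (bracket u v)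
  od_od : ∀ k l u v, od k u * od l v = -(od l v * od k u)
    + (if k + l + 1 = 0 then pair u v else 0) • 1
  ev_field : ∀ u, IsField fun n => ev n u
  od_field : ∀ u, IsField fun k => od k u

namespace ModeRep

variable {M : Type} [AddCommGroup M] [Module ℂ M] (ρ : ModeRep M)

/-- Modes of `:ū w̄:`. -/
def FF (N : ℤ) (u w : DD ℂ) : Module.End ℂ M := NO (-1) (fun n => ρ.od n u) (fun n => ρ.od n w) N
/-- Modes of `:u w̄:`. -/
def EF (N : ℤ) (u w : DD ℂ) : Module.End ℂ M := NO 1 (fun n => ρ.ev n u) (fun n => ρ.od n w) N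
/-- Modes of `:ū w:`. -/
def FE (N : ℤ) (u w : DD ℂ) : Module.End ℂ M := NO 1 (fun n => ρ.od n u) (fun n => ρ.ev n w) N
/-- Modes of `:u w:`. -/
def EE (N : ℤ) (u w : DD ℂ) : Module.End ℂ M := NO 1 (fun n => ρ.ev n u) (fun n => ρ.ev n w) N

lemma locSum_FF (N : ℤ) (u w : DD ℂ) :
    LocSum (fun j => if j < 0 then ρ.od j u * ρ.od (N - j) w else -(ρ.od (N - j) w * ρ.od j u))
      (ρ.FF N u w) :=
  (locSum_NO (-1) (ρ.od_field u) (ρ.od_field w) N).congr fun j => by simp [nterm]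

lemma locSum_EF (N : ℤ) (u w : DD ℂ) :
    LocSum (fun j => if j < 0 then ρ.ev j u * ρ.od (N - j) w else ρ.od (N - j) w * ρ.ev j u)
      (ρ.EF N u w) :=
  (locSum_NO 1 (ρ.ev_field u) (ρ.od_field w) N).congr fun j => by simp [nterm]

lemma locSum_FE (N : ℤ) (u w : DD ℂ) :
    LocSum (fun j => if j < 0 then ρ.od j u * ρ.ev (N - j) w else ρ.ev (N - j) w * ρ.od j u)
      (ρ.FE N u w) :=
  (locSum_NO 1 (ρ.od_field u) (ρ.ev_field w) N).congr fun j => by simp [nterm]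

lemma locSum_EE (N : ℤ) (u w : DD ℂ) :
    LocSum (fun j => if j < 0 then ρ.ev j u * ρ.ev (N - j) w else ρ.ev (N - j) w * ρ.ev j u)
      (ρ.EE N u w) :=
  (locSum_NO 1 (ρ.ev_field u) (ρ.ev_field w) N).congr fun j => by simp [nterm]

/-- `:ū w̄:` as a bilinear map. -/
def FFL (N : ℤ) : DD ℂ →ₗ[ℂ] DD ℂ →ₗ[ℂ] Module.End ℂ M :=
  LinearMap.mk₂ ℂ (ρ.FF N)
    (fun u u' w => (ρ.locSum_FF N (u + u') w).unique
      (((ρ.locSum_FF N u w).add (ρ.locSum_FF N u' w)).congr fun j => by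
        split_ifs <;> simp only [map_add] <;> noncomm_ring))
    (fun c u w => (ρ.locSum_FF N (c • u) w).unique
      (((ρ.locSum_FF N u w).smul c).congr fun j => by
        split_ifs <;> simp))
    (fun u w w' => (ρ.locSum_FF N u (w + w')).unique
      (((ρ.locSum_FF N u w).add (ρ.locSum_FF N u w')).congr fun j => by
        split_ifs <;> simp only [map_add] <;> noncomm_ring))
    (fun c u w => (ρ.locSum_FF N u (c • w)).unique
      (((ρ.locSum_FF N u w).smul c).congr fun j => by
        split_ifs <;> simp))

@[simp] lemma FFL_apply (N : ℤ) (u w : DD ℂ) : ρ.FFL N u w = ρ.FF N u w := rfl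

/-- `:u w̄:` as a bilinear map. -/
def EFL (N : ℤ) : DD ℂ →ₗ[ℂ] DD ℂ →ₗ[ℂ] Module.End ℂ M :=
  LinearMap.mk₂ ℂ (ρ.EF N)
    (fun u u' w => (ρ.locSum_EF N (u + u') w).unique
      (((ρ.locSum_EF N u w).add (ρ.locSum_EF N u' w)).congr fun j => by
        split_ifs <;> simp only [map_add] <;> noncomm_ring))
    (fun c u w => (ρ.locSum_EF N (c • u) w).unique
      (((ρ.locSum_EF N u w).smul c).congr fun j => by
        split_ifs <;> simp))
    (fun u w w' => (ρ.locSum_EF N u (w + w')).unique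
      (((ρ.locSum_EF N u w).add (ρ.locSum_EF N u w')).congr fun j => by
        split_ifs <;> simp only [map_add] <;> noncomm_ring))
    (fun c u w => (ρ.locSum_EF N u (c • w)).unique
      (((ρ.locSum_EF N u w).smul c).congr fun j => by
        split_ifs <;> simp))

@[simp] lemma EFL_apply (N : ℤ) (u w : DD ℂ) : ρ.EFL N u w = ρ.EF N u w := rfl

/-- `:ū w:` as a bilinear map. -/
def FEL (N : ℤ) : DD ℂ →ₗ[ℂ] DD ℂ →ₗ[ℂ] Module.End ℂ M :=
  LinearMap.mk₂ ℂ (ρ.FE N)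
    (fun u u' w => (ρ.locSum_FE N (u + u') w).unique
      (((ρ.locSum_FE N u w).add (ρ.locSum_FE N u' w)).congr fun j => by
        split_ifs <;> simp only [map_add] <;> noncomm_ring))
    (fun c u w => (ρ.locSum_FE N (c • u) w).unique
      (((ρ.locSum_FE N u w).smul c).congr fun j => by
        split_ifs <;> simp))
    (fun u w w' => (ρ.locSum_FE N u (w + w')).unique
      (((ρ.locSum_FE N u w).add (ρ.locSum_FE N u w')).congr fun j => by
        split_ifs <;> simp only [map_add] <;> noncomm_ring))
    (fun c u w => (ρ.locSum_FE N u (c • w)).unique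
      (((ρ.locSum_FE N u w).smul c).congr fun j => by
        split_ifs <;> simp))

@[simp] lemma FEL_apply (N : ℤ) (u w : DD ℂ) : ρ.FEL N u w = ρ.FE N u w := rfl

/-- An even operator shifting the odd modes acts as a derivation on `:ū w̄:`, up to a scalar. -/
lemma comm_FF {D : Module.End ℂ M} {m : ℤ} {u u' w w' : DD ℂ}
    (hu : ∀ j, D * ρ.od j u = ρ.od j u * D + ρ.od (j + m) u')
    (hw : ∀ j, D * ρ.od j w = ρ.od j w * D + ρ.od (j + m) w') (N : ℤ) :
    D * ρ.FF N u w - ρ.FF N u w * D = ρ.FF (N + m) u' w + ρ.FF (N + m) u w'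
      + (if N + m + 1 = 0 then (m : ℂ) * pair u' w else 0) • 1 := by
  have h1 := ((ρ.locSum_FF N u w).mul_left D).sub ((ρ.locSum_FF N u w).mul_right D)
  -- Reindexing by `m` leaves the terms with `u'` ordered at the cut `m` instead of `0`. Each step
  -- of the cut costs one anticommutator, whence the factor `m` in the scalar.
  have h2 := ((ρ.locSum_FF (N + m) u' w).cut
    (fun c => (if N + m + 1 = 0 then (c : ℂ) * pair u' w else 0) • 1) (by simp) (fun c => by
      rw [sub_neg_eq_add, ρ.od_od c (N + m - c) u' w, show c + (N + m - c) + 1 = N + m + 1 by ring]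
      split_ifs
      · push_cast; rw [add_mul, add_smul, one_mul]; abel
      · simp) m).shift m
  refine (h1.eq_of_terms (h2.add (ρ.locSum_FF (N + m) u w')) fun j => ?_).trans (by abel)
  simp only [add_lt_iff_neg_right, show N + m - (j + m) = N - j by ring,
    show N + m - j = N - j + m by ring]
  split_ifs
  · exact leibniz_even (hu j) (hw _)
  · rw [comm_neg, leibniz_even (hw (N - j)) (hu j)]; abel

/-- An odd operator sending odd modes to even ones acts on `:ū w̄:`. -/
lemma comm_FF_odd {D : Module.End ℂ M} {k : ℤ}
    (hD : ∀ l v, D * ρ.od l v = -(ρ.od l v * D) + ρ.ev (l + k + 1) v) (N : ℤ) (u w : DD ℂ) :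
    D * ρ.FF N u w - ρ.FF N u w * D = ρ.EF (N + k + 1) u w - ρ.FE (N + k + 1) u w
      + ((k : ℂ) + 1) • ρ.od (N + k + 1) (bracket u w) := by
  have h1 := ((ρ.locSum_FF N u w).mul_left D).sub ((ρ.locSum_FF N u w).mul_right D)
  -- Here each step of the cut costs a commutator of an even with an odd mode, which is an odd mode
  -- of the bracket; `k + 1` of them accumulate.
  have h2 := ((ρ.locSum_EF (N + k + 1) u w).cut
    (fun c => (c : ℂ) • ρ.od (N + k + 1) (bracket u w)) (by simp) (fun c => by
      rw [ρ.ev_od c (N + k + 1 - c) u w, show c + (N + k + 1 - c) = N + k + 1 by ring]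
      push_cast; rw [add_smul, one_smul]; abel) (k + 1)).shift (k + 1)
  refine (h1.eq_of_terms (h2.sub (ρ.locSum_FE (N + k + 1) u w)) fun j => ?_).trans
    (by push_cast; abel)
  simp only [add_lt_iff_neg_right, show N + k + 1 - (j + (k + 1)) = N - j by ring,
    show N + k + 1 - j = N - j + k + 1 by ring]
  rw [show j + (k + 1) = j + k + 1 by ring]
  split_ifs
  · exact leibniz_odd_odd (hD j u) (hD _ w)
  · rw [comm_neg, leibniz_odd_odd (hD (N - j) w) (hD j u)]; abel

lemma od_ev (l j : ℤ) (v u : DD ℂ) :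
    ρ.od l v * ρ.ev j u = ρ.ev j u * ρ.od l v + -ρ.od (j + l) (bracket u v) := by
  rw [ρ.ev_od]; abel

lemma od_od' (l j : ℤ) (v w : DD ℂ) :
    ρ.od l v * ρ.od j w = -(ρ.od j w * ρ.od l v)
      + (if j + l + 1 = 0 then pair w v else 0) • 1 := by
  rw [ρ.od_od, add_comm l j, pair_comm]

/-- The contraction of `v` with `w` is nonzero for one index only. The bracket of `u` with `v`
shifts the first index by `l`, so returning its cut to zero produces the scalar. -/
lemma anticomm_EF (N l : ℤ) (u w v : DD ℂ) :
    ρ.od l v * ρ.EF N u w + ρ.EF N u w * ρ.od l v = pair w v • ρ.ev (N + l + 1) u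
      - ρ.FF (N + l) (bracket u v) w
      - (if N + l + 1 = 0 then (l : ℂ) * pair (bracket u v) w else 0) • 1 := by
  have h1 := ((ρ.locSum_EF N u w).mul_left (ρ.od l v)).add
    ((ρ.locSum_EF N u w).mul_right (ρ.od l v))
  have h2 := ((ρ.locSum_FF (N + l) (bracket u v) w).cut
    (fun c => (if N + l + 1 = 0 then (c : ℂ) * pair (bracket u v) w else 0) • 1) (by simp)
    (fun c => by
      rw [sub_neg_eq_add, ρ.od_od c (N + l - c) _ w, show c + (N + l - c) + 1 = N + l + 1 by ring]
      split_ifs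
      · push_cast; rw [add_mul, add_smul, one_mul]; abel
      · simp) l).shift l
  refine (h1.eq_of_terms ((LocSum.single (N + l + 1) (pair w v • ρ.ev (N + l + 1) u)).sub h2)
    fun j => ?_).trans (by abel)
  simp only [add_lt_iff_neg_right, show N + l - (j + l) = N - j by ring]
  have e3 : (if j = N + l + 1 then pair w v • ρ.ev (N + l + 1) u else 0)
      = (if N - j + l + 1 = 0 then pair w v else 0) • ρ.ev j u := by
    by_cases h : j = N + l + 1
    · subst h; rw [if_pos rfl, if_pos (by ring)]
    · rw [if_neg h, if_neg (by omega), zero_smul]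
  rw [e3]
  by_cases hj : j < 0
  · simp only [if_pos hj]
    rw [leibniz_even_odd (ρ.od_ev l j v u) (ρ.od_od' l (N - j) v w), mul_smul_comm, mul_one]
    noncomm_ring
  · simp only [if_neg hj]
    rw [leibniz_odd_even (ρ.od_od' l (N - j) v w) (ρ.od_ev l j v u), smul_mul_assoc, one_mul]
    noncomm_ring

/-- There is no scalar, in contrast to `anticomm_EF`: the bracket shifts the second index, and the
cut, which is in terms of the first, stays at zero. -/
lemma anticomm_FE (N l : ℤ) (u w v : DD ℂ) :
    ρ.od l v * ρ.FE N u w + ρ.FE N u w * ρ.od l v = pair u v • ρ.ev (N + l + 1) w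
      + ρ.FF (N + l) u (bracket w v) := by
  have h1 := ((ρ.locSum_FE N u w).mul_left (ρ.od l v)).add
    ((ρ.locSum_FE N u w).mul_right (ρ.od l v))
  refine h1.eq_of_terms ((LocSum.single (-l - 1) (pair u v • ρ.ev (N + l + 1) w)).add
    (ρ.locSum_FF (N + l) u (bracket w v))) fun j => ?_
  simp only [show N + l - j = N - j + l by ring]
  have e3 : (if j = -l - 1 then pair u v • ρ.ev (N + l + 1) w else 0)
      = (if j + l + 1 = 0 then pair u v else 0) • ρ.ev (N - j) w := by
    by_cases h : j = -l - 1
    · subst h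
      rw [if_pos rfl, if_pos (by ring), show N - (-l - 1) = N + l + 1 by ring]
    · rw [if_neg h, if_neg (by omega), zero_smul]
  rw [e3]
  by_cases hj : j < 0
  · simp only [if_pos hj]
    rw [leibniz_odd_even (ρ.od_od' l j v u) (ρ.od_ev l (N - j) v w), smul_mul_assoc, one_mul]
    noncomm_ring
  · simp only [if_neg hj]
    rw [leibniz_even_odd (ρ.od_ev l (N - j) v w) (ρ.od_od' l j v u), mul_smul_comm, mul_one]
    noncomm_ring

/-- Each of the two contractions of `v` is nonzero for a single index of the sum. -/
lemma comm_FF_od (N l : ℤ) (u w v : DD ℂ) :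
    ρ.od l v * ρ.FF N u w - ρ.FF N u w * ρ.od l v = pair u v • ρ.od (N + l + 1) w
      - pair w v • ρ.od (N + l + 1) u := by
  have h1 := ((ρ.locSum_FF N u w).mul_left (ρ.od l v)).sub
    ((ρ.locSum_FF N u w).mul_right (ρ.od l v))
  refine h1.eq_of_terms ((LocSum.single (-l - 1) (pair u v • ρ.od (N + l + 1) w)).sub
    (LocSum.single (N + l + 1) (pair w v • ρ.od (N + l + 1) u))) fun j => ?_
  have e3 : (if j = -l - 1 then pair u v • ρ.od (N + l + 1) w else 0)
      = (if j + l + 1 = 0 then pair u v else 0) • ρ.od (N - j) w := by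
    by_cases h : j = -l - 1
    · subst h
      rw [if_pos rfl, if_pos (by ring), show N - (-l - 1) = N + l + 1 by ring]
    · rw [if_neg h, if_neg (by omega), zero_smul]
  have e4 : (if j = N + l + 1 then pair w v • ρ.od (N + l + 1) u else 0)
      = (if N - j + l + 1 = 0 then pair w v else 0) • ρ.od j u := by
    by_cases h : j = N + l + 1
    · subst h; rw [if_pos rfl, if_pos (by ring)]
    · rw [if_neg h, if_neg (by omega), zero_smul]
  rw [e3, e4]
  by_cases hj : j < 0
  · simp only [if_pos hj]
    rw [leibniz_odd_odd (ρ.od_od' l j v u) (ρ.od_od' l (N - j) v w), smul_mul_assoc, one_mul,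
      mul_smul_comm, mul_one]
  · simp only [if_neg hj]
    rw [comm_neg, leibniz_odd_odd (ρ.od_od' l (N - j) v w) (ρ.od_od' l j v u), smul_mul_assoc,
      one_mul, mul_smul_comm, mul_one]
    abel

/-- The action of a super-current on `:u w̄: - :ū w:`. -/
lemma anticomm_EF_sub_FE {D : Module.End ℂ M} {l : ℤ}
    (hod : ∀ n v, D * ρ.od n v = -(ρ.od n v * D) + ρ.ev (n + l + 1) v)
    (hev : ∀ n v, D * ρ.ev n v = ρ.ev n v * D + (-(n : ℂ)) • ρ.od (n + l) v)
    (k : ℤ) (u w : DD ℂ) :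
    D * (ρ.EF k u w - ρ.FE k u w) + (ρ.EF k u w - ρ.FE k u w) * D
      = ((l : ℂ) - k) • ρ.FF (k + l) u w
        - ((l : ℂ) + 1) • ρ.ev (k + l + 1) (bracket u w) := by
  have hA := ((ρ.locSum_EF k u w).mul_left D).add ((ρ.locSum_EF k u w).mul_right D)
  have hB := ((ρ.locSum_FE k u w).mul_left D).add ((ρ.locSum_FE k u w).mul_right D)
  -- Both halves contain the even product `:u w:`, cut at `0` in one and at `l + 1` in the other.
  -- Subtracting it leaves odd products with coefficients `l - j` and `k - j`, whose difference `l -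
  -- k` no longer depends on `j`.
  have hE := ρ.locSum_EE (k + l + 1) u w
  -- The central terms met while moving the cut are `0, 1, …, c - 1` times the pairing, and they add
  -- up to `c (c - 1) / 2`.
  have hE' := (hE.cut (fun c => (c : ℂ) • ρ.ev (k + l + 1) (bracket u w)
      + (if k + l + 1 = 0 then (c : ℂ) * (c - 1) / 2 * pair u w else 0) • 1) (by simp)
    (fun c => by
      rw [ρ.ev_ev c (k + l + 1 - c) u w, show c + (k + l + 1 - c) = k + l + 1 by ring]
      have e : ((c : ℂ) + 1) * (c + 1 - 1) / 2 * pair u w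
          = (c : ℂ) * (c - 1) / 2 * pair u w + c * pair u w := by ring
      split_ifs
      · push_cast; rw [e, add_smul, add_smul, one_smul]; abel
      · push_cast; rw [add_smul, one_smul]; simp) (l + 1)).shift (l + 1)
  have hA' : LocSum (fun j => if j < l then (-((j : ℂ) - l)) • (ρ.od j u * ρ.od (k + l - j) w)
      else (-((j : ℂ) - l)) • -(ρ.od (k + l - j) w * ρ.od j u))
      (D * ρ.EF k u w + ρ.EF k u w * D - ρ.EE (k + l + 1) u w) := by
    refine ((hA.sub hE).shift (-l)).congr fun j => ?_
    simp only [show (j + -l < 0) = (j < l) by rw [← sub_eq_add_neg, sub_neg],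
      show k + l + 1 - (j + -l) = k - (j + -l) + l + 1 by ring]
    have h1 := hev (j + -l) u
    have h2 := hod (k - (j + -l)) w
    rw [show j + -l + l = j by ring] at h1
    by_cases hj : j < l
    · simp only [if_pos hj]
      rw [leibniz_even_odd h1 h2, smul_mul_assoc, show k - (j + -l) = k + l - j by ring]
      push_cast
      rw [← sub_eq_add_neg (j : ℂ), add_sub_cancel_right]
    · simp only [if_neg hj]
      rw [leibniz_odd_even h2 h1, mul_smul_comm, show k - (j + -l) = k + l - j by ring]
      push_cast
      rw [smul_neg, sub_eq_add_neg (j : ℂ)]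
      abel
  have hB' : LocSum (fun j => if j < 0 then ((k : ℂ) - j) • (ρ.od j u * ρ.od (k + l - j) w)
      else ((k : ℂ) - j) • -(ρ.od (k + l - j) w * ρ.od j u))
      (D * ρ.FE k u w + ρ.FE k u w * D - (ρ.EE (k + l + 1) u w
        + (((l + 1 : ℤ) : ℂ) • ρ.ev (k + l + 1) (bracket u w) + (if k + l + 1 = 0 then
          ((l + 1 : ℤ) : ℂ) * (((l + 1 : ℤ) : ℂ) - 1) / 2 * pair u w else 0) • 1))) := by
    refine (hB.sub hE').congr fun j => ?_
    simp only [add_lt_iff_neg_right, show k + l + 1 - (j + (l + 1)) = k - j by ring]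
    rw [show j + (l + 1) = j + l + 1 by ring]
    have h1 := hev (k - j) w
    have h2 := hod j u
    rw [show k - j + l = k + l - j by ring] at h1
    by_cases hj : j < 0
    · simp only [if_pos hj]
      rw [leibniz_odd_even h2 h1, mul_smul_comm]
      push_cast
      rw [neg_smul]
      abel
    · simp only [if_neg hj]
      rw [leibniz_even_odd h1 h2, smul_mul_assoc]
      push_cast
      rw [neg_smul, smul_neg]
      abel
  -- Moving this cut from `l` back to `0` again gives a triangular number, which cancels the scalar
  -- from `hE'`.
  have hA'' := hA'.cut (fun c => (if k + l + 1 = 0 then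
      -(((c : ℂ) - l) * (c - l - 1) / 2) * pair u w else 0) • 1) (by simp) (fun c => by
    rw [smul_neg, sub_neg_eq_add, ← smul_add, ρ.od_od c (k + l - c) u w,
      show c + (k + l - c) + 1 = k + l + 1 by ring]
    have e : -(((c : ℂ) + 1 - l) * (c + 1 - l - 1) / 2) * pair u w
        = -(((c : ℂ) - l) * (c - l - 1) / 2) * pair u w + -(c - l) * pair u w := by ring
    split_ifs
    · push_cast; rw [e]; module
    · simp) 0
  have key := (hA''.sub hB').eq_of_terms ((ρ.locSum_FF (k + l) u w).smul ((l : ℂ) - k))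
    fun j => by
      split_ifs <;> rw [← sub_smul] <;> congr 1 <;> ring
  rw [← key]
  have e : (if k + l + 1 = 0 then -((((0 : ℤ) : ℂ) - l) * (((0 : ℤ) : ℂ) - l - 1) / 2) * pair u w
      else 0) = - (if k + l + 1 = 0 then
          ((l + 1 : ℤ) : ℂ) * (((l + 1 : ℤ) : ℂ) - 1) / 2 * pair u w else 0) := by
    split_ifs
    · push_cast; ring
    · simp
  rw [e, neg_smul]
  push_cast
  noncomm_ring

end ModeRep

/-! ## The super-currents of a splitting into isotropic subalgebras -/

/-- Dual bases of two complementary isotropic subalgebras. -/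
structure DualFrame (e e' : Fin 4 → DD ℂ) : Prop where
  iso : ∀ i j, pair (e i) (e j) = 0
  iso' : ∀ i j, pair (e' i) (e' j) = 0
  dual : ∀ i j, pair (e' i) (e j) = if i = j then 1 else 0
  expand : ∀ v, v = ∑ i, pair (e' i) v • e i + ∑ i, pair (e i) v • e' i
  closed : ∀ i j k, pair (bracket (e i) (e j)) (e k) = 0
  closed' : ∀ i j k, pair (bracket (e' i) (e' j)) (e' k) = 0
  unimod : ∑ i, bracket (e' i) (e i) = 0

namespace DualFrame

variable {e e' : Fin 4 → DD ℂ} (h : DualFrame e e')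

/-- The difference of the projections to the second and to the first subalgebra. -/
def lam (e e' : Fin 4 → DD ℂ) : DD ℂ →ₗ[ℂ] DD ℂ :=
  ∑ i, ((pairL ℂ (e i)).smulRight (e' i) - (pairL ℂ (e' i)).smulRight (e i))

lemma lam_apply (v : DD ℂ) :
    lam e e' v = ∑ i, (pair (e i) v • e' i - pair (e' i) v • e i) := by
  simp [lam]

include h

lemma dual' (i j : Fin 4) : pair (e i) (e' j) = if j = i then 1 else 0 := by
  rw [pair_comm, h.dual]

lemma lam_e (i : Fin 4) : lam e e' (e i) = -e i := by
  simp [lam_apply, h.iso, h.dual]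

lemma lam_e' (i : Fin 4) : lam e e' (e' i) = e' i := by
  simp [lam_apply, h.iso', h.dual']

/-- Linear maps that agree on the two bases are equal. -/
lemma hom_ext {V : Type} [AddCommGroup V] [Module ℂ V] {f g : DD ℂ →ₗ[ℂ] V}
    (h1 : ∀ i, f (e i) = g (e i)) (h2 : ∀ i, f (e' i) = g (e' i)) : f = g := by
  refine LinearMap.ext fun v => ?_
  rw [h.expand v]
  simp only [map_add, map_sum, map_smul, h1, h2]

lemma lam_lam (v : DD ℂ) : lam e e' (lam e e' v) = v := by
  have := h.hom_ext (f := lam e e' ∘ₗ lam e e') (g := LinearMap.id)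
    (fun i => by simp [h.lam_e]) (fun i => by simp [h.lam_e'])
  exact LinearMap.congr_fun this v

/-- By closedness the first summand has only mixed terms, and invariance of the pairing makes them
cancel against the mixed terms of the second. For normally ordered products this says that the
bracket of `J_0` with a mode of `e^k` has charge `2`. -/
lemma tensor_e' {V : Type} [AddCommGroup V] [Module ℂ V] (β : DD ℂ →ₗ[ℂ] DD ℂ →ₗ[ℂ] V)
    (k : Fin 4) :
    ∑ i, (β (bracket (e' k) (e' i)) (e i) + β (e' i) (bracket (e' k) (e i)))
      = ∑ i, ∑ j, pair (bracket (e' k) (e i)) (e j) • β (e' i) (e' j) := by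
  have h1 : ∀ i, β (bracket (e' k) (e' i)) (e i)
      = ∑ j, pair (e j) (bracket (e' k) (e' i)) • β (e' j) (e i) := fun i => by
    conv_lhs => rw [h.expand (bracket (e' k) (e' i))]
    simp [pair_comm (e' _) (bracket _ _), h.closed']
  have h2 : ∀ i, β (e' i) (bracket (e' k) (e i))
      = ∑ j, pair (e' j) (bracket (e' k) (e i)) • β (e' i) (e j)
        + ∑ j, pair (bracket (e' k) (e i)) (e j) • β (e' i) (e' j) := fun i => by
    conv_lhs => rw [h.expand (bracket (e' k) (e i))]
    simp [pair_comm (bracket _ _) (e _)]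
  have h3 : ∑ i, ∑ j, pair (e j) (bracket (e' k) (e' i)) • β (e' j) (e i)
      = -∑ i, ∑ j, pair (e' j) (bracket (e' k) (e i)) • β (e' i) (e j) := by
    rw [Finset.sum_comm, ← Finset.sum_neg_distrib]
    refine Finset.sum_congr rfl fun i _ => ?_
    rw [← Finset.sum_neg_distrib]
    refine Finset.sum_congr rfl fun j _ => ?_
    rw [← neg_smul, pair_comm (e i), pair_bracket_swap, pair_comm (e' j)]
  simp only [h1, h2, Finset.sum_add_distrib]
  rw [h3]
  abel

/-- The mirror image of `tensor_e'`, with resulting charge `-2`. -/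
lemma tensor_e {V : Type} [AddCommGroup V] [Module ℂ V] (β : DD ℂ →ₗ[ℂ] DD ℂ →ₗ[ℂ] V)
    (k : Fin 4) :
    ∑ i, (β (bracket (e k) (e' i)) (e i) + β (e' i) (bracket (e k) (e i)))
      = ∑ i, ∑ j, pair (bracket (e k) (e' i)) (e' j) • β (e j) (e i) := by
  have h1 : ∀ i, β (bracket (e k) (e' i)) (e i)
      = ∑ j, pair (e j) (bracket (e k) (e' i)) • β (e' j) (e i)
        + ∑ j, pair (bracket (e k) (e' i)) (e' j) • β (e j) (e i) := fun i => by
    conv_lhs => rw [h.expand (bracket (e k) (e' i))]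
    simp [pair_comm (bracket _ _) (e' _), add_comm]
  have h2 : ∀ i, β (e' i) (bracket (e k) (e i))
      = ∑ j, pair (e' j) (bracket (e k) (e i)) • β (e' i) (e j) := fun i => by
    conv_lhs => rw [h.expand (bracket (e k) (e i))]
    simp [pair_comm (e _) (bracket _ _), h.closed]
  have h3 : ∑ i, ∑ j, pair (e j) (bracket (e k) (e' i)) • β (e' j) (e i)
      = -∑ i, ∑ j, pair (e' j) (bracket (e k) (e i)) • β (e' i) (e j) := by
    rw [Finset.sum_comm, ← Finset.sum_neg_distrib]
    refine Finset.sum_congr rfl fun i _ => ?_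
    rw [← Finset.sum_neg_distrib]
    refine Finset.sum_congr rfl fun j _ => ?_
    rw [← neg_smul, pair_comm (e i), pair_bracket_swap, pair_comm (e' j)]
  simp only [h1, h2, Finset.sum_add_distrib]
  rw [h3]
  abel

end DualFrame

/-! ### The charge, the super-currents, and their brackets with the odd modes. -/

section Currents

variable {M : Type} [AddCommGroup M] [Module ℂ M] (ρ : ModeRep M) (e e' : Fin 4 → DD ℂ)

open DualFrame

/-- The modes of `∑ :ē^i ē_i:`. -/
def JJ (n : ℤ) : Module.End ℂ M := ∑ i, ρ.FF (n - 1) (e' i) (e i)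

/-- The modes of `∑ (:e^i ē_i: - :ē^i e_i:)`. -/
def QQ (k : ℤ) : Module.End ℂ M := ∑ i, (ρ.EF k (e' i) (e i) - ρ.FE k (e' i) (e i))

/-- The modes of the second super-current. -/
def RR (k : ℤ) : Module.End ℂ M := QQ ρ e e' k * JJ ρ e e' 0 - JJ ρ e e' 0 * QQ ρ e e' k

variable {e e'}

/-- The two contractions of `v` in `comm_FF_od` add up to `lam`, so odd modes of `e^i` and `e_i`
have `J_0`-charge `1` and `-1`. -/
lemma JJ_od (m k : ℤ) (v : DD ℂ) : JJ ρ e e' m * ρ.od k v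
    = ρ.od k v * JJ ρ e e' m + ρ.od (k + m) (lam e e' v) := by
  have h : ρ.od k v * JJ ρ e e' m - JJ ρ e e' m * ρ.od k v = -ρ.od (k + m) (lam e e' v) := by
    simp only [JJ, Finset.mul_sum, Finset.sum_mul]
    rw [← Finset.sum_sub_distrib, lam_apply, map_sum, ← Finset.sum_neg_distrib]
    refine Finset.sum_congr rfl fun i _ => ?_
    rw [ρ.comm_FF_od, show m - 1 + k + 1 = k + m by ring]
    simp
  rw [sub_eq_iff_eq_add] at h
  rw [h]; abel

/-- `J` is a sum of products of two odd modes, so the signs cancel. It is needed in `RR_ev`, for an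
operator not yet known to be zero. -/
lemma commute_JJ {C : Module.End ℂ M} (hC : ∀ l u, C * ρ.od l u = -(ρ.od l u * C)) (n : ℤ) :
    C * JJ ρ e e' n = JJ ρ e e' n * C := by
  simp only [JJ, Finset.mul_sum, Finset.sum_mul]
  refine Finset.sum_congr rfl fun i _ => ?_
  have hF := ρ.locSum_FF (n - 1) (e' i) (e i)
  refine (hF.mul_left C).eq_of_terms (hF.mul_right C) fun j => ?_
  have key : ∀ a b u w, C * (ρ.od a u * ρ.od b w) = ρ.od a u * ρ.od b w * C := fun a b u w => by
    rw [← mul_assoc, hC, neg_mul, mul_assoc, hC, mul_neg, neg_neg, mul_assoc]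
  split_ifs
  · exact key _ _ _ _
  · rw [mul_neg, key, neg_mul]

variable (h : DualFrame e e')
include h

/-- The operator parts cancel because `e^i` and `e_i` have opposite charges. Each of the four pairs
contributes `m`, and `4 = 12 / 3` fixes the central charge. -/
lemma JJ_JJ (m n : ℤ) : JJ ρ e e' m * JJ ρ e e' n - JJ ρ e e' n * JJ ρ e e' m
    = (if m + n = 0 then 4 * (m : ℂ) else 0) • 1 := by
  nth_rw 2 [JJ]
  nth_rw 2 [JJ]
  rw [Finset.mul_sum, Finset.sum_mul, ← Finset.sum_sub_distrib]
  have key : ∀ i, JJ ρ e e' m * ρ.FF (n - 1) (e' i) (e i) - ρ.FF (n - 1) (e' i) (e i) * JJ ρ e e' m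
      = (if m + n = 0 then (m : ℂ) else 0) • 1 := fun i => by
    rw [ρ.comm_FF (fun j => JJ_od ρ m j (e' i)) (fun j => JJ_od ρ m j (e i)), h.lam_e, h.lam_e',
      h.dual, ← ρ.FFL_apply _ _ (-e i), map_neg, ρ.FFL_apply, show n - 1 + m + 1 = m + n by ring]
    simp
  simp only [key]
  rw [Finset.sum_const, Finset.card_univ, Fintype.card_fin]
  split_ifs <;> simp [mul_smul, ← Nat.cast_smul_eq_nsmul ℂ]

omit h in
-- The scalar in `comm_FF` carries the factor `N` and occurs only for `N = 0`.
lemma ev_JJ_zero (N : ℤ) (v : DD ℂ) : ρ.ev N v * JJ ρ e e' 0 - JJ ρ e e' 0 * ρ.ev N v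
    = ∑ i, (ρ.FF (N - 1) (bracket v (e' i)) (e i) + ρ.FF (N - 1) (e' i) (bracket v (e i))) := by
  simp only [JJ, Finset.mul_sum, Finset.sum_mul]
  rw [← Finset.sum_sub_distrib]
  refine Finset.sum_congr rfl fun i _ => ?_
  rw [ρ.comm_FF (m := N) (u' := bracket v (e' i)) (w' := bracket v (e i))
    (fun j => by rw [ρ.ev_od, add_comm N]) (fun j => by rw [ρ.ev_od, add_comm N]),
    show (0 : ℤ) - 1 + N = N - 1 by ring, sub_add_cancel]
  split_ifs with hN
  · subst hN; simp
  · simp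

/-- The contractions assemble to `lam v` and the brackets to the commutator with `J_0`. The leftover
scalar is a multiple of the pairing of `v` with `∑ [e^i, e_i]`, which vanishes by unimodularity. -/
lemma od_QQ (k l : ℤ) (v : DD ℂ) : ρ.od l v * QQ ρ e e' k + QQ ρ e e' k * ρ.od l v
    = ρ.ev (k + l + 1) (lam e e' v)
      + (ρ.ev (k + l + 1) v * JJ ρ e e' 0 - JJ ρ e e' 0 * ρ.ev (k + l + 1) v) := by
  have hu : ∑ i, (if k + l + 1 = 0 then (l : ℂ) * pair (bracket (e' i) v) (e i) else 0) • (1 : Module.End ℂ M)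
      = 0 := by
    rw [← Finset.sum_smul]
    split_ifs
    · have e1 : ∀ i, (l : ℂ) * pair (bracket (e' i) v) (e i)
          = -l * pairL ℂ (bracket (e' i) (e i)) v := fun i => by
        rw [pair_bracket_swap, pairL_apply]; ring
      simp only [e1]
      rw [← Finset.mul_sum, ← LinearMap.sum_apply, ← map_sum, h.unimod]
      simp
    · simp
  rw [ev_JJ_zero, lam_apply, map_sum, ← Finset.sum_add_distrib,
    ← sub_zero (∑ i, _ : Module.End ℂ M), ← hu, ← Finset.sum_sub_distrib]
  simp only [QQ, Finset.mul_sum, Finset.sum_mul]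
  rw [← Finset.sum_add_distrib]
  refine Finset.sum_congr rfl fun i _ => ?_
  have e1 := ρ.anticomm_EF k l (e' i) (e i) v
  have e2 := ρ.anticomm_FE k l (e' i) (e i) v
  rw [bracket_swap (e' i) v, ← ρ.FFL_apply _ (-_), map_neg, LinearMap.neg_apply,
    ρ.FFL_apply] at e1
  rw [bracket_swap (e i) v, ← ρ.FFL_apply _ _ (-_), map_neg, ρ.FFL_apply] at e2
  rw [bracket_swap (e' i) v, mul_sub, sub_mul, sub_add_sub_comm, e1, e2, add_sub_cancel_right,
    map_sub, map_smul, map_smul]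
  abel

/-- The adjoint action of the charge on the even modes: integrability. -/
lemma JJ_JJ_ev (N : ℤ) (v : DD ℂ) :
    JJ ρ e e' 0 * (JJ ρ e e' 0 * ρ.ev N v - ρ.ev N v * JJ ρ e e' 0)
      - (JJ ρ e e' 0 * ρ.ev N v - ρ.ev N v * JJ ρ e e' 0) * JJ ρ e e' 0
    = (2 : ℂ) • (JJ ρ e e' 0 * ρ.ev N (lam e e' v) - ρ.ev N (lam e e' v) * JJ ρ e e' 0) := by
  set J := JJ ρ e e' 0 with hJ
  let ad : Module.End ℂ M →ₗ[ℂ] Module.End ℂ M :=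
    LinearMap.mulLeft ℂ J - LinearMap.mulRight ℂ J
  have had : ∀ X, ad X = J * X - X * J := fun X => by simp [ad]
  have hev : ∀ v, ad (ρ.ev N v) = -∑ i, (ρ.FFL (N - 1) (bracket v (e' i)) (e i)
      + ρ.FFL (N - 1) (e' i) (bracket v (e i))) := fun v => by
    rw [had, ← neg_sub, hJ, ev_JJ_zero]; rfl
  have hFF : ∀ u w, ad (ρ.FFL (N - 1) u w) = ρ.FFL (N - 1) (lam e e' u) w
      + ρ.FFL (N - 1) u (lam e e' w) := fun u w => by
    rw [had, ρ.FFL_apply, hJ, ρ.comm_FF (fun j => JJ_od ρ 0 j u) (fun j => JJ_od ρ 0 j w)]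
    simp
  have key : ad ∘ₗ ad ∘ₗ ρ.ev N = (2 : ℂ) • (ad ∘ₗ ρ.ev N ∘ₗ lam e e') := by
    refine h.hom_ext (fun k => ?_) (fun k => ?_)
    · simp only [LinearMap.comp_apply, LinearMap.smul_apply, h.lam_e, map_neg]
      rw [hev, h.tensor_e]
      simp only [map_neg, map_sum, map_smul, hFF, h.lam_e, LinearMap.neg_apply]
      simp only [← Finset.sum_neg_distrib, Finset.smul_sum]
      refine Finset.sum_congr rfl fun i _ => Finset.sum_congr rfl fun j _ => ?_
      module
    · simp only [LinearMap.comp_apply, LinearMap.smul_apply, h.lam_e']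
      rw [hev, h.tensor_e']
      simp only [map_neg, map_sum, map_smul, hFF, h.lam_e']
      simp only [← Finset.sum_neg_distrib, Finset.smul_sum]
      refine Finset.sum_congr rfl fun i _ => Finset.sum_congr rfl fun j _ => ?_
      module
  have := LinearMap.congr_fun key v
  simpa only [LinearMap.comp_apply, LinearMap.smul_apply, had] using this

/-- Expanding `R = [Q, J_0]` by the Jacobi identity gives a double commutator with `J_0`, two
commutators of `lam v` with `J_0`, and `lam (lam v) = v`. By `JJ_JJ_ev` all but the last cancel. -/
lemma RR_od (k l : ℤ) (v : DD ℂ) : RR ρ e e' k * ρ.od l v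
    = -(ρ.od l v * RR ρ e e' k) + ρ.ev (l + k + 1) v := by
  have h1 := od_QQ ρ h k l v
  have h2 := od_QQ ρ h k l (lam e e' v)
  have h3 := JJ_JJ_ev ρ h (k + l + 1) v
  have h4 := JJ_od ρ (e := e) (e' := e') 0 l v
  rw [h.lam_lam] at h2
  rw [add_zero] at h4
  rw [show l + k + 1 = k + l + 1 by ring, RR]
  set J := JJ ρ e e' 0
  set Q := QQ ρ e e' k
  set z := ρ.od l v
  set z' := ρ.od l (lam e e' v)
  set V := ρ.ev (k + l + 1) v
  set V' := ρ.ev (k + l + 1) (lam e e' v)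
  have e1 : z * Q * J - J * (z * Q) + Q * z * J - J * (Q * z) + (z' * Q + Q * z') = V := by
    have : z * Q * J - J * (z * Q) + Q * z * J - J * (Q * z)
        = (z * Q + Q * z) * J - J * (z * Q + Q * z) := by noncomm_ring
    rw [this, h1, h2]
    rw [two_smul] at h3
    have h3' : (V * J - J * V) * J - J * (V * J - J * V)
        = J * V' - V' * J + (J * V' - V' * J) := by rw [← h3]; noncomm_ring
    rw [add_mul, mul_add]
    calc _ = ((V * J - J * V) * J - J * (V * J - J * V)) + (V' * J - J * V') + (V' * J - J * V')
          + V := by abel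
      _ = V := by rw [h3']; abel
  have h5 : z' = J * z - z * J := by rw [h4]; abel
  rw [h5] at e1
  rw [← e1]
  noncomm_ring

/-- Since `R` turns odd modes into even ones, it turns `J` into `Q`; the correction from reordering
is a multiple of `∑ [e^i, e_i] = 0`. -/
lemma RR_JJ (k n : ℤ) : RR ρ e e' k * JJ ρ e e' n - JJ ρ e e' n * RR ρ e e' k
    = QQ ρ e e' (k + n) := by
  rw [JJ, Finset.mul_sum, Finset.sum_mul, ← Finset.sum_sub_distrib, QQ]
  have key : ∀ i, RR ρ e e' k * ρ.FF (n - 1) (e' i) (e i) - ρ.FF (n - 1) (e' i) (e i) * RR ρ e e' k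
      = ρ.EF (k + n) (e' i) (e i) - ρ.FE (k + n) (e' i) (e i)
        + ((k : ℂ) + 1) • ρ.od (k + n) (bracket (e' i) (e i)) := fun i => by
    rw [ρ.comm_FF_odd (fun l v => RR_od ρ h k l v), show n - 1 + k + 1 = k + n by ring]
  simp only [key]
  rw [Finset.sum_add_distrib, ← Finset.smul_sum, ← map_sum, h.unimod]
  simp

end Currents

/-! ### The charge argument and the brackets of the super-currents with even modes and with each
other. -/

/-- The commutator in an algebra as a bilinear map. -/
def ad (R : Type) [Ring R] [Algebra ℂ R] : R →ₗ[ℂ] R →ₗ[ℂ] R :=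
  LinearMap.mul ℂ R - (LinearMap.mul ℂ R).flip

lemma ad_apply {R : Type} [Ring R] [Algebra ℂ R] (x y : R) : ad R x y = x * y - y * x := rfl

lemma ad_ad {R : Type} [Ring R] [Algebra ℂ R] (x y z : R) :
    ad R x (ad R y z) = ad R (ad R x y) z + ad R y (ad R x z) := by
  simp only [ad_apply]; noncomm_ring

lemma ad_anticomm {R : Type} [Ring R] [Algebra ℂ R] (x a b : R) :
    ad R x (a * b + b * a) = (ad R x a * b + b * ad R x a) + (a * ad R x b + ad R x b * a) := by
  simp only [ad_apply]; noncomm_ring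

/-- In a ring where `ad J` has on `v` only the eigenvalues `0` and `2ε`, and exchanges `r` and `q`
up to sign, an element `[r, v] + o` commuting with `J` vanishes if `o` has eigenvalue `ε`. -/
lemma eq_zero_of_odd_charge {R : Type} [Ring R] [Algebra ℂ R] {J r q v o : R} {ε : ℂ}
    (hε : ε * ε = 1) (hr : ad R J r = -q) (hq : ad R J q = -r)
    (hv : ad R J (ad R J v) = (2 * ε) • ad R J v) (ho : ad R J o = ε • o)
    (hC : ad R J (ad R r v + o) = 0) : ad R r v + o = 0 := by
  set t := ad R J v
  have hrt : ad R J (ad R r t) = -ad R q t + (2 * ε) • ad R r t := by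
    rw [ad_ad, hr, hv, map_neg, map_smul, LinearMap.neg_apply]
  have hqt : ad R J (ad R q t) = -ad R r t + (2 * ε) • ad R q t := by
    rw [ad_ad, hq, hv, map_neg, map_smul, LinearMap.neg_apply]
  have hrv : ad R J (ad R r v) = -ad R q v + ad R r t := by
    rw [ad_ad, hr, map_neg, LinearMap.neg_apply]
  have hqv : ad R J (ad R q v) = -ad R r v + ad R q t := by
    rw [ad_ad, hq, map_neg, LinearMap.neg_apply]
  have h1 : -ad R q v + ad R r t + ε • o = 0 := by
    rw [← hC, map_add, hrv, ho]
  -- Applying `ad J` a second time expresses the element through `[q, t]` and `[r, t]`. The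
  -- resulting combination has charge `3ε`, which is incompatible with charge `0`.
  have h2 : ad R r v - (2 : ℂ) • ad R q t + (2 * ε) • ad R r t + o = 0 := by
    have : ad R J (-ad R q v + ad R r t + ε • o) = 0 := by rw [h1, map_zero]
    rw [map_add, map_add, map_neg, hqv, hrt, map_smul, ho, smul_smul, hε, one_smul] at this
    rw [← this]; module
  have h3 : ad R r v + o = (2 : ℂ) • ad R q t - (2 * ε) • ad R r t := by
    rw [← sub_eq_zero, ← h2]; module
  have h4 : ad R J ((2 : ℂ) • ad R q t - (2 * ε) • ad R r t)
      = (3 * ε) • ((2 : ℂ) • ad R q t - (2 * ε) • ad R r t) := by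
    rw [map_sub, map_smul, map_smul, hqt, hrt]
    have e1 : (2 * ε) • ((2 * ε) • ad R r t) = (4 : ℂ) • ad R r t := by
      rw [smul_smul]; congr 1; linear_combination 4 * hε
    have e2 : (3 * ε) • ((2 * ε) • ad R r t) = (6 : ℂ) • ad R r t := by
      rw [smul_smul]; congr 1; linear_combination 6 * hε
    rw [smul_sub, smul_add, smul_add, e1, e2]
    module
  rw [h3] at hC ⊢
  rw [hC] at h4
  refine (smul_eq_zero.mp h4.symm).resolve_left fun hc => ?_
  have : ε = 0 := by simpa using hc
  simp [this] at hε

lemma anticomm_of_jacobi {R : Type} [Ring R] {r z v u b : R} (h1 : r * z = -(z * r) + u)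
    (h2 : v * z = z * v + b) :
    (r * v - v * r) * z + z * (r * v - v * r) = (u * v - v * u) + (r * b + b * r) := by
  calc _ = r * (v * z) - v * (r * z) + z * r * v - z * v * r := by noncomm_ring
    _ = r * (z * v + b) - v * (-(z * r) + u) + z * r * v - z * v * r := by rw [h2, h1]
    _ = r * z * v + r * b + v * z * r - v * u + z * r * v - z * v * r := by noncomm_ring
    _ = _ := by rw [h1, h2]; noncomm_ring

lemma comm_of_jacobi {R : Type} [Ring R] {m j r : R} (h : m * j = j * m) :
    m * (r * j - j * r) - (r * j - j * r) * m
      = -((r * m - m * r) * j - j * (r * m - m * r)) := by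
  rw [← sub_eq_zero]
  calc _ = (j * m - m * j) * r + r * (m * j - j * m) := by noncomm_ring
    _ = 0 := by rw [h]; simp

section Currents

variable {M : Type} [AddCommGroup M] [Module ℂ M] (ρ : ModeRep M) {e e' : Fin 4 → DD ℂ}

open DualFrame

variable (h : DualFrame e e')
include h

/-- The defect `f v` anticommutes with every odd mode by the Jacobi identity and `RR_od`, so it
commutes with `J_0`. For `v` among the `e_i` or `e^i` it can only have odd charges: `R` splits into
charges `±1`, `[J_0, v]` has charge `±2`, and the odd mode has charge `±1`. Hence it vanishes on
both bases. -/
lemma RR_ev (k n : ℤ) (v : DD ℂ) : RR ρ e e' k * ρ.ev n v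
    = ρ.ev n v * RR ρ e e' k + (-(n : ℂ)) • ρ.od (n + k) v := by
  let f : DD ℂ →ₗ[ℂ] Module.End ℂ M :=
    (LinearMap.mulLeft ℂ (RR ρ e e' k) - LinearMap.mulRight ℂ (RR ρ e e' k)) ∘ₗ ρ.ev n
      + (n : ℂ) • ρ.od (n + k)
  have hf : ∀ v, f v = ad _ (RR ρ e e' k) (ρ.ev n v) + (n : ℂ) • ρ.od (n + k) v := fun v => rfl
  have hC : ∀ v l u, f v * ρ.od l u = -(ρ.od l u * f v) := fun v l u => by
    have e1 := anticomm_of_jacobi (RR_od ρ h k l u) (ρ.ev_od n l v u)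
    have e4 := ρ.ev_ev (l + k + 1) n u v
    have e5 := ρ.od_od (n + k) l v u
    rw [RR_od ρ h k (n + l), e4, bracket_swap u v, map_neg,
      show l + k + 1 + n = n + l + k + 1 by ring] at e1
    rw [show n + k + l + 1 = n + l + k + 1 by ring] at e5
    rw [hf, ad_apply, ← sub_eq_zero, sub_neg_eq_add, add_mul, mul_add, add_add_add_comm, e1,
      smul_mul_assoc, mul_smul_comm, e5, pair_comm u v]
    by_cases hN : n + l + k + 1 = 0
    · have : ((l + k + 1 : ℤ) : ℂ) = -n := by
        rw [show l + k + 1 = -n by omega]; push_cast; ring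
      simp only [if_pos hN, this]
      module
    · simp only [if_neg hN]
      module
  have hr : ad _ (JJ ρ e e' 0) (RR ρ e e' k) = -QQ ρ e e' k := by
    rw [ad_apply, ← neg_sub, RR_JJ ρ h, add_zero]
  have hq : ad _ (JJ ρ e e' 0) (QQ ρ e e' k) = -RR ρ e e' k := by
    rw [ad_apply, RR]; abel
  have hv : ∀ v, ad _ (JJ ρ e e' 0) (ad _ (JJ ρ e e' 0) (ρ.ev n v))
      = (2 : ℂ) • ad _ (JJ ρ e e' 0) (ρ.ev n (lam e e' v)) := fun v => JJ_JJ_ev ρ h n v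
  have ho : ∀ v, ad _ (JJ ρ e e' 0) ((n : ℂ) • ρ.od (n + k) v)
      = (n : ℂ) • ρ.od (n + k) (lam e e' v) := fun v => by
    rw [map_smul, ad_apply, JJ_od, add_sub_cancel_left, add_zero]
  have hJC : ∀ v, ad _ (JJ ρ e e' 0)
      (ad _ (RR ρ e e' k) (ρ.ev n v) + (n : ℂ) • ρ.od (n + k) v) = 0 := fun v => by
    rw [← hf, ad_apply, commute_JJ ρ (hC v), sub_self]
  have hzero : f = 0 := by
    refine h.hom_ext (fun i => ?_) (fun i => ?_)
    · rw [hf]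
      refine eq_zero_of_odd_charge (ε := -1) (by norm_num) hr hq ?_ ?_ (hJC _)
      · rw [hv, h.lam_e, map_neg, map_neg]; module
      · rw [ho, h.lam_e, map_neg]; module
    · rw [hf]
      refine eq_zero_of_odd_charge (ε := 1) (by norm_num) hr hq ?_ ?_ (hJC _)
      · rw [hv, h.lam_e']; module
      · rw [ho, h.lam_e']; module
  have h0 : f v = 0 := by rw [hzero]; rfl
  rw [hf, ad_apply] at h0
  rw [← sub_eq_zero, ← h0]
  module

/-- Since `Q_k = [R_k, J_0]` and `J_m` commutes with `J_0`, the bracket with `J_m` can be taken on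
`R_k` first. -/
lemma JJ_QQ (m k : ℤ) : JJ ρ e e' m * QQ ρ e e' k - QQ ρ e e' k * JJ ρ e e' m
    = -RR ρ e e' (m + k) := by
  have h3 := JJ_JJ ρ h m 0
  have h4 : (if m + 0 = 0 then 4 * (m : ℂ) else 0) = 0 := by
    split_ifs with hm
    · rw [add_zero] at hm; simp [hm]
    · rfl
  rw [h4, zero_smul, sub_eq_zero] at h3
  have h1 := comm_of_jacobi (r := RR ρ e e' k) h3
  rw [RR_JJ ρ h, RR_JJ ρ h, add_zero] at h1
  rw [h1, add_comm m k, RR]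

lemma RR_QQ (l k : ℤ) : RR ρ e e' l * QQ ρ e e' k + QQ ρ e e' k * RR ρ e e' l
    = ((l : ℂ) - k) • JJ ρ e e' (k + l + 1) := by
  have key := fun i => ρ.anticomm_EF_sub_FE (fun n v => RR_od ρ h l n v)
    (fun n v => RR_ev ρ h l n v) k (e' i) (e i)
  rw [QQ, Finset.mul_sum, Finset.sum_mul, ← Finset.sum_add_distrib]
  simp only [key]
  rw [Finset.sum_sub_distrib, ← Finset.smul_sum, ← Finset.smul_sum, ← map_sum, h.unimod, JJ]
  simp

/-- Bracketing `RR_QQ` with `J_0` exchanges the two currents up to sign on the left and annihilates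
the right side. -/
lemma QQ_QQ (k l : ℤ) : QQ ρ e e' k * QQ ρ e e' l + QQ ρ e e' l * QQ ρ e e' k
    = -(RR ρ e e' k * RR ρ e e' l + RR ρ e e' l * RR ρ e e' k) := by
  have h1 := congrArg (ad _ (JJ ρ e e' 0)) (RR_QQ ρ h l k)
  have h2 : ∀ k, ad _ (JJ ρ e e' 0) (QQ ρ e e' k) = -RR ρ e e' k := fun k => by
    rw [ad_apply, JJ_QQ ρ h, zero_add]
  have h3 : ∀ l, ad _ (JJ ρ e e' 0) (RR ρ e e' l) = -QQ ρ e e' l := fun l => by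
    rw [ad_apply, ← neg_sub, RR_JJ ρ h, add_zero]
  have h4 := JJ_JJ ρ h 0 (k + l + 1)
  rw [Int.cast_zero, mul_zero, ite_self, zero_smul] at h4
  rw [ad_anticomm, h2, h3, map_smul, ad_apply, h4, smul_zero] at h1
  rw [← sub_eq_zero, ← neg_eq_zero, ← h1]
  noncomm_ring

/-- The anticommutator of the second super-current with itself depends only on the sum of the
degrees, up to a scalar. -/
lemma RR_RR (k l : ℤ) : RR ρ e e' k * RR ρ e e' l + RR ρ e e' l * RR ρ e e' k
    = RR ρ e e' 0 * RR ρ e e' (k + l) + RR ρ e e' (k + l) * RR ρ e e' 0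
      + (if k + l + 1 = 0 then 4 * ((k : ℂ) ^ 2 + k) else 0) • 1 := by
  -- Bracketing `{R_l, Q_0}` with `J_k` yields `{R_l, R_k}` and `{Q_{k+l}, Q_0}`. The latter is
  -- `-{R_0, R_{k+l}}`, and the scalar is the level of `J`.
  have h1 := congrArg (ad _ (JJ ρ e e' k)) (RR_QQ ρ h l 0)
  have h2 : ∀ j, ad _ (JJ ρ e e' k) (QQ ρ e e' j) = -RR ρ e e' (k + j) := fun j => by
    rw [ad_apply, JJ_QQ ρ h]
  have h3 : ∀ j, ad _ (JJ ρ e e' k) (RR ρ e e' j) = -QQ ρ e e' (j + k) := fun j => by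
    rw [ad_apply, ← neg_sub, RR_JJ ρ h]
  have h4 := JJ_JJ ρ h k (0 + l + 1)
  have h5 := QQ_QQ ρ h 0 (k + l)
  rw [ad_anticomm, h2, h3, map_smul, ad_apply, h4, add_zero, add_comm l k] at h1
  rw [← sub_eq_zero, sub_add_eq_sub_sub, sub_eq_zero]
  have h6 : RR ρ e e' k * RR ρ e e' l + RR ρ e e' l * RR ρ e e' k
      - (RR ρ e e' 0 * RR ρ e e' (k + l) + RR ρ e e' (k + l) * RR ρ e e' 0)
      = -(-QQ ρ e e' (k + l) * QQ ρ e e' 0 + QQ ρ e e' 0 * -QQ ρ e e' (k + l) +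
      (RR ρ e e' l * -RR ρ e e' k + -RR ρ e e' k * RR ρ e e' l)) := by
    rw [eq_neg_iff_add_eq_zero] at h5
    rw [← sub_eq_zero, ← neg_eq_zero, ← h5]
    noncomm_ring
  rw [h6, h1, zero_add, smul_smul, ← neg_smul, show k + (l + 1) = k + l + 1 by ring]
  congr 1
  split_ifs with hN
  · have : (l : ℂ) = -k - 1 := by
      rw [show l = -k - 1 by omega]; push_cast; ring
    rw [this]; push_cast; ring
  · simp

end Currents

/-! ## Super-conformal algebras from their super-currents -/

section Jacobi

variable {R : Type} [Ring R] [Algebra ℂ R] {c : ℂ} {J Gp Gm L : ℤ → R}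

/-- `L_m` is, up to a multiple of `J_m`, an anticommutator of `G^+` and `G^-`, on which `[J_n, ·]`
acts by the Leibniz rule. -/
lemma jacobi_L_J (hJJ : ∀ m n : ℤ, J m * J n - J n * J m
      = (if m + n = 0 then c / 3 * (m : ℂ) else 0) • 1)
    (hJp : ∀ m k : ℤ, J m * Gp k - Gp k * J m = Gp (m + k))
    (hJm : ∀ m k : ℤ, J m * Gm k - Gm k * J m = -Gm (m + k))
    (hpm : ∀ k l : ℤ, Gp k * Gm l + Gm l * Gp k = L (k + l + 1)
      + (((k : ℂ) - l) / 2) • J (k + l + 1)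
      + (if k + l + 1 = 0 then c / 6 * (((k : ℂ) + 1 / 2) ^ 2 - 1 / 4) else 0) • 1) (m n : ℤ) :
    L m * J n - J n * L m = (-(n : ℂ)) • J (m + n) := by
  -- With first index `0`, that is `r = 1/2`, the central term `r² - 1/4` vanishes.
  have h1 := hpm 0 (m - 1)
  have h2 := congrArg (ad R (J n)) h1
  have e1 : ∀ k, ad R (J n) (Gp k) = Gp (n + k) := hJp n
  have e2 : ∀ k, ad R (J n) (Gm k) = -Gm (n + k) := hJm n
  have h3 := hpm n (m - 1)
  have h4 := hpm 0 (n + (m - 1))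
  have h5 : ad R (J n) (J m) = _ := hJJ n m
  have h6 : ad R (J n) 1 = 0 := by simp [ad_apply]
  rw [show (0 : ℤ) + (m - 1) + 1 = m by ring, ad_anticomm, e1, e2, add_zero, map_add, map_add,
    map_smul, map_smul, h6, h5] at h2
  rw [show n + (m - 1) + 1 = m + n by ring] at h3
  rw [show 0 + (n + (m - 1)) + 1 = m + n by ring] at h4
  rw [mul_neg, neg_mul, ← neg_add, h3, h4, ← sub_eq_zero] at h2
  rw [← neg_sub, ← ad_apply, ← sub_eq_zero, ← h2, add_comm n m]
  by_cases hN : m + n = 0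
  · have : (m : ℂ) = -n := by rw [show m = -n by omega]; push_cast; ring
    simp only [if_pos hN]
    push_cast
    rw [this]
    module
  · simp only [if_neg hN]
    push_cast
    module

/-- `G^+_k` squares to zero, so it commutes with its anticommutator with any `G^-_l`. The choice `l
= m - k - 1` makes `L_m` appear there, and the `J_m` term determines the bracket. -/
lemma jacobi_L_Gp 
    (hJp : ∀ m k : ℤ, J m * Gp k - Gp k * J m = Gp (m + k))
    (hpp : ∀ k l : ℤ, Gp k * Gp l + Gp l * Gp k = 0)
    (hpm : ∀ k l : ℤ, Gp k * Gm l + Gm l * Gp k = L (k + l + 1)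
      + (((k : ℂ) - l) / 2) • J (k + l + 1)
      + (if k + l + 1 = 0 then c / 6 * (((k : ℂ) + 1 / 2) ^ 2 - 1 / 4) else 0) • 1) (m k : ℤ) :
    L m * Gp k - Gp k * L m = ((m : ℂ) / 2 - (k + 1 / 2)) • Gp (m + k) := by
  have h0 : Gp k * Gp k = 0 := by
    have := hpp k k
    rw [← two_smul ℂ] at this
    exact (smul_eq_zero.mp this).resolve_left two_ne_zero
  have h1 := congrArg (fun x => ad R x (Gp k)) (hpm k (m - k - 1))
  have h2 : ad R (J m) (Gp k) = _ := hJp m k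
  have h3 : ad R 1 (Gp k) = 0 := by simp [ad_apply]
  have h4 : ad R (Gp k * Gm (m - k - 1) + Gm (m - k - 1) * Gp k) (Gp k) = 0 := by
    rw [ad_apply]
    calc _ = Gm (m - k - 1) * (Gp k * Gp k) - Gp k * Gp k * Gm (m - k - 1) := by noncomm_ring
      _ = 0 := by rw [h0]; simp
  simp only [map_add, map_smul, LinearMap.add_apply, LinearMap.smul_apply] at h1 h4
  rw [show k + (m - k - 1) + 1 = m by ring, h4, h2, h3] at h1
  rw [← ad_apply, ← sub_eq_zero, ← neg_eq_zero]
  rw [eq_comm, ← sub_eq_zero] at h1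
  rw [← neg_eq_zero, ← h1]
  push_cast
  module

lemma jacobi_L_Gm 
    (hJm : ∀ m k : ℤ, J m * Gm k - Gm k * J m = -Gm (m + k))
    (hmm : ∀ k l : ℤ, Gm k * Gm l + Gm l * Gm k = 0)
    (hpm : ∀ k l : ℤ, Gp k * Gm l + Gm l * Gp k = L (k + l + 1)
      + (((k : ℂ) - l) / 2) • J (k + l + 1)
      + (if k + l + 1 = 0 then c / 6 * (((k : ℂ) + 1 / 2) ^ 2 - 1 / 4) else 0) • 1) (m k : ℤ) :
    L m * Gm k - Gm k * L m = ((m : ℂ) / 2 - (k + 1 / 2)) • Gm (m + k) := by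
  have h0 : Gm k * Gm k = 0 := by
    have := hmm k k
    rw [← two_smul ℂ] at this
    exact (smul_eq_zero.mp this).resolve_left two_ne_zero
  have h1 := congrArg (fun x => ad R x (Gm k)) (hpm (m - k - 1) k)
  have h2 : ad R (J m) (Gm k) = _ := hJm m k
  have h3 : ad R 1 (Gm k) = 0 := by simp [ad_apply]
  have h4 : ad R (Gp (m - k - 1) * Gm k + Gm k * Gp (m - k - 1)) (Gm k) = 0 := by
    rw [ad_apply]
    calc _ = Gp (m - k - 1) * (Gm k * Gm k) - Gm k * Gm k * Gp (m - k - 1) := by noncomm_ring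
      _ = 0 := by rw [h0]; simp
  simp only [map_add, map_smul, LinearMap.add_apply, LinearMap.smul_apply] at h1 h4
  rw [show m - k - 1 + k + 1 = m by ring, h4, h2, h3] at h1
  rw [eq_comm, ← sub_eq_zero] at h1
  rw [← ad_apply, ← sub_eq_zero, ← h1]
  push_cast
  module

/-- The Leibniz rule for `[L_m, ·]` on `{G^+_0, G^-_{n-1}}` uses only brackets already known. -/
lemma jacobi_L_L
    (hpm : ∀ k l : ℤ, Gp k * Gm l + Gm l * Gp k = L (k + l + 1)
      + (((k : ℂ) - l) / 2) • J (k + l + 1)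
      + (if k + l + 1 = 0 then c / 6 * (((k : ℂ) + 1 / 2) ^ 2 - 1 / 4) else 0) • 1)
    (hLJ : ∀ m n : ℤ, L m * J n - J n * L m = (-(n : ℂ)) • J (m + n))
    (hLp : ∀ m k : ℤ, L m * Gp k - Gp k * L m = ((m : ℂ) / 2 - (k + 1 / 2)) • Gp (m + k))
    (hLm : ∀ m k : ℤ, L m * Gm k - Gm k * L m = ((m : ℂ) / 2 - (k + 1 / 2)) • Gm (m + k))
    (m n : ℤ) :
    L m * L n - L n * L m = ((m : ℂ) - n) • L (m + n)
    + (if m + n = 0 then c / 12 * ((m : ℂ) ^ 3 - m) else 0) • 1 := by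
  have h1 := hpm 0 (n - 1)
  have h2 := congrArg (ad R (L m)) h1
  have e1 : ∀ k, ad R (L m) (Gp k) = _ := hLp m
  have e2 : ∀ k, ad R (L m) (Gm k) = _ := hLm m
  have h3 := hpm m (n - 1)
  have h4 := hpm 0 (m + (n - 1))
  have h5 : ad R (L m) (J n) = _ := hLJ m n
  have h6 : ad R (L m) 1 = 0 := by simp [ad_apply]
  rw [show (0 : ℤ) + (n - 1) + 1 = n by ring, ad_anticomm, e1, e2, add_zero, map_add, map_add,
    map_smul, map_smul, h6, h5] at h2
  rw [show m + (n - 1) + 1 = m + n by ring] at h3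
  rw [show 0 + (m + (n - 1)) + 1 = m + n by ring] at h4
  simp only [mul_smul_comm, smul_mul_assoc, ← smul_add] at h2
  rw [h3, h4, eq_comm, ← sub_eq_zero] at h2
  rw [← ad_apply, ← sub_eq_zero, ← h2]
  by_cases hN : m + n = 0
  · have : (n : ℂ) = -m := by rw [show n = -m by omega]; push_cast; ring
    simp only [if_pos hN]
    push_cast
    rw [this]
    module
  · simp only [if_neg hN]
    push_cast
    module

end Jacobi

/-! ## Induced modules -/

/-- The map from the free algebra to the mode algebra. -/
def toModes : FreeAlgebra ℂ Gen →ₐ[ℂ] ModeAlgebra := RingQuot.mkAlgHom ℂ ModeRel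

lemma toModes_rel {a b : FreeAlgebra ℂ Gen} (h : ModeRel a b) : toModes a = toModes b :=
  RingQuot.mkAlgHom_rel ℂ h

lemma toModes_surjective : Function.Surjective toModes := RingQuot.mkAlgHom_surjective ℂ ModeRel

@[simp] lemma toModes_fe (u : DD ℂ) (n : ℤ) : toModes (fe u n) = mode (Gen.even u n) := rfl

@[simp] lemma toModes_fo (u : DD ℂ) (n : ℤ) : toModes (fo u n) = mode (Gen.odd u n) := rfl

section Induced

variable {Z : Type} [AddCommGroup Z] [Module ℂ Z] (E : Idx → Module.End ℂ Z)

/-- The action of the mode algebra on the induced module. -/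
def actInd : ModeAlgebra →ₐ[ℂ] Module.End ℂ (Ind E) := Algebra.lsmul ℂ ℂ (Ind E)

lemma actInd_apply (a : ModeAlgebra) (v : Ind E) : actInd E a v = a • v := rfl

lemma op_eq (g : ℤ → Gen) (n : ℤ) : op E g n = actInd E (mode (g n)) := rfl

/-- The even modes. -/
def evInd (n : ℤ) : DD ℂ →ₗ[ℂ] Module.End ℂ (Ind E) where
  toFun u := op E (Gen.even u) n
  map_add' u v := by
    simp only [op_eq, ← map_add]
    exact congrArg (actInd E) (by simpa using toModes_rel (ModeRel.even_add u v n))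
  map_smul' c u := by
    simp only [op_eq, ← map_smul, RingHom.id_apply]
    exact congrArg (actInd E) (by simpa using toModes_rel (ModeRel.even_smul c u n))

/-- The odd modes. -/
def odInd (n : ℤ) : DD ℂ →ₗ[ℂ] Module.End ℂ (Ind E) where
  toFun u := op E (Gen.odd u) n
  map_add' u v := by
    simp only [op_eq, ← map_add]
    exact congrArg (actInd E) (by simpa using toModes_rel (ModeRel.odd_add u v n))
  map_smul' c u := by
    simp only [op_eq, ← map_smul, RingHom.id_apply]
    exact congrArg (actInd E) (by simpa using toModes_rel (ModeRel.odd_smul c u n))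

lemma evInd_evInd (m n : ℤ) (u v : DD ℂ) : evInd E m u * evInd E n v
    = evInd E n v * evInd E m u + evInd E (m + n) (bracket u v)
      + (if m + n = 0 then (m : ℂ) * pair u v else 0) • 1 := by
  have h := congrArg (actInd E) (toModes_rel (ModeRel.even_even u v m n))
  rw [map_mul, map_mul, map_add, map_add, map_add, map_add, map_mul, map_mul, AlgHom.commutes,
    AlgHom.commutes, Algebra.algebraMap_eq_smul_one] at h
  exact h

lemma evInd_odInd (m k : ℤ) (u v : DD ℂ) : evInd E m u * odInd E k v
    = odInd E k v * evInd E m u + odInd E (m + k) (bracket u v) := by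
  have h := congrArg (actInd E) (toModes_rel (ModeRel.even_odd u v m k))
  rw [map_mul, map_mul, map_add, map_add, map_mul, map_mul] at h
  exact h

lemma odInd_odInd (k l : ℤ) (u v : DD ℂ) : odInd E k u * odInd E l v
    = -(odInd E l v * odInd E k u) + (if k + l + 1 = 0 then pair u v else 0) • 1 := by
  have h := congrArg (actInd E) (toModes_rel (ModeRel.odd_odd u v k l))
  rw [map_mul, map_mul, map_add, map_add, map_neg, map_neg, map_mul, map_mul, AlgHom.commutes,
    AlgHom.commutes, Algebra.algebraMap_eq_smul_one] at h
  exact h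

lemma mode_smul_incl (a : ModeAlgebra) (z : Z) : a • incl E z
    = (Submodule.Quotient.mk (a ⊗ₜ[ℂ] z) : (ModeAlgebra ⊗[ℂ] Z) ⧸ indRelations E) := by
  have : a • ((1 : ModeAlgebra) ⊗ₜ[ℂ] z) = a ⊗ₜ[ℂ] z := by
    rw [TensorProduct.smul_tmul', smul_eq_mul, mul_one]
  rw [← this]
  rfl

lemma evInd_incl {n : ℤ} (hn : 0 < n) (u : DD ℂ) (z : Z) : evInd E n u (incl E z) = 0 := by
  change mode (Gen.even u n) • incl E z = 0
  rw [mode_smul_incl]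
  exact (Submodule.Quotient.mk_eq_zero _).mpr
    (Submodule.subset_span (Or.inl (Or.inl ⟨u, n, z, hn, rfl⟩)))

lemma odInd_incl {k : ℤ} (hk : 0 ≤ k) (u : DD ℂ) (z : Z) : odInd E k u (incl E z) = 0 := by
  change mode (Gen.odd u k) • incl E z = 0
  rw [mode_smul_incl]
  exact (Submodule.Quotient.mk_eq_zero _).mpr
    (Submodule.subset_span (Or.inl (Or.inr ⟨u, k, z, hk, rfl⟩)))

/-- The vectors on which all modes of large degree vanish. -/
def smoothPart : Submodule ℂ (Ind E) where
  carrier := {v | ∀ u, ∃ N : ℤ, ∀ n ≥ N, evInd E n u v = 0 ∧ odInd E n u v = 0}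
  add_mem' {v w} hv hw u := by
    obtain ⟨N, hN⟩ := hv u
    obtain ⟨N', hN'⟩ := hw u
    refine ⟨max N N', fun n hn => ?_⟩
    have h1 := hN n (le_of_max_le_left hn)
    have h2 := hN' n (le_of_max_le_right hn)
    simp [h1.1, h1.2, h2.1, h2.2]
  zero_mem' u := ⟨0, by simp⟩
  smul_mem' c v hv u := by
    obtain ⟨N, hN⟩ := hv u
    exact ⟨N, fun n hn => by simp [hN n hn]⟩

/-- Commuting a mode of degree `n` past `g` produces a mode of the bracket whose degree also grows
with `n`; the central term is absent once `n` is large. -/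
lemma mode_smul_mem_smoothPart (g : Gen) {v : Ind E} (hv : v ∈ smoothPart E) :
    mode g • v ∈ smoothPart E := by
  intro u
  rcases g with ⟨w, m⟩ | ⟨w, m⟩
  · obtain ⟨N, hN⟩ := hv u
    obtain ⟨N', hN'⟩ := hv (bracket u w)
    refine ⟨max (max N (N' - m)) (1 - m), fun n hn => ?_⟩
    have h1 := hN n (le_of_max_le_left (le_of_max_le_left hn))
    have h2 := hN' (n + m) (by have := le_of_max_le_right (le_of_max_le_left hn); omega)
    have h3 : ¬ n + m = 0 := by have := le_of_max_le_right hn; omega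
    constructor
    · have := LinearMap.congr_fun (evInd_evInd E n m u w) v
      simp only [Module.End.mul_apply, LinearMap.add_apply, h1.1, h2.1, if_neg h3, zero_smul,
        map_zero, add_zero] at this
      exact this
    · have := LinearMap.congr_fun (evInd_odInd E m n w u) v
      rw [bracket_swap, map_neg, add_comm m n] at this
      simp only [Module.End.mul_apply, LinearMap.add_apply, h1.2, LinearMap.neg_apply, h2.2,
        map_zero, neg_zero, add_zero] at this
      exact this.symm
  · obtain ⟨N, hN⟩ := hv u
    obtain ⟨N', hN'⟩ := hv (bracket u w)
    refine ⟨max (max N (N' - m)) (-m), fun n hn => ?_⟩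
    have h1 := hN n (le_of_max_le_left (le_of_max_le_left hn))
    have h2 := hN' (n + m) (by have := le_of_max_le_right (le_of_max_le_left hn); omega)
    have h3 : ¬ n + m + 1 = 0 := by have := le_of_max_le_right hn; omega
    constructor
    · have := LinearMap.congr_fun (evInd_odInd E n m u w) v
      simp only [Module.End.mul_apply, LinearMap.add_apply, h1.1, h2.2, map_zero, add_zero] at this
      exact this
    · have := LinearMap.congr_fun (odInd_odInd E n m u w) v
      simp only [Module.End.mul_apply, h1.2, LinearMap.neg_apply, if_neg h3,
        zero_smul, map_zero, neg_zero, add_zero] at this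
      exact this

/-- The zero modes generate the induced module over the modes, so a subspace containing them and
stable under every mode is everything. -/
lemma ind_induction {S : Submodule ℂ (Ind E)} (h0 : ∀ z, incl E z ∈ S)
    (h1 : ∀ g, ∀ v ∈ S, mode g • v ∈ S) (v : Ind E) : v ∈ S := by
  have key : ∀ a : FreeAlgebra ℂ Gen, ∀ v ∈ S, toModes a • v ∈ S := by
    intro a
    induction a using FreeAlgebra.induction with
    | grade0 c =>
      intro v hv
      rw [AlgHom.commutes, algebraMap_smul]
      exact S.smul_mem c hv
    | grade1 g => exact fun v hv => h1 g v hv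
    | mul a b ha hb =>
      intro v hv
      rw [map_mul, mul_smul]
      exact ha _ (hb v hv)
    | add a b ha hb =>
      intro v hv
      rw [map_add, add_smul]
      exact S.add_mem (ha v hv) (hb v hv)
  obtain ⟨t, rfl⟩ := Submodule.Quotient.mk_surjective (indRelations E) v
  induction t using TensorProduct.induction_on with
  | zero => exact S.zero_mem
  | tmul a z =>
    obtain ⟨b, rfl⟩ := toModes_surjective a
    have := key b _ (h0 z)
    rw [mode_smul_incl] at this
    exact this
  | add x y hx hy => exact S.add_mem hx hy

/-- The induced module as a module over the modes. -/
def repInd : ModeRep (Ind E) where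
  ev := evInd E
  od := odInd E
  ev_ev := evInd_evInd E
  ev_od := evInd_odInd E
  od_od := odInd_odInd E
  ev_field u v := by
    obtain ⟨N, hN⟩ := ind_induction E (S := smoothPart E)
      (fun z u => ⟨1, fun n hn => ⟨evInd_incl E (by omega) u z, odInd_incl E (by omega) u z⟩⟩)
      (fun g v hv => mode_smul_mem_smoothPart E g hv) v u
    exact ⟨N, fun n hn => (hN n hn).1⟩
  od_field u v := by
    obtain ⟨N, hN⟩ := ind_induction E (S := smoothPart E)
      (fun z u => ⟨1, fun n hn => ⟨evInd_incl E (by omega) u z, odInd_incl E (by omega) u z⟩⟩)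
      (fun g v hv => mode_smul_mem_smoothPart E g hv) v u
    exact ⟨N, fun n hn => (hN n hn).2⟩

/-! ### Parity -/

/-- The operators that shift the parity by `q`. -/
def parityShift (q : ZMod 2) : Submodule ℂ (Module.End ℂ (Ind E)) where
  carrier := {X | ∀ p, ∀ v ∈ parityPart E p, X v ∈ parityPart E (p + q)}
  add_mem' hX hY p v hv := Submodule.add_mem _ (hX p v hv) (hY p v hv)
  zero_mem' _ _ _ := Submodule.zero_mem _
  smul_mem' c _ hX p v hv := Submodule.smul_mem _ c (hX p v hv)

variable {E}

lemma mul_mem_parityShift {q r : ZMod 2} {X Y : Module.End ℂ (Ind E)} (hX : X ∈ parityShift E q)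
    (hY : Y ∈ parityShift E r) : X * Y ∈ parityShift E (q + r) := fun p v hv => by
  rw [add_comm q r, ← add_assoc]
  exact hX _ _ (hY p v hv)

lemma locSum_mem_parityShift {q : ZMod 2} {x : ℤ → Module.End ℂ (Ind E)}
    {X : Module.End ℂ (Ind E)} (hX : LocSum x X) (hx : ∀ j, x j ∈ parityShift E q) :
    X ∈ parityShift E q := fun p v hv => by
  rw [(hX v).2]
  exact finsum_induction (· ∈ parityPart E (p + q)) (Submodule.zero_mem _)
    (fun _ _ => Submodule.add_mem _) (fun j => hx j p v hv)

lemma mode_smul_parity {g : Gen} {q : ZMod 2} (hg : ∀ w, oddCount (g :: w) = oddCount w + q) :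
    actInd E (mode g) ∈ parityShift E q := fun p v hv => by
  induction hv using Submodule.span_induction with
  | mem v hv =>
    obtain ⟨w, z, hw, rfl⟩ := hv
    refine Submodule.subset_span ⟨g :: w, z, by rw [hg, hw], ?_⟩
    rw [actInd_apply, List.map_cons, List.prod_cons, mul_smul]
  | zero => rw [map_zero]; exact Submodule.zero_mem _
  | add v w _ _ hv hw => rw [map_add]; exact Submodule.add_mem _ hv hw
  | smul c v _ hv => rw [map_smul]; exact Submodule.smul_mem _ c hv

lemma ev_mem_parityShift (n : ℤ) (u : DD ℂ) : (repInd E).ev n u ∈ parityShift E 0 :=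
  mode_smul_parity fun w => by simp [oddCount]

lemma od_mem_parityShift (n : ℤ) (u : DD ℂ) : (repInd E).od n u ∈ parityShift E 1 :=
  mode_smul_parity fun w => by simp [oddCount]

lemma FF_mem_parityShift (n : ℤ) (u w : DD ℂ) : (repInd E).FF n u w ∈ parityShift E 0 :=
  locSum_mem_parityShift ((repInd E).locSum_FF n u w) fun j => by
    have key : ∀ a b u w, (repInd E).od a u * (repInd E).od b w ∈ parityShift E 0 :=
      fun a b u w => mul_mem_parityShift (q := 1) (r := 1) (od_mem_parityShift a u)
        (od_mem_parityShift b w)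
    split_ifs
    · exact key _ _ _ _
    · exact Submodule.neg_mem _ (key _ _ _ _)

lemma EF_mem_parityShift (n : ℤ) (u w : DD ℂ) : (repInd E).EF n u w ∈ parityShift E 1 :=
  locSum_mem_parityShift ((repInd E).locSum_EF n u w) fun j => by
    split_ifs
    · exact mul_mem_parityShift (q := 0) (r := 1) (ev_mem_parityShift _ u)
        (od_mem_parityShift _ w)
    · exact mul_mem_parityShift (q := 1) (r := 0) (od_mem_parityShift _ w)
        (ev_mem_parityShift _ u)

lemma FE_mem_parityShift (n : ℤ) (u w : DD ℂ) : (repInd E).FE n u w ∈ parityShift E 1 :=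
  locSum_mem_parityShift ((repInd E).locSum_FE n u w) fun j => by
    split_ifs
    · exact mul_mem_parityShift (q := 1) (r := 0) (od_mem_parityShift _ u)
        (ev_mem_parityShift _ w)
    · exact mul_mem_parityShift (q := 0) (r := 1) (ev_mem_parityShift _ w)
        (od_mem_parityShift _ u)

lemma JJ_mem_parityShift (e e' : Fin 4 → DD ℂ) (n : ℤ) :
    JJ (repInd E) e e' n ∈ parityShift E 0 :=
  Submodule.sum_mem _ fun _ _ => FF_mem_parityShift _ _ _

lemma QQ_mem_parityShift (e e' : Fin 4 → DD ℂ) (n : ℤ) :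
    QQ (repInd E) e e' n ∈ parityShift E 1 :=
  Submodule.sum_mem _ fun _ _ =>
    Submodule.sub_mem _ (EF_mem_parityShift _ _ _) (FE_mem_parityShift _ _ _)

lemma RR_mem_parityShift (e e' : Fin 4 → DD ℂ) (n : ℤ) :
    RR (repInd E) e e' n ∈ parityShift E 1 :=
  Submodule.sub_mem _
    (mul_mem_parityShift (q := 1) (r := 0) (QQ_mem_parityShift _ _ _) (JJ_mem_parityShift _ _ _))
    (mul_mem_parityShift (q := 0) (r := 1) (JJ_mem_parityShift _ _ _) (QQ_mem_parityShift _ _ _))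

end Induced

/-! ## `N = 2` structures on induced modules -/

lemma isField_JJ {M : Type} [AddCommGroup M] [Module ℂ M] (ρ : ModeRep M) (e e' : Fin 4 → DD ℂ) :
    IsField (JJ ρ e e') :=
  IsField.sum _ fun i => (isField_NO (-1) (ρ.od_field (e' i)) (ρ.od_field (e i))).shift (-1)

lemma isField_QQ {M : Type} [AddCommGroup M] [Module ℂ M] (ρ : ModeRep M) (e e' : Fin 4 → DD ℂ) :
    IsField (QQ ρ e e') :=
  IsField.sum _ fun i => (isField_NO 1 (ρ.ev_field (e' i)) (ρ.od_field (e i))).sub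
    (isField_NO 1 (ρ.od_field (e' i)) (ρ.ev_field (e i)))

lemma isField_RR {M : Type} [AddCommGroup M] [Module ℂ M] (ρ : ModeRep M) (e e' : Fin 4 → DD ℂ) :
    IsField (RR ρ e e') :=
  ((isField_QQ ρ e e').mul_right _).sub ((isField_QQ ρ e e').mul_left _)

/-! ### The super-currents of charge `±1` and their `N = 2` relations. -/

section Structure

variable {M : Type} [AddCommGroup M] [Module ℂ M] (ρ : ModeRep M) (e e' : Fin 4 → DD ℂ)

/-- The super-current of charge `1`. -/
def GGp (k : ℤ) : Module.End ℂ M := (1 / 2 : ℂ) • (RR ρ e e' k - QQ ρ e e' k)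

/-- The super-current of charge `-1`. -/
def GGm (k : ℤ) : Module.End ℂ M := (1 / 2 : ℂ) • (RR ρ e e' k + QQ ρ e e' k)

/-- The Virasoro modes. -/
def LL (n : ℤ) : Module.End ℂ M :=
  (1 / 2 : ℂ) • (RR ρ e e' 0 * RR ρ e e' (n - 1) + RR ρ e e' (n - 1) * RR ρ e e' 0)

variable {e e'} (h : DualFrame e e')
include h

lemma JJ_GGp (m k : ℤ) : JJ ρ e e' m * GGp ρ e e' k - GGp ρ e e' k * JJ ρ e e' m
    = GGp ρ e e' (m + k) := by
  have h1 := JJ_QQ ρ h m k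
  have h2 := RR_JJ ρ h k m
  rw [add_comm k m] at h2
  simp only [GGp, mul_smul_comm, smul_mul_assoc, ← smul_sub]
  congr 1
  rw [← h2, ← neg_neg (RR ρ e e' (m + k)), ← h1]
  noncomm_ring

lemma JJ_GGm (m k : ℤ) : JJ ρ e e' m * GGm ρ e e' k - GGm ρ e e' k * JJ ρ e e' m
    = -GGm ρ e e' (m + k) := by
  have h1 := JJ_QQ ρ h m k
  have h2 := RR_JJ ρ h k m
  rw [add_comm k m] at h2
  simp only [GGm, mul_smul_comm, smul_mul_assoc, ← smul_sub, ← smul_neg]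
  congr 1
  rw [← h2, neg_add, ← h1]
  noncomm_ring

lemma GGp_GGp (k l : ℤ) : GGp ρ e e' k * GGp ρ e e' l + GGp ρ e e' l * GGp ρ e e' k = 0 := by
  have h1 := QQ_QQ ρ h k l
  have h2 := RR_QQ ρ h k l
  have h3 := RR_QQ ρ h l k
  rw [add_comm l k] at h2
  simp only [GGp, mul_smul_comm, smul_mul_assoc, ← smul_add]
  have : (RR ρ e e' k - QQ ρ e e' k) * (RR ρ e e' l - QQ ρ e e' l)
      + (RR ρ e e' l - QQ ρ e e' l) * (RR ρ e e' k - QQ ρ e e' k)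
      = (RR ρ e e' k * RR ρ e e' l + RR ρ e e' l * RR ρ e e' k)
      + (QQ ρ e e' k * QQ ρ e e' l + QQ ρ e e' l * QQ ρ e e' k)
      - (RR ρ e e' k * QQ ρ e e' l + QQ ρ e e' l * RR ρ e e' k)
      - (RR ρ e e' l * QQ ρ e e' k + QQ ρ e e' k * RR ρ e e' l) := by noncomm_ring
  rw [this, h1, h2, h3]
  module

lemma GGm_GGm (k l : ℤ) : GGm ρ e e' k * GGm ρ e e' l + GGm ρ e e' l * GGm ρ e e' k = 0 := by
  have h1 := QQ_QQ ρ h k l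
  have h2 := RR_QQ ρ h k l
  have h3 := RR_QQ ρ h l k
  rw [add_comm l k] at h2
  simp only [GGm, mul_smul_comm, smul_mul_assoc, ← smul_add]
  have : (RR ρ e e' k + QQ ρ e e' k) * (RR ρ e e' l + QQ ρ e e' l)
      + (RR ρ e e' l + QQ ρ e e' l) * (RR ρ e e' k + QQ ρ e e' k)
      = (RR ρ e e' k * RR ρ e e' l + RR ρ e e' l * RR ρ e e' k)
      + (QQ ρ e e' k * QQ ρ e e' l + QQ ρ e e' l * QQ ρ e e' k)
      + (RR ρ e e' k * QQ ρ e e' l + QQ ρ e e' l * RR ρ e e' k)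
      + (RR ρ e e' l * QQ ρ e e' k + QQ ρ e e' k * RR ρ e e' l) := by noncomm_ring
  rw [this, h1, h2, h3]
  module

lemma GGp_GGm (k l : ℤ) : GGp ρ e e' k * GGm ρ e e' l + GGm ρ e e' l * GGp ρ e e' k
    = LL ρ e e' (k + l + 1) + (((k : ℂ) - l) / 2) • JJ ρ e e' (k + l + 1)
      + (if k + l + 1 = 0 then (12 : ℂ) / 6 * (((k : ℂ) + 1 / 2) ^ 2 - 1 / 4) else 0) • 1 := by
  have h1 := QQ_QQ ρ h k l
  have h2 := RR_QQ ρ h k l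
  have h3 := RR_QQ ρ h l k
  have h4 := RR_RR ρ h k l
  rw [add_comm l k] at h2
  simp only [GGp, GGm, LL, mul_smul_comm, smul_mul_assoc, ← smul_add]
  have : (RR ρ e e' k - QQ ρ e e' k) * (RR ρ e e' l + QQ ρ e e' l)
      + (RR ρ e e' l + QQ ρ e e' l) * (RR ρ e e' k - QQ ρ e e' k)
      = (RR ρ e e' k * RR ρ e e' l + RR ρ e e' l * RR ρ e e' k)
      - (QQ ρ e e' k * QQ ρ e e' l + QQ ρ e e' l * QQ ρ e e' k)
      + (RR ρ e e' k * QQ ρ e e' l + QQ ρ e e' l * RR ρ e e' k)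
      - (RR ρ e e' l * QQ ρ e e' k + QQ ρ e e' k * RR ρ e e' l) := by noncomm_ring
  rw [this, h1, h2, h3, h4, add_sub_cancel_right]
  split_ifs
  · module
  · module

end Structure

section Induced

variable {Z : Type} [AddCommGroup Z] [Module ℂ Z] (E : Idx → Module.End ℂ Z)

/-- The `N = 2` structure of a pair of dual bases of complementary isotropic subalgebras. -/
def n2OfDualFrame {e e' : Fin 4 → DD ℂ} (h : DualFrame e e') :
    N2Structure 12 (Ind E) (parityPart E) :=
  have hJJ : ∀ m n : ℤ, JJ (repInd E) e e' m * JJ (repInd E) e e' n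
      - JJ (repInd E) e e' n * JJ (repInd E) e e' m
      = (if m + n = 0 then (12 : ℂ) / 3 * (m : ℂ) else 0) • 1 := fun m n => by
    rw [JJ_JJ _ h]; norm_num
  have hLJ := jacobi_L_J hJJ (JJ_GGp (repInd E) h) (JJ_GGm (repInd E) h) (GGp_GGm (repInd E) h)
  have hLp := jacobi_L_Gp (JJ_GGp (repInd E) h) (GGp_GGp (repInd E) h) (GGp_GGm (repInd E) h)
  have hLm := jacobi_L_Gm (JJ_GGm (repInd E) h) (GGm_GGm (repInd E) h) (GGp_GGm (repInd E) h)
  { L := LL (repInd E) e e'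
    J := JJ (repInd E) e e'
    Gp := GGp (repInd E) e e'
    Gm := GGm (repInd E) e e'
    L_field := (((isField_RR (repInd E) e e').mul_left _).add
      ((isField_RR (repInd E) e e').mul_right _)).smul (1 / 2) |>.shift (-1)
    J_field := isField_JJ _ _ _
    Gp_field := ((isField_RR _ _ _).sub (isField_QQ _ _ _)).smul _
    Gm_field := ((isField_RR _ _ _).add (isField_QQ _ _ _)).smul _
    L_even := fun n p v hv => by
      have : LL (repInd E) e e' n ∈ parityShift E 0 :=
        Submodule.smul_mem _ _ (Submodule.add_mem _
          (mul_mem_parityShift (q := 1) (r := 1) (RR_mem_parityShift _ _ _)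
            (RR_mem_parityShift _ _ _))
          (mul_mem_parityShift (q := 1) (r := 1) (RR_mem_parityShift _ _ _)
            (RR_mem_parityShift _ _ _)))
      simpa using this p v hv
    J_even := fun n p v hv => by simpa using JJ_mem_parityShift e e' n p v hv
    Gp_odd := fun k p v hv => (Submodule.smul_mem _ _ (Submodule.sub_mem _
      (RR_mem_parityShift e e' k) (QQ_mem_parityShift e e' k)) :
        GGp (repInd E) e e' k ∈ parityShift E 1) p v hv
    Gm_odd := fun k p v hv => (Submodule.smul_mem _ _ (Submodule.add_mem _
      (RR_mem_parityShift e e' k) (QQ_mem_parityShift e e' k)) :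
        GGm (repInd E) e e' k ∈ parityShift E 1) p v hv
    L_L := jacobi_L_L (GGp_GGm (repInd E) h) hLJ hLp hLm
    L_J := hLJ
    L_Gp := hLp
    L_Gm := hLm
    J_J := hJJ
    J_Gp := JJ_GGp (repInd E) h
    J_Gm := JJ_GGm (repInd E) h
    Gp_Gp := GGp_GGp (repInd E) h
    Gm_Gm := GGm_GGm (repInd E) h
    Gp_Gm := GGp_GGm (repInd E) h }

variable {E}

/-- Normally ordered products are unique, so the auxiliary fields in the definition can be
eliminated. The index `k + 1` there compensates the shift between `NO` and `IsNormalProduct`. -/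
lemma isGeneratedBy_iff {c : ℂ} (S : N2Structure c (Ind E) (parityPart E)) (e e' : Fin 4 → DD ℂ) :
    IsGeneratedBy S e e' ↔ (∀ n, S.J n = JJ (repInd E) e e' n) ∧
      ∀ k, S.Gm k - S.Gp k = QQ (repInd E) e e' k := by
  constructor
  · rintro ⟨F, A, B, hF, hA, hB, hJ, hG⟩
    refine ⟨fun n => ?_, fun k => ?_⟩
    · rw [hJ]
      exact Finset.sum_congr rfl fun i _ =>
        (hF i).eq_NO ((repInd E).od_field (e' i)) ((repInd E).od_field (e i)) n
    · rw [hG]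
      refine Finset.sum_congr rfl fun i _ => ?_
      rw [(hA i).eq_NO ((repInd E).ev_field (e' i)) ((repInd E).od_field (e i)) (k + 1),
        (hB i).eq_NO ((repInd E).od_field (e' i)) ((repInd E).ev_field (e i)) (k + 1),
        add_sub_cancel_right]
      rfl
  · rintro ⟨hJ, hG⟩
    refine ⟨_, _, _,
      fun i => isNormalProduct_NO (-1) ((repInd E).od_field (e' i)) ((repInd E).od_field (e i)),
      fun i => isNormalProduct_NO 1 ((repInd E).ev_field (e' i)) ((repInd E).od_field (e i)),
      fun i => isNormalProduct_NO 1 ((repInd E).od_field (e' i)) ((repInd E).ev_field (e i)),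
      hJ, fun k => ?_⟩
    rw [hG]
    simp only [add_sub_cancel_right]
    rfl

lemma n2OfDualFrame_isGeneratedBy {e e' : Fin 4 → DD ℂ} (h : DualFrame e e') :
    IsGeneratedBy (n2OfDualFrame E h) e e' := by
  rw [isGeneratedBy_iff]
  refine ⟨fun n => rfl, fun k => ?_⟩
  change GGm (repInd E) e e' k - GGp (repInd E) e e' k = _
  rw [GGm, GGp]
  module

end Induced

/-! ### Recovering an `N = 2` structure from its generating super-field. -/

section Formulas

variable {M : Type} [AddCommGroup M] [Module ℂ M] {P : ZMod 2 → Submodule ℂ M} {c : ℂ}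
  (S : N2Structure c M P)

/-- `[J_0, ·]` is `1` on `G^+` and `-1` on `G^-`, so the difference of the currents and its bracket
with `J_0` determine both. -/
lemma N2Structure.Gp_eq (k : ℤ) : S.Gp k = (-(1 / 2) : ℂ) • ((S.Gm k - S.Gp k)
    + (S.J 0 * (S.Gm k - S.Gp k) - (S.Gm k - S.Gp k) * S.J 0)) := by
  have h1 := S.J_Gp 0 k
  have h2 := S.J_Gm 0 k
  rw [zero_add] at h1 h2
  have : S.J 0 * (S.Gm k - S.Gp k) - (S.Gm k - S.Gp k) * S.J 0
      = (S.J 0 * S.Gm k - S.Gm k * S.J 0) - (S.J 0 * S.Gp k - S.Gp k * S.J 0) := by noncomm_ring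
  rw [this, h1, h2]
  module

lemma N2Structure.Gm_eq (k : ℤ) : S.Gm k = (1 / 2 : ℂ) • ((S.Gm k - S.Gp k)
    - (S.J 0 * (S.Gm k - S.Gp k) - (S.Gm k - S.Gp k) * S.J 0)) := by
  have h1 := S.J_Gp 0 k
  have h2 := S.J_Gm 0 k
  rw [zero_add] at h1 h2
  have : S.J 0 * (S.Gm k - S.Gp k) - (S.Gm k - S.Gp k) * S.J 0
      = (S.J 0 * S.Gm k - S.Gm k * S.J 0) - (S.J 0 * S.Gp k - S.Gp k * S.J 0) := by noncomm_ring
  rw [this, h1, h2]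
  module

/-- The index `0` is chosen because the central term of that anticommutator vanishes. -/
lemma N2Structure.L_eq (n : ℤ) : S.L n = S.Gp 0 * S.Gm (n - 1) + S.Gm (n - 1) * S.Gp 0
    + (((n : ℂ) - 1) / 2) • S.J n := by
  have h := S.Gp_Gm 0 (n - 1)
  rw [show 0 + (n - 1) + 1 = n by ring] at h
  rw [h]
  have e : (if n = 0 then c / 6 * ((((0 : ℤ) : ℂ) + 1 / 2) ^ 2 - 1 / 4) else 0 : ℂ) = 0 := by
    split_ifs
    · norm_num
    · rfl
  rw [e]
  push_cast
  module

/-- A linear isomorphism that intertwines the generating super-fields of two `N = 2` structures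
intertwines the structures. -/
lemma N2Structure.intertwines {M' : Type} [AddCommGroup M'] [Module ℂ M']
    {P' : ZMod 2 → Submodule ℂ M'} (S' : N2Structure c M' P') (Φ : M →ₗ[ℂ] M')
    (hJ : ∀ n v, Φ (S.J n v) = S'.J n (Φ v))
    (hQ : ∀ k v, Φ ((S.Gm k - S.Gp k) v) = (S'.Gm k - S'.Gp k) (Φ v)) (n : ℤ) (v : M) :
    Φ (S.L n v) = S'.L n (Φ v) ∧ Φ (S.J n v) = S'.J n (Φ v) ∧
      Φ (S.Gp n v) = S'.Gp n (Φ v) ∧ Φ (S.Gm n v) = S'.Gm n (Φ v) := by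
  have hp : ∀ k v, Φ (S.Gp k v) = S'.Gp k (Φ v) := fun k v => by
    rw [S.Gp_eq, S'.Gp_eq]
    simp only [LinearMap.smul_apply, LinearMap.add_apply, Module.End.mul_apply, map_smul, map_add,
      map_sub, hJ, hQ, LinearMap.sub_apply (S.J 0 * _), LinearMap.sub_apply (S'.J 0 * _)]
  have hm : ∀ k v, Φ (S.Gm k v) = S'.Gm k (Φ v) := fun k v => by
    rw [S.Gm_eq, S'.Gm_eq]
    simp only [LinearMap.smul_apply, LinearMap.sub_apply (S.Gm k - S.Gp k),
      LinearMap.sub_apply (S'.Gm k - S'.Gp k), Module.End.mul_apply, map_smul,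
      map_sub, hJ, hQ, LinearMap.sub_apply (S.J 0 * _), LinearMap.sub_apply (S'.J 0 * _)]
  refine ⟨?_, hJ n v, hp n v, hm n v⟩
  rw [S.L_eq, S'.L_eq]
  simp only [LinearMap.add_apply, Module.End.mul_apply, map_add, LinearMap.smul_apply, map_smul,
    hp, hm, hJ]

lemma N2Structure.eq_of_generators {S S' : N2Structure c M P} (hJ : ∀ n, S.J n = S'.J n)
    (hQ : ∀ k, S.Gm k - S.Gp k = S'.Gm k - S'.Gp k) : S = S' := by
  have h := S.intertwines S' LinearMap.id (fun n v => by rw [hJ]; rfl) (fun n v => by rw [hQ]; rfl)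
  refine N2Structure.ext ?_ ?_ ?_ ?_ <;> funext n <;> ext1 v
  · exact (h n v).1
  · exact (h n v).2.1
  · exact (h n v).2.2.1
  · exact (h n v).2.2.2

end Formulas

/-! ### Independence of the dual bases -/

/-- `∑ e^i ⊗ e_i` is the canonical element of the pairing: the transition matrices of two pairs of
dual bases are inverse transposes of each other. -/
lemma DualFrame.tensor_eq {e e' f f' : Fin 4 → DD ℂ} (h : DualFrame e e')
    (hf : ∀ i j, pair (e j) (f i) = 0) (hf' : ∀ i j, pair (e' j) (f' i) = 0)
    (hd : ∀ i j, pair (f' i) (f j) = if i = j then 1 else 0) {V : Type} [AddCommGroup V]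
    [Module ℂ V] (β : DD ℂ →ₗ[ℂ] DD ℂ →ₗ[ℂ] V) :
    ∑ i, β (f' i) (f i) = ∑ i, β (e' i) (e i) := by
  have h1 : ∀ i, f i = ∑ j, pair (e' j) (f i) • e j := fun i => by
    conv_lhs => rw [h.expand (f i)]
    simp [hf]
  have h2 : ∀ i, f' i = ∑ j, pair (e j) (f' i) • e' j := fun i => by
    conv_lhs => rw [h.expand (f' i)]
    simp [hf']
  let A : Matrix (Fin 4) (Fin 4) ℂ := Matrix.of fun i j => pair (e' j) (f i)
  let B : Matrix (Fin 4) (Fin 4) ℂ := Matrix.of fun i j => pair (e j) (f' i)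
  have hBA : B * A.transpose = 1 := by
    ext i k
    rw [Matrix.mul_apply, Matrix.one_apply, ← hd i k]
    change ∑ j, pair (e j) (f' i) * pair (e' j) (f k) = _
    conv_rhs => rw [h2 i]
    rw [← pairL_apply, map_sum, LinearMap.sum_apply]
    simp
  have hAB : A.transpose * B = 1 := mul_eq_one_comm.mp hBA
  have h3 : ∀ i, β (f' i) (f i) = ∑ j, ∑ k, (A i k * B i j) • β (e' j) (e k) := fun i => by
    conv_lhs => rw [h1 i, h2 i]
    simp only [map_sum, LinearMap.sum_apply, map_smul, LinearMap.smul_apply, Finset.smul_sum,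
      smul_smul]
    rw [Finset.sum_comm]
    rfl
  simp only [h3]
  rw [Finset.sum_comm]
  refine Finset.sum_congr rfl fun j _ => ?_
  rw [Finset.sum_comm]
  simp only [← Finset.sum_smul]
  have h4 : ∀ k, ∑ i, A i k * B i j = if k = j then 1 else 0 := fun k => by
    rw [← Matrix.one_apply, ← hAB, Matrix.mul_apply]
    rfl
  simp [h4]

/-- The generating fields are bilinear in the bases, so `DualFrame.tensor_eq` applies to them. -/
lemma DualFrame.isGeneratedBy {Z : Type} [AddCommGroup Z] [Module ℂ Z] {E : Idx → Module.End ℂ Z}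
    {c : ℂ} {S : N2Structure c (Ind E) (parityPart E)} {e e' f f' : Fin 4 → DD ℂ}
    (h : DualFrame e e') (hf : ∀ i j, pair (e j) (f i) = 0) (hf' : ∀ i j, pair (e' j) (f' i) = 0)
    (hd : ∀ i j, pair (f' i) (f j) = if i = j then 1 else 0) (hS : IsGeneratedBy S e e') :
    IsGeneratedBy S f f' := by
  rw [isGeneratedBy_iff] at hS ⊢
  refine ⟨fun n => (hS.1 n).trans ?_, fun k => (hS.2 k).trans ?_⟩
  · exact (h.tensor_eq hf hf' hd ((repInd E).FFL (n - 1))).symm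
  · exact (h.tensor_eq hf hf' hd ((repInd E).EFL k - (repInd E).FEL k)).symm

/-! ### Functoriality -/

section Functor

variable {Z Z' : Type} [AddCommGroup Z] [Module ℂ Z] [AddCommGroup Z'] [Module ℂ Z']
  {E : Idx → Module.End ℂ Z} {E' : Idx → Module.End ℂ Z'}

lemma map_indRelations_le (Ψ : Z →ₗ[ℂ] Z') (hΨ : ∀ a z, Ψ (E a z) = E' a (Ψ z)) :
    indRelations E ≤ (indRelations E').comap
      (TensorProduct.AlgebraTensorModule.map (LinearMap.id : ModeAlgebra →ₗ[ModeAlgebra] _) Ψ) := by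
  refine Submodule.span_le.mpr ?_
  rintro t ((⟨u, n, z, hn, rfl⟩ | ⟨u, k, z, hk, rfl⟩) | ⟨u, z, rfl⟩)
  · exact Submodule.subset_span (Or.inl (Or.inl ⟨u, n, Ψ z, hn, rfl⟩))
  · exact Submodule.subset_span (Or.inl (Or.inr ⟨u, k, Ψ z, hk, rfl⟩))
  · refine Submodule.subset_span (Or.inr ⟨u, Ψ z, ?_⟩)
    simp [hΨ]

/-- The isomorphism of induced modules given by an isomorphism of zero modes. -/
def indEquiv (Ψ : Z ≃ₗ[ℂ] Z') (hΨ : ∀ a z, Ψ (E a z) = E' a (Ψ z)) :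
    Ind E ≃ₗ[ModeAlgebra] Ind E' :=
  Submodule.Quotient.equiv (indRelations E) (indRelations E')
    (TensorProduct.AlgebraTensorModule.congr (LinearEquiv.refl ModeAlgebra ModeAlgebra) Ψ) (by
      refine le_antisymm (Submodule.map_le_iff_le_comap.mpr (map_indRelations_le Ψ.toLinearMap hΨ))
        fun t ht => ?_
      have hΨ' : ∀ a z, Ψ.symm (E' a z) = E a (Ψ.symm z) := fun a z => by
        rw [LinearEquiv.symm_apply_eq, hΨ, LinearEquiv.apply_symm_apply]
      refine ⟨_, map_indRelations_le Ψ.symm.toLinearMap hΨ' ht, ?_⟩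
      exact (TensorProduct.AlgebraTensorModule.congr (LinearEquiv.refl ModeAlgebra ModeAlgebra)
        Ψ).apply_symm_apply t)

lemma indEquiv_incl (Ψ : Z ≃ₗ[ℂ] Z') (hΨ : ∀ a z, Ψ (E a z) = E' a (Ψ z)) (z : Z) :
    indEquiv Ψ hΨ (incl E z) = incl E' (Ψ z) := rfl

lemma map_mem_parityPart (Φ : Ind E →ₗ[ModeAlgebra] Ind E') {Ψ : Z → Z'}
    (hΦ : ∀ z, Φ (incl E z) = incl E' (Ψ z)) {p : ZMod 2} {v : Ind E} (hv : v ∈ parityPart E p) :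
    Φ v ∈ parityPart E' p := by
  induction hv using Submodule.span_induction with
  | mem v hv =>
    obtain ⟨w, z, hw, rfl⟩ := hv
    exact Submodule.subset_span ⟨w, Ψ z, hw, by rw [map_smul, hΦ]⟩
  | zero => rw [map_zero]; exact Submodule.zero_mem _
  | add v w _ _ hv hw => rw [map_add]; exact Submodule.add_mem _ hv hw
  | smul c v _ hv =>
    have : Φ (c • v) = c • Φ v := (Φ.restrictScalars ℂ).map_smul c v
    rw [this]
    exact Submodule.smul_mem _ c hv

lemma map_locSum (Φ : Ind E →ₗ[ModeAlgebra] Ind E') {x : ℤ → Module.End ℂ (Ind E)}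
    {x' : ℤ → Module.End ℂ (Ind E')} {X : Module.End ℂ (Ind E)} {X' : Module.End ℂ (Ind E')}
    (hX : LocSum x X) (hX' : LocSum x' X') (hx : ∀ j v, Φ (x j v) = x' j (Φ v)) (v : Ind E) :
    Φ (X v) = X' (Φ v) := by
  rw [(hX v).2, (hX' (Φ v)).2, ← finsum_congr fun j => hx j v]
  exact Φ.toAddMonoidHom.map_finsum (hX v).1

lemma map_ev (Φ : Ind E →ₗ[ModeAlgebra] Ind E') (n : ℤ) (u : DD ℂ) (v : Ind E) :
    Φ ((repInd E).ev n u v) = (repInd E').ev n u (Φ v) := Φ.map_smul _ _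

lemma map_od (Φ : Ind E →ₗ[ModeAlgebra] Ind E') (n : ℤ) (u : DD ℂ) (v : Ind E) :
    Φ ((repInd E).od n u v) = (repInd E').od n u (Φ v) := Φ.map_smul _ _

lemma map_JJ (Φ : Ind E →ₗ[ModeAlgebra] Ind E') (e e' : Fin 4 → DD ℂ) (n : ℤ) (v : Ind E) :
    Φ (JJ (repInd E) e e' n v) = JJ (repInd E') e e' n (Φ v) := by
  simp only [JJ, LinearMap.sum_apply, map_sum]
  refine Finset.sum_congr rfl fun i _ => ?_
  refine map_locSum Φ ((repInd E).locSum_FF _ _ _) ((repInd E').locSum_FF _ _ _) (fun j v => ?_) v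
  split_ifs <;> simp [Module.End.mul_apply, map_od]

lemma map_QQ (Φ : Ind E →ₗ[ModeAlgebra] Ind E') (e e' : Fin 4 → DD ℂ) (n : ℤ) (v : Ind E) :
    Φ (QQ (repInd E) e e' n v) = QQ (repInd E') e e' n (Φ v) := by
  simp only [QQ, LinearMap.sum_apply, map_sum, LinearMap.sub_apply, map_sub]
  refine Finset.sum_congr rfl fun i _ => congrArg₂ _ ?_ ?_
  · refine map_locSum Φ ((repInd E).locSum_EF _ _ _) ((repInd E').locSum_EF _ _ _)
      (fun j v => ?_) v
    split_ifs <;> simp [Module.End.mul_apply, map_od, map_ev]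
  · refine map_locSum Φ ((repInd E).locSum_FE _ _ _) ((repInd E').locSum_FE _ _ _)
      (fun j v => ?_) v
    split_ifs <;> simp [Module.End.mul_apply, map_od, map_ev]

/-- Module maps of induced modules intertwine `N = 2` structures with the same generators. -/
lemma intertwines_of_isGeneratedBy (Φ : Ind E →ₗ[ModeAlgebra] Ind E') {c : ℂ}
    {S : N2Structure c (Ind E) (parityPart E)} {S' : N2Structure c (Ind E') (parityPart E')}
    {e e' : Fin 4 → DD ℂ} (hS : IsGeneratedBy S e e') (hS' : IsGeneratedBy S' e e')
    (n : ℤ) (v : Ind E) : Φ (S.L n v) = S'.L n (Φ v) ∧ Φ (S.J n v) = S'.J n (Φ v) ∧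
      Φ (S.Gp n v) = S'.Gp n (Φ v) ∧ Φ (S.Gm n v) = S'.Gm n (Φ v) := by
  rw [isGeneratedBy_iff] at hS hS'
  refine S.intertwines S' (Φ.restrictScalars ℂ) (fun n v => ?_) (fun k v => ?_) n v
  · rw [hS.1, hS'.1]; exact map_JJ Φ e e' n v
  · rw [hS.2, hS'.2]; exact map_QQ Φ e e' k v

end Functor

/-! ## Constant complex structures on the Lie algebra -/

lemma pair_single_left {K : Type} [CommRing K] (i : Fin 4) (v : DD K) :
    pair (Pi.single (Sum.inl i) 1) v = v (Sum.inr i) ∧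
      pair (Pi.single (Sum.inr i) 1) v = v (Sum.inl i) := by
  constructor <;> fin_cases i <;> simp [pair, Pi.single_apply]

lemma eq_zero_of_pair_eq_zero {K : Type} [CommRing K] {v : DD K} (h : ∀ u, pair u v = 0) :
    v = 0 := by
  funext a
  rcases a with i | i
  · rw [← (pair_single_left i v).2, h]; rfl
  · rw [← (pair_single_left i v).1, h]; rfl

/-- The inclusion of the Lie algebra in its complexification. -/
def toC (u : DD ℝ) : DD ℂ := fun a => (u a : ℂ)

lemma pair_toC (u v : DD ℝ) : pair (toC u) (toC v) = (pair u v : ℝ) := by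
  simp [pair, toC]

lemma bracket_toC (u v : DD ℝ) : bracket (toC u) (toC v) = toC (bracket u v) := by
  funext a
  rcases a with i | i
  · fin_cases i <;> simp [bracket, toC]
  · simp [bracket, toC]

lemma mulVec_toC (T : Matrix Idx Idx ℝ) (u : DD ℝ) :
    (T.map Complex.ofReal).mulVec (toC u) = toC (T.mulVec u) := by
  funext a
  simp [Matrix.mulVec, dotProduct, toC]

lemma toC_add (u v : DD ℝ) : toC (u + v) = toC u + toC v := by
  funext a; simp [toC]

lemma toC_neg (u : DD ℝ) : toC (-u) = -toC u := by
  funext a; simp [toC]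

lemma exists_re_im (u : DD ℂ) : ∃ x y : DD ℝ, u = toC x + Complex.I • toC y :=
  ⟨fun a => (u a).re, fun a => (u a).im, by
    funext a
    simp only [Pi.add_apply, Pi.smul_apply, toC, smul_eq_mul]
    rw [mul_comm]
    exact (Complex.re_add_im (u a)).symm⟩

lemma mem_plusEigen {T : Matrix Idx Idx ℝ} {u : DD ℂ} :
    u ∈ plusEigen T ↔ (T.map Complex.ofReal).mulVec u = Complex.I • u := by
  rw [plusEigen, Module.End.mem_eigenspace_iff, Matrix.toLin'_apply]

lemma mem_minusEigen {T : Matrix Idx Idx ℝ} {u : DD ℂ} :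
    u ∈ minusEigen T ↔ (T.map Complex.ofReal).mulVec u = (-Complex.I) • u := by
  rw [minusEigen, Module.End.mem_eigenspace_iff, Matrix.toLin'_apply]

/-- Complex conjugation on the complexification. -/
def conjC (u : DD ℂ) : DD ℂ := fun a => star (u a)

lemma conjC_mem {T : Matrix Idx Idx ℝ} {u : DD ℂ} : conjC u ∈ plusEigen T ↔ u ∈ minusEigen T := by
  rw [mem_plusEigen, mem_minusEigen]
  have h : (T.map Complex.ofReal).mulVec (conjC u) = conjC ((T.map Complex.ofReal).mulVec u) := by
    funext a
    simp [Matrix.mulVec, dotProduct, conjC]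
  rw [h]
  constructor <;> intro h
  · funext a
    have := congrArg star (congrFun h a)
    simpa [conjC] using this
  · rw [h]
    funext a
    simp [conjC]

lemma bracket_conjC (u v : DD ℂ) : bracket (conjC u) (conjC v) = conjC (bracket u v) := by
  funext a
  rcases a with i | i
  · fin_cases i <;> simp [bracket, conjC]
  · simp [bracket, conjC]

/-- An orthogonal complex structure on the Lie algebra whose `√-1`-eigenspace is a subalgebra. -/
structure IsLieComplex (T : Matrix Idx Idx ℝ) : Prop where
  square : T * T = -1
  orthogonal : ∀ u v : DD ℝ, pair (T.mulVec u) (T.mulVec v) = pair u v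
  closed : ∀ u ∈ plusEigen T, ∀ v ∈ plusEigen T, bracket u v ∈ plusEigen T

/-! ### Dual bases of the eigenspaces, and unimodularity. -/

section Isotropic

variable {T : Matrix Idx Idx ℝ}

lemma square_complex (hT : T * T = -1) (u : DD ℂ) :
    (T.map Complex.ofReal).mulVec ((T.map Complex.ofReal).mulVec u) = -u := by
  have h : (T.map Complex.ofReal) * (T.map Complex.ofReal) = -1 := by
    have := congrArg (fun A : Matrix Idx Idx ℝ => Complex.ofRealHom.mapMatrix A) hT
    rw [map_mul, map_neg, map_one] at this
    exact this
  rw [Matrix.mulVec_mulVec, h, Matrix.neg_mulVec, Matrix.one_mulVec]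

lemma orthogonal_complex (hT : ∀ u v : DD ℝ, pair (T.mulVec u) (T.mulVec v) = pair u v)
    (u v : DD ℂ) : pair ((T.map Complex.ofReal).mulVec u) ((T.map Complex.ofReal).mulVec v)
      = pair u v := by
  have h : ∀ x y : DD ℝ, pair ((T.map Complex.ofReal).mulVec (toC x))
      ((T.map Complex.ofReal).mulVec (toC y)) = pair (toC x) (toC y) := fun x y => by
    rw [mulVec_toC, mulVec_toC, pair_toC, pair_toC, hT]
  obtain ⟨x, y, rfl⟩ := exists_re_im u
  obtain ⟨x', y', rfl⟩ := exists_re_im v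
  simp only [← pairL_apply, Matrix.mulVec_add, Matrix.mulVec_smul, map_add, map_smul,
    LinearMap.add_apply, LinearMap.smul_apply] at h ⊢
  simp only [h]

lemma isotropic_plus (hT : ∀ u v : DD ℝ, pair (T.mulVec u) (T.mulVec v) = pair u v) {u v : DD ℂ}
    (hu : u ∈ plusEigen T) (hv : v ∈ plusEigen T) : pair u v = 0 := by
  have h := orthogonal_complex hT u v
  rw [mem_plusEigen.mp hu, mem_plusEigen.mp hv, ← pairL_apply, ← pairL_apply, map_smul, map_smul,
    LinearMap.smul_apply, smul_smul, Complex.I_mul_I, neg_smul, one_smul] at h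
  have := add_eq_zero_iff_eq_neg.mpr h.symm
  rw [pairL_apply, ← two_mul] at this
  exact (mul_eq_zero.mp this).resolve_left two_ne_zero

lemma isotropic_minus (hT : ∀ u v : DD ℝ, pair (T.mulVec u) (T.mulVec v) = pair u v) {u v : DD ℂ}
    (hu : u ∈ minusEigen T) (hv : v ∈ minusEigen T) : pair u v = 0 := by
  have h := orthogonal_complex hT u v
  rw [mem_minusEigen.mp hu, mem_minusEigen.mp hv, ← pairL_apply, ← pairL_apply, map_smul, map_smul,
    LinearMap.smul_apply, smul_smul, neg_mul_neg, Complex.I_mul_I, neg_smul, one_smul] at h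
  have := add_eq_zero_iff_eq_neg.mpr h.symm
  rw [pairL_apply, ← two_mul] at this
  exact (mul_eq_zero.mp this).resolve_left two_ne_zero

lemma exists_plus_minus (hT : T * T = -1) (u : DD ℂ) :
    ∃ p ∈ plusEigen T, ∃ m ∈ minusEigen T, u = p + m := by
  refine ⟨(1 / 2 : ℂ) • (u - Complex.I • (T.map Complex.ofReal).mulVec u), ?_,
    (1 / 2 : ℂ) • (u + Complex.I • (T.map Complex.ofReal).mulVec u), ?_, by module⟩
  · rw [mem_plusEigen, Matrix.mulVec_smul, Matrix.mulVec_sub, Matrix.mulVec_smul,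
      square_complex hT, smul_comm Complex.I, smul_sub Complex.I, smul_smul Complex.I Complex.I,
      Complex.I_mul_I]
    module
  · rw [mem_minusEigen, Matrix.mulVec_smul, Matrix.mulVec_add, Matrix.mulVec_smul,
      square_complex hT, smul_comm (-Complex.I), smul_add (-Complex.I), smul_smul (-Complex.I),
      neg_mul, Complex.I_mul_I]
    module

lemma isCompl_eigen (hT : T * T = -1) : IsCompl (plusEigen T) (minusEigen T) := by
  constructor
  · rw [Submodule.disjoint_def]
    intro u hu hv
    rw [mem_plusEigen] at hu
    rw [mem_minusEigen, hu, neg_smul] at hv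
    have : (2 * Complex.I) • u = 0 := by
      rw [mul_smul, two_smul]; nth_rw 1 [hv]; simp
    exact (smul_eq_zero.mp this).resolve_left (by simp)
  · rw [codisjoint_iff, eq_top_iff]
    intro u _
    obtain ⟨p, hp, m, hm, rfl⟩ := exists_plus_minus hT u
    exact Submodule.add_mem_sup hp hm

/-- The map from one eigenspace to the dual of the other. -/
def pairMap (A B : Submodule ℂ (DD ℂ)) : A →ₗ[ℂ] Module.Dual ℂ B :=
  ((pairL ℂ).domRestrict₁₂ A B)

/-- A vector of `A` orthogonal to `B` is orthogonal to `A` as well by isotropy, hence to everything.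
-/
lemma pairMap_injective {A B : Submodule ℂ (DD ℂ)} (hAB : A ⊔ B = ⊤)
    (hA : ∀ u ∈ A, ∀ v ∈ A, pair u v = 0) : Function.Injective (pairMap A B) := by
  rw [injective_iff_map_eq_zero]
  intro a ha
  apply Subtype.ext
  refine eq_zero_of_pair_eq_zero fun u => ?_
  have hu : u ∈ A ⊔ B := hAB ▸ Submodule.mem_top
  obtain ⟨x, hx, y, hy, rfl⟩ := Submodule.mem_sup.mp hu
  have h1 : pair a.1 y = 0 := LinearMap.congr_fun ha ⟨y, hy⟩
  rw [pair_comm, ← pairL_apply, map_add, pairL_apply, pairL_apply, h1, hA _ a.2 _ hx, add_zero]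

/-- The pairing embeds each eigenspace in the dual of the other. Both therefore have dimension `4`,
and the embeddings are isomorphisms under which a coordinate basis pulls back. -/
lemma exists_isDualBases (h1 : T * T = -1)
    (h2 : ∀ u v : DD ℝ, pair (T.mulVec u) (T.mulVec v) = pair u v) :
    ∃ e e', IsDualBases (plusEigen T) (minusEigen T) e e' := by
  have hc := isCompl_eigen h1
  have i1 := pairMap_injective (A := plusEigen T) (B := minusEigen T) hc.sup_eq_top
    (fun u hu v hv => isotropic_plus h2 hu hv)
  have i2 := pairMap_injective (A := minusEigen T) (B := plusEigen T)
    (sup_comm (plusEigen T) _ ▸ hc.sup_eq_top) (fun u hu v hv => isotropic_minus h2 hu hv)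
  have f1 := LinearMap.finrank_le_finrank_of_injective i1
  have f2 := LinearMap.finrank_le_finrank_of_injective i2
  rw [Subspace.dual_finrank_eq] at f1 f2
  have f3 := Submodule.finrank_add_eq_of_isCompl hc
  have f4 : Module.finrank ℂ (DD ℂ) = 8 := by simp
  have f5 : Module.finrank ℂ (plusEigen T) = 4 := by omega
  let b := Module.finBasisOfFinrankEq ℂ (plusEigen T) f5
  let φ := LinearMap.linearEquivOfInjective (pairMap (minusEigen T) (plusEigen T)) i2
    (by rw [Subspace.dual_finrank_eq]; omega)
  refine ⟨fun i => (b i : DD ℂ), fun i => ((φ.symm (b.coord i) : minusEigen T) : DD ℂ), ?_, ?_, ?_,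
    ?_⟩
  · exact b.linearIndependent.map' (plusEigen T).subtype (Submodule.ker_subtype _)
  · have := congrArg (Submodule.map (plusEigen T).subtype) b.span_eq
    rw [Submodule.map_span, ← Set.range_comp, Submodule.map_top, Submodule.range_subtype] at this
    exact this
  · exact fun i => (φ.symm (b.coord i)).2
  · intro i j
    have := LinearMap.congr_fun (φ.apply_symm_apply (b.coord i)) (b j)
    rw [Module.Basis.coord_apply, Module.Basis.repr_self, Finsupp.single_apply] at this
    simp only [eq_comm (a := i)]
    exact this

/-- The sum is the trace of `ad e_k` on the subalgebra. Since `𝔡` is two-step nilpotent, this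
operator squares to zero, and a nilpotent matrix has trace zero. -/
lemma sum_pair_bracket_eq_zero {e e' : Fin 4 → DD ℂ}
    (h : ∀ k j, bracket (e k) (e j) = ∑ m, pair (e' m) (bracket (e k) (e j)) • e m) (k : Fin 4) :
    ∑ i, pair (e' i) (bracket (e k) (e i)) = 0 := by
  let N : Matrix (Fin 4) (Fin 4) ℂ := Matrix.of fun i j => pair (e' i) (bracket (e k) (e j))
  have hN : IsNilpotent N := by
    refine ⟨2, ?_⟩
    ext i j
    rw [pow_two, Matrix.mul_apply]
    change ∑ m, pair (e' i) (bracket (e k) (e m)) * pair (e' m) (bracket (e k) (e j)) = 0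
    have e1 : bracket (e k) (bracket (e k) (e j)) = 0 := by
      rw [bracket_swap, bracket_bracket, neg_zero]
    have e2 := congrArg (pairL ℂ (e' i)) e1
    rw [h k j, ← bracketL_apply, map_sum, map_sum, map_zero] at e2
    rw [← e2]
    refine Finset.sum_congr rfl fun m _ => ?_
    rw [map_smul, map_smul, smul_eq_mul, mul_comm]
    rfl
  have := Matrix.isNilpotent_trace_of_isNilpotent hN
  exact this.eq_zero

lemma IsLieComplex.dualFrame (hT : IsLieComplex T) {e e' : Fin 4 → DD ℂ}
    (he : IsDualBases (plusEigen T) (minusEigen T) e e') : DualFrame e e' := by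
  have hm : ∀ i, e i ∈ plusEigen T := fun i => by
    rw [← he.span]; exact Submodule.subset_span ⟨i, rfl⟩
  have hiso : ∀ i j, pair (e i) (e j) = 0 := fun i j => isotropic_plus hT.orthogonal (hm i) (hm j)
  have hiso' : ∀ i j, pair (e' i) (e' j) = 0 := fun i j =>
    isotropic_minus hT.orthogonal (he.mem i) (he.mem j)
  -- The second subalgebra is the complex conjugate of the first, and the bracket is real.
  have hclosed' : ∀ u ∈ minusEigen T, ∀ v ∈ minusEigen T, bracket u v ∈ minusEigen T :=
    fun u hu v hv => by
    rw [← conjC_mem, ← bracket_conjC]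
    exact hT.closed _ (conjC_mem.mpr hu) _ (conjC_mem.mpr hv)
  have hp : ∀ p ∈ plusEigen T, p = ∑ i, pair (e' i) p • e i := fun p hp => by
    rw [← he.span, Submodule.mem_span_range_iff_exists_fun] at hp
    obtain ⟨c, rfl⟩ := hp
    refine Finset.sum_congr rfl fun i _ => ?_
    rw [← pairL_apply, map_sum]
    simp [he.dual]
  have hq : ∀ m ∈ minusEigen T, m = ∑ i, pair (e i) m • e' i := fun m hm' => by
    rw [← sub_eq_zero]
    set x := m - ∑ i, pair (e i) m • e' i with hx
    have hxm : x ∈ minusEigen T := Submodule.sub_mem _ hm'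
      (Submodule.sum_mem _ fun i _ => Submodule.smul_mem _ _ (he.mem i))
    have hxe : ∀ j, pair (e j) x = 0 := fun j => by
      rw [hx, ← pairL_apply, map_sub, map_sum]
      simp [pair_comm (e j) (e' _), he.dual]
    refine eq_zero_of_pair_eq_zero fun u => ?_
    obtain ⟨p, hp', m', hm'', rfl⟩ := exists_plus_minus hT.square u
    rw [← pairL_apply, map_add, LinearMap.add_apply, pairL_apply, pairL_apply,
      isotropic_minus hT.orthogonal hm'' hxm, add_zero, hp p hp', ← pairL_apply, map_sum,
      LinearMap.sum_apply]
    simp [hxe]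
  have hexp : ∀ v, v = ∑ i, pair (e' i) v • e i + ∑ i, pair (e i) v • e' i := fun v => by
    obtain ⟨p, hp', m, hm', rfl⟩ := exists_plus_minus hT.square v
    have e1 : ∀ i, pair (e i) (p + m) = pair (e i) m := fun i => by
      rw [← pairL_apply, map_add, pairL_apply, isotropic_plus hT.orthogonal (hm i) hp', zero_add]
      rfl
    have e2 : ∀ i, pair (e' i) (p + m) = pair (e' i) p := fun i => by
      rw [← pairL_apply, map_add, pairL_apply, pairL_apply,
        isotropic_minus hT.orthogonal (he.mem i) hm', add_zero]
    simp only [e1, e2]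
    rw [← hp p hp', ← hq m hm']
  refine ⟨hiso, hiso', he.dual, hexp, fun i j k => ?_, fun i j k => ?_, ?_⟩
  · exact isotropic_plus hT.orthogonal (hT.closed _ (hm i) _ (hm j)) (hm k)
  · exact isotropic_minus hT.orthogonal (hclosed' _ (he.mem i) _ (he.mem j)) (he.mem k)
  · have t1 := sum_pair_bracket_eq_zero (e := e) (e' := e')
      fun k j => hp _ (hT.closed _ (hm k) _ (hm j))
    have t2 := sum_pair_bracket_eq_zero (e := e') (e' := e)
      fun k j => hq _ (hclosed' _ (he.mem k) _ (he.mem j))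
    -- By invariance, the components of this sum in the two bases are, up to sign, the traces `t1`
    -- and `t2`.
    rw [hexp (∑ i, bracket (e' i) (e i))]
    have u1 : ∀ k, pair (e' k) (∑ i, bracket (e' i) (e i)) = 0 := fun k => by
      rw [← pairL_apply, map_sum, ← t2 k]
      refine Finset.sum_congr rfl fun i _ => ?_
      rw [pairL_apply, ← pair_bracket, pair_comm]
    have u2 : ∀ k, pair (e k) (∑ i, bracket (e' i) (e i)) = 0 := fun k => by
      rw [← pairL_apply, map_sum, ← neg_eq_zero, ← t1 k, ← Finset.sum_neg_distrib]
      refine Finset.sum_congr rfl fun i _ => ?_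
      rw [pairL_apply, ← pair_bracket, pair_comm, pair_comm (e' i), pair_bracket_swap,
        pair_comm (e i)]
    simp [u1, u2]

end Isotropic

/-- The only input is a dual frame, and the representation on the zero modes is arbitrary; the same
statement thus serves both `X × T²` and `Y`. -/
lemma IsLieComplex.existsUnique_associated {T : Matrix Idx Idx ℝ} (hT : IsLieComplex T) {Z : Type}
    [AddCommGroup Z] [Module ℂ Z] (E : Idx → Module.End ℂ Z) :
    ∃! S : N2Structure 12 (Ind E) (parityPart E), IsAssociated T S := by
  obtain ⟨e, e', he⟩ := exists_isDualBases hT.square hT.orthogonal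
  have h := hT.dualFrame he
  refine ⟨n2OfDualFrame E h, ⟨⟨e, e', he⟩, fun f f' hf => ?_⟩, fun S hS => ?_⟩
  · have hm : ∀ i, e i ∈ plusEigen T := fun i => by
      rw [← he.span]; exact Submodule.subset_span ⟨i, rfl⟩
    have hm' : ∀ i, f i ∈ plusEigen T := fun i => by
      rw [← hf.span]; exact Submodule.subset_span ⟨i, rfl⟩
    exact h.isGeneratedBy (fun i j => isotropic_plus hT.orthogonal (hm j) (hm' i))
      (fun i j => isotropic_minus hT.orthogonal (he.mem j) (hf.mem i)) hf.dual
      (n2OfDualFrame_isGeneratedBy h)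
  · have h1 := (isGeneratedBy_iff _ _ _).mp (hS.2 e e' he)
    have h2 := (isGeneratedBy_iff _ _ _).mp (n2OfDualFrame_isGeneratedBy (E := E) h)
    exact N2Structure.eq_of_generators (fun n => (h1.1 n).trans (h2.1 n).symm)
      (fun n => (h1.2 n).trans (h2.2 n).symm)

/-! ## Pure spinors -/

lemma koszul_insert_self_erase (i : Fin 4) (I : Finset (Fin 4)) :
    koszul i (I.erase i) = koszul i I ∧ koszul i (insert i I) = koszul i I := by
  constructor
  · unfold koszul
    congr 2
    ext j
    simp only [Finset.mem_filter, Finset.mem_erase]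
    exact ⟨fun h => ⟨h.1.2, h.2⟩, fun h => ⟨⟨h.2.ne, h.1⟩, h.2⟩⟩
  · unfold koszul
    congr 2
    ext j
    simp only [Finset.mem_filter, Finset.mem_insert]
    exact ⟨fun h => ⟨h.1.resolve_left h.2.ne, h.2⟩, fun h => ⟨Or.inr h.1, h.2⟩⟩

lemma koszul_mul_self (i : Fin 4) (I : Finset (Fin 4)) : koszul i I * koszul i I = 1 := by
  unfold koszul
  rw [← pow_add, ← two_mul, pow_mul]
  simp

lemma koszul_insert {i : Fin 4} (j : Fin 4) (I : Finset (Fin 4)) (hi : i ∉ I) :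
    koszul j (insert i I) = (if i < j then -1 else 1) * koszul j I := by
  unfold koszul
  rw [Finset.filter_insert]
  split_ifs with h
  · rw [Finset.card_insert_of_notMem (by simp [hi]), pow_succ]; ring
  · rw [one_mul]

lemma koszul_erase {i : Fin 4} (j : Fin 4) (I : Finset (Fin 4)) (hi : i ∈ I) :
    koszul j (I.erase i) = (if i < j then -1 else 1) * koszul j I := by
  have h := koszul_insert j (I.erase i) (Finset.notMem_erase i I)
  rw [Finset.insert_erase hi] at h
  rw [h, ← mul_assoc]
  split_ifs <;> simp

/-- Exterior multiplication as a linear operator. -/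
def wedgeL (i : Fin 4) : Module.End ℂ Spinor where
  toFun := wedge i
  map_add' ρ σ := by
    funext I
    simp only [wedge, Pi.add_apply]
    split_ifs
    · ring
    · ring
  map_smul' c ρ := by
    funext I
    simp only [wedge, Pi.smul_apply, smul_eq_mul, RingHom.id_apply]
    split_ifs
    · ring
    · ring

/-- Contraction as a linear operator. -/
def contrL (i : Fin 4) : Module.End ℂ Spinor where
  toFun := contr i
  map_add' ρ σ := by
    funext I
    simp only [contr, Pi.add_apply]
    split_ifs
    · ring
    · ring
  map_smul' c ρ := by
    funext I
    simp only [contr, Pi.smul_apply, smul_eq_mul, RingHom.id_apply]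
    split_ifs
    · ring
    · ring

lemma wedgeL_apply (i : Fin 4) (ρ : Spinor) (I : Finset (Fin 4)) :
    wedgeL i ρ I = if i ∈ I then koszul i I * ρ (I.erase i) else 0 := rfl

lemma contrL_apply (i : Fin 4) (ρ : Spinor) (I : Finset (Fin 4)) :
    contrL i ρ I = if i ∈ I then 0 else koszul i I * ρ (insert i I) := rfl

lemma wedgeL_wedgeL (i j : Fin 4) : wedgeL i * wedgeL j + wedgeL j * wedgeL i = 0 := by
  refine LinearMap.ext fun ρ => funext fun I => ?_
  simp only [LinearMap.add_apply, Module.End.mul_apply, Pi.add_apply, wedgeL_apply,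
    LinearMap.zero_apply, Pi.zero_apply]
  rcases eq_or_ne i j with rfl | hij
  · simp
  by_cases hi : i ∈ I <;> by_cases hj : j ∈ I <;> simp [hi, hj, hij, hij.symm]
  rw [koszul_erase j I hi, koszul_erase i I hj, Finset.erase_right_comm]
  rcases lt_or_gt_of_ne hij with h | h
  · simp [h, h.not_gt]; ring
  · simp [h, h.not_gt]; ring

lemma contrL_contrL (i j : Fin 4) : contrL i * contrL j + contrL j * contrL i = 0 := by
  refine LinearMap.ext fun ρ => funext fun I => ?_
  simp only [LinearMap.add_apply, Module.End.mul_apply, Pi.add_apply, contrL_apply,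
    LinearMap.zero_apply, Pi.zero_apply]
  rcases eq_or_ne i j with rfl | hij
  · simp
  by_cases hi : i ∈ I <;> by_cases hj : j ∈ I <;> simp [hi, hj, hij, hij.symm]
  rw [koszul_insert j I hi, koszul_insert i I hj, Finset.insert_comm]
  rcases lt_or_gt_of_ne hij with h | h
  · simp [h, h.not_gt]; ring
  · simp [h, h.not_gt]; ring

lemma contrL_wedgeL (i j : Fin 4) :
    contrL i * wedgeL j + wedgeL j * contrL i = (if i = j then 1 else 0 : ℂ) • 1 := by
  refine LinearMap.ext fun ρ => funext fun I => ?_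
  simp only [LinearMap.add_apply, Module.End.mul_apply, Pi.add_apply, contrL_apply, wedgeL_apply,
    LinearMap.smul_apply, Pi.smul_apply, Module.End.one_apply, smul_eq_mul]
  rcases eq_or_ne i j with rfl | hij
  · by_cases hi : i ∈ I
    · simp only [hi, if_true, Finset.notMem_erase, if_false, Finset.insert_erase hi,
        (koszul_insert_self_erase i I).1]
      rw [← mul_assoc, koszul_mul_self]; ring
    · simp only [hi, if_true, Finset.mem_insert_self, if_false, Finset.erase_insert hi,
        (koszul_insert_self_erase i I).2]
      rw [← mul_assoc, koszul_mul_self]; ring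
  by_cases hi : i ∈ I <;> by_cases hj : j ∈ I <;> simp [hi, hj, hij, hij.symm]
  rw [koszul_insert j I hi, koszul_erase i I hj, Finset.erase_insert_of_ne hij]
  rcases lt_or_gt_of_ne hij with h | h
  · simp [h, h.not_gt]; ring
  · simp [h, h.not_gt]; ring

/-- The Clifford action as a linear map. -/
def cliffL : DD ℂ →ₗ[ℂ] Module.End ℂ Spinor :=
  ∑ i : Fin 4, ((LinearMap.proj (Sum.inr i)).smulRight (contrL i)
    + (LinearMap.proj (Sum.inl i)).smulRight (wedgeL i))

lemma cliffL_eq (v : DD ℂ) : cliffL v = ∑ i : Fin 4, (v (Sum.inr i) • contrL i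
    + v (Sum.inl i) • wedgeL i) := by
  simp [cliffL]

lemma cliffL_apply (v : DD ℂ) (ρ : Spinor) : cliffL v ρ = clifford v ρ := by
  rw [cliffL_eq, LinearMap.sum_apply]
  rfl

lemma cliffL_wedgeL (v : DD ℂ) (j : Fin 4) :
    cliffL v * wedgeL j + wedgeL j * cliffL v = v (Sum.inr j) • 1 := by
  rw [cliffL_eq, Finset.sum_mul, Finset.mul_sum, ← Finset.sum_add_distrib]
  have h : ∀ i, (v (Sum.inr i) • contrL i + v (Sum.inl i) • wedgeL i) * wedgeL j
      + wedgeL j * (v (Sum.inr i) • contrL i + v (Sum.inl i) • wedgeL i)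
      = (if i = j then v (Sum.inr i) else 0) • 1 := fun i => by
    rw [add_mul, mul_add, smul_mul_assoc, smul_mul_assoc, mul_smul_comm, mul_smul_comm,
      add_add_add_comm, ← smul_add, ← smul_add, contrL_wedgeL, wedgeL_wedgeL]
    split_ifs <;> simp
  simp only [h, ← Finset.sum_smul]
  simp

lemma cliffL_contrL (v : DD ℂ) (j : Fin 4) :
    cliffL v * contrL j + contrL j * cliffL v = v (Sum.inl j) • 1 := by
  rw [cliffL_eq, Finset.sum_mul, Finset.mul_sum, ← Finset.sum_add_distrib]
  have h : ∀ i, (v (Sum.inr i) • contrL i + v (Sum.inl i) • wedgeL i) * contrL j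
      + contrL j * (v (Sum.inr i) • contrL i + v (Sum.inl i) • wedgeL i)
      = (if j = i then v (Sum.inl i) else 0) • 1 := fun i => by
    rw [add_mul, mul_add, smul_mul_assoc, smul_mul_assoc, mul_smul_comm, mul_smul_comm,
      add_add_add_comm, ← smul_add, ← smul_add, add_comm (wedgeL i * _), contrL_wedgeL,
      contrL_contrL]
    split_ifs <;> simp
  simp only [h, ← Finset.sum_smul]
  simp

lemma cliffL_cliffL (u v : DD ℂ) : cliffL u * cliffL v + cliffL v * cliffL u = pair u v • 1 := by
  rw [cliffL_eq v, Finset.mul_sum, Finset.sum_mul, ← Finset.sum_add_distrib, pair, Finset.sum_smul]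
  refine Finset.sum_congr rfl fun i _ => ?_
  rw [mul_add, add_mul, mul_smul_comm, mul_smul_comm, smul_mul_assoc, smul_mul_assoc,
    add_add_add_comm, ← smul_add, ← smul_add, cliffL_contrL, cliffL_wedgeL, smul_smul, smul_smul,
    ← add_smul]
  congr 1
  ring

/-- Exterior multiplication with the three-form. -/
def fluxL : Module.End ℂ Spinor := wedgeL 1 * (wedgeL 2 * wedgeL 3)

/-- The contraction of the three-form with a vector. -/
def fluxContr (u : DD ℂ) : Module.End ℂ Spinor :=
  u (Sum.inr 1) • (wedgeL 2 * wedgeL 3) - u (Sum.inr 2) • (wedgeL 1 * wedgeL 3)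
    + u (Sum.inr 3) • (wedgeL 1 * wedgeL 2)

lemma cliffL_mul_wedgeL (v : DD ℂ) (j : Fin 4) :
    cliffL v * wedgeL j = -(wedgeL j * cliffL v) + v (Sum.inr j) • 1 := by
  rw [← cliffL_wedgeL]; abel

/-- Covectors anticommute with the three-form, so only the contraction with the vector part is left.
-/
lemma cliffL_fluxL (u : DD ℂ) : cliffL u * fluxL + fluxL * cliffL u = fluxContr u := by
  have h23 := leibniz_odd_odd (cliffL_mul_wedgeL u 2) (cliffL_mul_wedgeL u 3)
  rw [sub_eq_iff_eq_add, add_comm, smul_mul_assoc, mul_smul_comm, one_mul, mul_one] at h23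
  have h := leibniz_odd_even (cliffL_mul_wedgeL u 1) h23
  rw [fluxL, h, fluxContr, smul_mul_assoc, one_mul, mul_sub, mul_smul_comm, mul_smul_comm]
  abel

/-- A second contraction of `det` is the covector `det (u, v, ·)`, which is the bracket. This ties
closedness of spinors to closedness of the subalgebra. -/
lemma fluxContr_cliffL (u v : DD ℂ) :
    cliffL v * fluxContr u = fluxContr u * cliffL v + cliffL (bracket u v) := by
  have h : ∀ i j, cliffL v * (wedgeL i * wedgeL j) - wedgeL i * wedgeL j * cliffL v
      = v (Sum.inr i) • wedgeL j - v (Sum.inr j) • wedgeL i := fun i j => by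
    rw [leibniz_odd_odd (cliffL_mul_wedgeL v i) (cliffL_mul_wedgeL v j), smul_mul_assoc,
      mul_smul_comm, one_mul, mul_one]
  have h2 : cliffL (bracket u v) = (u (Sum.inr 2) * v (Sum.inr 3) - u (Sum.inr 3) * v (Sum.inr 2))
      • wedgeL 1 + (u (Sum.inr 3) * v (Sum.inr 1) - u (Sum.inr 1) * v (Sum.inr 3)) • wedgeL 2
      + (u (Sum.inr 1) * v (Sum.inr 2) - u (Sum.inr 2) * v (Sum.inr 1)) • wedgeL 3 := by
    rw [cliffL_eq, Fin.sum_univ_four]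
    simp [bracket]
  rw [h2, ← sub_eq_iff_eq_add', fluxContr]
  have h3 : ∀ (a b c : ℂ) (x y z w : Module.End ℂ Spinor), w * (a • x - b • y + c • z)
      - (a • x - b • y + c • z) * w = a • (w * x - x * w) - b • (w * y - y * w)
        + c • (w * z - z * w) := fun a b c x y z w => by
    rw [mul_add, mul_sub, add_mul, sub_mul]
    simp only [mul_smul_comm, smul_mul_assoc]
    module
  rw [h3, h, h, h]
  module

lemma wedgeL_sq (i : Fin 4) : wedgeL i * wedgeL i = 0 := by
  have := wedgeL_wedgeL i i
  rw [← two_smul ℂ] at this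
  exact (smul_eq_zero.mp this).resolve_left two_ne_zero

lemma wedgeL_swap (i j : Fin 4) : wedgeL i * wedgeL j = -(wedgeL j * wedgeL i) :=
  eq_neg_of_add_eq_zero_left (wedgeL_wedgeL i j)

lemma mul_mul_eq_zero_of_sq {R : Type*} [Ring R] {a b d : R} (hb : b * b = 0) :
    a * b * (b * d) = 0 := by
  rw [mul_assoc, ← mul_assoc b b, hb, zero_mul, mul_zero]

lemma mul_mul_eq_zero_of_swap {R : Type*} [Ring R] {a b d : R} (hab : a * b = -(b * a))
    (ha : a * a = 0) : a * b * (a * d) = 0 := by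
  rw [hab, neg_mul, mul_mul_eq_zero_of_sq ha, neg_zero]

lemma mul_mul_eq_zero_of_swap_right {R : Type*} [Ring R] {a b c d : R} (hcd : c * d = -(d * c))
    (h : a * b * (d * c) = 0) : a * b * (c * d) = 0 := by
  rw [hcd, mul_neg, h, neg_zero]

/-- A product of four of the three one-forms on `Λ` vanishes. -/
lemma wedgeL_four {i j k l : Fin 4} (hi : i ≠ 0) (hj : j ≠ 0) (hk : k ≠ 0) (hl : l ≠ 0) :
    wedgeL i * wedgeL j * (wedgeL k * wedgeL l) = 0 := by
  have key : i = j ∨ i = k ∨ i = l ∨ j = k ∨ j = l ∨ k = l := by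
    revert i j k l; decide
  rcases key with rfl | rfl | rfl | rfl | rfl | rfl
  · rw [wedgeL_sq, zero_mul]
  · exact mul_mul_eq_zero_of_swap (wedgeL_swap i j) (wedgeL_sq i)
  · exact mul_mul_eq_zero_of_swap_right (wedgeL_swap k i)
      (mul_mul_eq_zero_of_swap (wedgeL_swap i j) (wedgeL_sq i))
  · exact mul_mul_eq_zero_of_sq (wedgeL_sq j)
  · exact mul_mul_eq_zero_of_swap_right (wedgeL_swap k j) (mul_mul_eq_zero_of_sq (wedgeL_sq j))
  · rw [wedgeL_sq, mul_zero]

lemma fluxContr_fluxContr (u v : DD ℂ) : fluxContr u * fluxContr v = 0 := by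
  simp only [fluxContr, add_mul, mul_add, sub_mul, mul_sub, smul_mul_assoc, mul_smul_comm]
  simp [wedgeL_four]

lemma fluxL_fluxL : fluxL * fluxL = 0 := by
  simp only [fluxL]
  rw [mul_assoc, ← mul_assoc (wedgeL 2 * wedgeL 3) (wedgeL 1),
    ← mul_assoc (wedgeL 2 * wedgeL 3 * wedgeL 1), mul_assoc (wedgeL 2 * wedgeL 3),
    wedgeL_four (by decide) (by decide) (by decide) (by decide)]
  simp

/-- A closed pure spinor annihilated by the span of pairwise orthogonal isotropic vectors which is
a subalgebra. -/
lemma exists_closed_spinor {e : Fin 4 → DD ℂ} (he : ∀ i j, pair (e i) (e j) = 0)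
    {𝔩 : Submodule ℂ (DD ℂ)} (hspan : Submodule.span ℂ (Set.range e) = 𝔩)
    (hclosed : ∀ u ∈ 𝔩, ∀ v ∈ 𝔩, bracket u v ∈ 𝔩) :
    ∃ ψ : Spinor, ψ ≠ 0 ∧ (∀ u ∈ 𝔩, cliffL u ψ = 0) ∧ fluxL ψ = 0 := by
  -- The operators of the `e_i` anticommute and square to zero, so replacing `ψ` by `e_i · ψ` when
  -- it is nonzero enforces one more condition and keeps the earlier ones.
  have h1 : ∀ s : Finset (Fin 4), ∃ ψ : Spinor, ψ ≠ 0 ∧ ∀ i ∈ s, cliffL (e i) ψ = 0 := by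
    intro s
    induction s using Finset.induction_on with
    | empty => exact ⟨1, one_ne_zero, by simp⟩
    | insert i s _ ih =>
      obtain ⟨ψ, hψ, hs⟩ := ih
      by_cases hi : cliffL (e i) ψ = 0
      · refine ⟨ψ, hψ, fun j hj => ?_⟩
        rcases Finset.mem_insert.mp hj with rfl | hj
        · exact hi
        · exact hs j hj
      · refine ⟨cliffL (e i) ψ, hi, fun j hj => ?_⟩
        have h := LinearMap.congr_fun (cliffL_cliffL (e j) (e i)) ψ
        rw [he, zero_smul, LinearMap.add_apply, Module.End.mul_apply, Module.End.mul_apply] at h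
        rcases Finset.mem_insert.mp hj with rfl | hj
        · rw [← two_smul ℂ] at h
          exact (smul_eq_zero.mp h).resolve_left two_ne_zero
        · rw [hs j hj, map_zero, add_zero] at h
          exact h
  have h2 : ∃ ψ : Spinor, ψ ≠ 0 ∧ ∀ u ∈ 𝔩, cliffL u ψ = 0 := by
    obtain ⟨ψ, hψ, h⟩ := h1 Finset.univ
    refine ⟨ψ, hψ, fun u hu => ?_⟩
    have : 𝔩 ≤ LinearMap.ker ((LinearMap.applyₗ ψ) ∘ₗ cliffL) := by
      rw [← hspan, Submodule.span_le]
      rintro _ ⟨i, rfl⟩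
      exact h i (Finset.mem_univ i)
    exact this hu
  have h3 : ∀ ψ : Spinor, (∀ u ∈ 𝔩, cliffL u ψ = 0) → ∀ w ∈ 𝔩, ∀ u ∈ 𝔩,
      cliffL u (fluxContr w ψ) = 0 := fun ψ h w hw u hu => by
    have := LinearMap.congr_fun (fluxContr_cliffL w u) ψ
    rw [LinearMap.add_apply, Module.End.mul_apply, Module.End.mul_apply, h u hu,
      h _ (hclosed w hw u hu), map_zero, add_zero] at this
    exact this
  have h4 : ∃ ψ : Spinor, ψ ≠ 0 ∧ (∀ u ∈ 𝔩, cliffL u ψ = 0) ∧ ∀ u ∈ 𝔩, fluxContr u ψ = 0 := by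
    obtain ⟨ψ, hψ, h⟩ := h2
    -- Contractions of `det` preserve the spinors annihilated by `𝔩` (`h3`), and any two of them
    -- multiply to zero. A nonzero image may therefore replace `ψ`. The same device is then applied
    -- to `det` itself.
    by_cases hw : ∃ w ∈ 𝔩, fluxContr w ψ ≠ 0
    · obtain ⟨w, hw, hne⟩ := hw
      exact ⟨fluxContr w ψ, hne, h3 ψ h w hw, fun u _ =>
        LinearMap.congr_fun (fluxContr_fluxContr u w) ψ⟩
    · push Not at hw
      exact ⟨ψ, hψ, h, hw⟩
  obtain ⟨ψ, hψ, h, hf⟩ := h4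
  by_cases hne : fluxL ψ = 0
  · exact ⟨ψ, hψ, h, hne⟩
  · refine ⟨fluxL ψ, hne, fun u hu => ?_, LinearMap.congr_fun fluxL_fluxL ψ⟩
    have := LinearMap.congr_fun (cliffL_fluxL u) ψ
    rw [LinearMap.add_apply, Module.End.mul_apply, Module.End.mul_apply, h u hu, hf u hu, map_zero,
      add_zero] at this
    exact this

/-! ## Generalized Calabi-Yau structures on the gerby torus -/

lemma IsLieComplex.exists_spinor {T : Matrix Idx Idx ℝ} (hT : IsLieComplex T) :
    ∃ ψ : Spinor, (∀ v, clifford v ψ = 0 ↔ v ∈ plusEigen T) ∧ fluxL ψ = 0 := by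
  obtain ⟨e, e', he⟩ := exists_isDualBases hT.square hT.orthogonal
  have h := hT.dualFrame he
  obtain ⟨ψ, hψ, hl, hf⟩ := exists_closed_spinor h.iso he.span hT.closed
  have hm : ∀ i, e i ∈ plusEigen T := fun i => by
    rw [← he.span]; exact Submodule.subset_span ⟨i, rfl⟩
  refine ⟨ψ, fun v => ⟨fun hv => ?_, fun hv => ?_⟩, hf⟩
  · rw [← cliffL_apply] at hv
    -- By the Clifford relation, `e_i` and `v` both killing `ψ ≠ 0` are orthogonal. The expansion in
    -- the dual frame then puts `v` in the eigenspace.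
    have hz : ∀ i, pair (e i) v = 0 := fun i => by
      have := LinearMap.congr_fun (cliffL_cliffL (e i) v) ψ
      rw [LinearMap.add_apply, Module.End.mul_apply, Module.End.mul_apply, hv, hl _ (hm i),
        map_zero, map_zero, add_zero, LinearMap.smul_apply, Module.End.one_apply] at this
      exact (smul_eq_zero.mp this.symm).resolve_right hψ
    rw [h.expand v]
    simp only [hz, zero_smul, Finset.sum_const_zero, add_zero]
    exact Submodule.sum_mem _ fun i _ => Submodule.smul_mem _ _ (hm i)
  · rw [← cliffL_apply]; exact hl v hv

lemma dorfman_const (u v : DD ℂ) (x : Fin 4 → ℝ) :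
    dorfman (fun _ => u) (fun _ => v) x = bracket u v := by
  funext a
  rcases a with i | i <;> simp [dorfman, bracket, pd]

lemma IsEquivariantGCY.eq_const {J : (Fin 4 → ℝ) → Matrix Idx Idx ℝ} (hJ : IsEquivariantGCY J)
    (x : Fin 4 → ℝ) : J x = J 0 := by
  have := hJ.equivariant x 0
  rwa [zero_add] at this

lemma IsEquivariantGCY.isLieComplex {J : (Fin 4 → ℝ) → Matrix Idx Idx ℝ}
    (hJ : IsEquivariantGCY J) : IsLieComplex (J 0) where
  square := hJ.genComplex.square 0
  orthogonal := hJ.genComplex.orthogonal 0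
  closed u hu v hv := by
    have := hJ.genComplex.involutive (fun _ => u) (fun _ => v) contDiff_const contDiff_const
      (fun _ _ => rfl) (fun _ _ => rfl) (fun x => by rw [hJ.eq_const]; exact hu)
      (fun x => by rw [hJ.eq_const]; exact hv) 0
    rwa [dorfman_const] at this

/-- The derivative of a field along a coordinate, in components. -/
def pdField (j : Fin 4) (s : (Fin 4 → ℝ) → DD ℂ) (x : Fin 4 → ℝ) : DD ℂ :=
  fun a => pd j (fun y => s y a) x

lemma pdField_eq {s : (Fin 4 → ℝ) → DD ℂ} (hs : ContDiff ℝ ∞ s) (j : Fin 4) (x : Fin 4 → ℝ) :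
    pdField j s x = fderiv ℝ s x (Pi.single j 1) := by
  funext a
  have h := (hasFDerivAt_pi'.mp (hs.differentiable (by simp) x).hasFDerivAt a).fderiv
  rw [pdField, pd, h]
  rfl

/-- The eigenspace is the kernel of a constant linear map, which commutes with differentiation. -/
lemma pdField_mem {T : Matrix Idx Idx ℝ} {s : (Fin 4 → ℝ) → DD ℂ} (hs : ContDiff ℝ ∞ s)
    (hsT : ∀ x, s x ∈ plusEigen T) (j : Fin 4) (x : Fin 4 → ℝ) :
    pdField j s x ∈ plusEigen T := by
  let A : DD ℂ →L[ℝ] DD ℂ := (LinearMap.toContinuousLinearMap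
    (Matrix.toLin' (T.map Complex.ofReal) - Complex.I • LinearMap.id)).restrictScalars ℝ
  have hA : ∀ u, A u = (T.map Complex.ofReal).mulVec u - Complex.I • u := fun u => rfl
  have h0 : (fun y => A (s y)) = fun _ => 0 := funext fun y => by
    rw [hA, mem_plusEigen.mp (hsT y), sub_self]
  have h1 : HasFDerivAt (fun y => A (s y)) (A.comp (fderiv ℝ s x)) x :=
    A.hasFDerivAt.comp x (hs.differentiable (by simp) x).hasFDerivAt
  rw [h0] at h1
  have h2 := congrArg (fun L => L (Pi.single j 1)) (h1.unique (hasFDerivAt_const _ _))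
  have h3 : A (fderiv ℝ s x (Pi.single j 1)) = 0 := h2
  rw [pdField_eq hs, mem_plusEigen, ← sub_eq_zero, ← hA, h3]

/-- The separation isolates the non-derivation part of the Dorfman bracket, a pairing of a
derivative of `s` with `t`. It vanishes on sections of a constant isotropic subbundle. -/
lemma dorfman_eq (s t : (Fin 4 → ℝ) → DD ℂ) (x : Fin 4 → ℝ) :
    dorfman s t x = bracket (s x) (t x)
      + ∑ j, (s x (Sum.inr j) • pdField j t x - t x (Sum.inr j) • pdField j s x)
      + Sum.elim (fun i => pair (pdField i s x) (t x)) 0 := by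
  funext a
  rcases a with i | i
  · simp only [dorfman, bracket, pair, pdField, Sum.elim_inl, Pi.add_apply, Finset.sum_apply,
      Pi.sub_apply, Pi.smul_apply, smul_eq_mul]
    rw [add_comm, add_assoc, ← Finset.sum_add_distrib]
    congr 1
    refine Finset.sum_congr rfl fun j _ => ?_
    ring
  · simp only [dorfman, bracket, pdField, Sum.elim_inr, Pi.add_apply, Finset.sum_apply,
      Pi.sub_apply, Pi.smul_apply, smul_eq_mul, Pi.zero_apply, zero_add, add_zero]

/-- No condition beyond `IsLieComplex` is needed: the closed spinor always exists and can be taken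
constant. -/
lemma IsLieComplex.isEquivariantGCY {T : Matrix Idx Idx ℝ} (hT : IsLieComplex T) :
    IsEquivariantGCY (fun _ => T) where
  genComplex :=
    { smooth := fun _ _ => contDiff_const
      periodic := fun _ _ => rfl
      square := fun _ => hT.square
      orthogonal := fun _ => hT.orthogonal
      involutive := fun s t hs ht _ _ hsT htT x => by
        have h0 : (fun i => pair (pdField i s x) (t x)) = 0 := funext fun i =>
          isotropic_plus hT.orthogonal (pdField_mem hs hsT i x) (htT x)
        rw [dorfman_eq, h0, Sum.elim_zero_zero, add_zero]
        exact Submodule.add_mem _ (hT.closed _ (hsT x) _ (htT x))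
          (Submodule.sum_mem _ fun j _ => Submodule.sub_mem _
            (Submodule.smul_mem _ _ (pdField_mem ht htT j x))
            (Submodule.smul_mem _ _ (pdField_mem hs hsT j x))) }
  equivariant _ _ := rfl
  calabiYau := by
    obtain ⟨ψ, h1, h2⟩ := hT.exists_spinor
    refine ⟨fun _ => ψ, fun _ => contDiff_const, fun _ _ => rfl, fun _ => h1, fun x => ?_⟩
    have h3 : wedge 1 (wedge 2 (wedge 3 ψ)) = 0 := h2
    unfold twistedD
    rw [h3, sub_zero]
    refine Finset.sum_eq_zero fun i _ => ?_
    funext I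
    simp [wedge, pd]

/-! ## Left-invariant complex structures on the nilmanifold -/

lemma frame_mulVec (p u : Pt) : (frame p).mulVec u = leftInv p u := by
  have h : frame p = LinearMap.toMatrix' (leftInvL p).toLinearMap := by
    ext b a
    rw [LinearMap.toMatrix'_apply]
    simp only [frame, Matrix.of_apply]
    rfl
  rw [h, ← Matrix.toLin'_apply, Matrix.toLin'_toMatrix']
  rfl

lemma frame_gmul (p q : Pt) : frame (gmul p q) = frame p * frame q := by
  refine Matrix.ext_of_mulVec_single fun a => ?_
  rw [← Matrix.mulVec_mulVec, frame_mulVec, frame_mulVec, frame_mulVec, leftInv_gmul]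

lemma leftInv_eq (p u : Pt) : leftInv p u = u + (1 / 2 : ℝ) • bracket p u := by
  funext a
  rcases a with i | i <;> simp [bracket]

lemma leftInv_zero_left (u : Pt) : leftInv 0 u = u := by
  rw [leftInv_eq, ← bracketL_apply, map_zero]; simp

lemma frame_zero : frame 0 = 1 := by
  refine Matrix.ext_of_mulVec_single fun a => ?_
  rw [frame_mulVec, leftInv_zero_left, Matrix.one_mulVec]

lemma gmul_neg (p : Pt) : gmul p (-p) = 0 := by
  have h := neg_gmul (-p)
  rwa [neg_neg] at h

lemma frame_mul_neg (p : Pt) : frame p * frame (-p) = 1 := by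
  rw [← frame_gmul, gmul_neg, frame_zero]

lemma neg_mul_frame (p : Pt) : frame (-p) * frame p = 1 := by
  rw [← frame_gmul, neg_gmul, frame_zero]

lemma frame_inv (p : Pt) : (frame p)⁻¹ = frame (-p) :=
  Matrix.inv_eq_right_inv (frame_mul_neg p)

lemma leftInv_leftInv_neg (p u : Pt) : leftInv p (leftInv (-p) u) = u := by
  rw [← leftInv_gmul, gmul_neg, leftInv_zero_left]

/-- The left-invariant field of endomorphisms with a given value at the identity. -/
def leftField (T : Matrix Idx Idx ℝ) (p : Pt) : Matrix Idx Idx ℝ := frame p * T * frame (-p)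

lemma inFrame_leftField (T : Matrix Idx Idx ℝ) (p : Pt) : inFrame (leftField T) p = T := by
  rw [inFrame, frame_inv, leftField, ← mul_assoc, ← mul_assoc, neg_mul_frame, one_mul, mul_assoc,
    neg_mul_frame, mul_one]

lemma leftField_inFrame {J : Pt → Matrix Idx Idx ℝ} (h : ∀ p, inFrame J p = inFrame J 0) :
    leftField (inFrame J 0) = J := by
  funext p
  rw [leftField, ← h p, inFrame, frame_inv, ← mul_assoc, ← mul_assoc, frame_mul_neg, one_mul,
    mul_assoc, frame_mul_neg, mul_one]

/-- The vector field with given components in the left-invariant frame. -/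
def ofFrame (v : Pt → Pt) (p : Pt) : Pt := leftInv p (v p)

lemma leftField_mulVec (T : Matrix Idx Idx ℝ) (p u : Pt) :
    (leftField T p).mulVec (leftInv p u) = leftInv p (T.mulVec u) := by
  rw [← frame_mulVec, ← frame_mulVec, Matrix.mulVec_mulVec, Matrix.mulVec_mulVec, leftField,
    mul_assoc, neg_mul_frame, mul_one]

/-- The Lie bracket as a continuous bilinear map. -/
def bracketCLM : Pt →L[ℝ] Pt →L[ℝ] Pt := LinearMap.toContinuousBilinearMap (bracketL ℝ)

lemma bracketCLM_apply (u v : Pt) : bracketCLM u v = bracket u v := rfl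

lemma ofFrame_eq (v : Pt → Pt) : ofFrame v = fun p => v p + (1 / 2 : ℝ) • bracketCLM p (v p) :=
  funext fun p => leftInv_eq p (v p)

lemma fderiv_ofFrame {v : Pt → Pt} {p : Pt} (hv : DifferentiableAt ℝ v p) (h : Pt) :
    fderiv ℝ (ofFrame v) p h = leftInv p (fderiv ℝ v p h) + (1 / 2 : ℝ) • bracket h (v p) := by
  have h1 := bracketCLM.hasFDerivAt_of_bilinear (hasFDerivAt_id (𝕜 := ℝ) p) hv.hasFDerivAt
  have h2 := hv.hasFDerivAt.add (h1.const_smul (1 / 2 : ℝ))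
  have h3 : ofFrame v = v + (1 / 2 : ℝ) • fun q => bracketCLM (id q) (v q) := ofFrame_eq v
  rw [h3, h2.fderiv, leftInv_eq]
  simp only [add_apply, smul_apply, ContinuousLinearMap.precompR_apply,
    ContinuousLinearMap.precompL_apply, bracketCLM_apply, smul_add, add_assoc]
  rfl

lemma contDiff_ofFrame {v : Pt → Pt} (hv : ContDiff ℝ ∞ v) : ContDiff ℝ ∞ (ofFrame v) := by
  rw [ofFrame_eq]
  exact hv.add ((bracketCLM.contDiff.clm_apply hv).const_smul (1 / 2 : ℝ))

lemma exists_eq_ofFrame {V : Pt → Pt} (hV : ContDiff ℝ ∞ V) :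
    ∃ v, ContDiff ℝ ∞ v ∧ V = ofFrame v := by
  refine ⟨fun p => leftInv (-p) (V p), ?_, funext fun p => (leftInv_leftInv_neg p _).symm⟩
  have h : (fun p => leftInv (-p) (V p)) = fun p => V p + (1 / 2 : ℝ) • bracketCLM (-p) (V p) :=
    funext fun p => leftInv_eq (-p) (V p)
  rw [h]
  exact hV.add (((bracketCLM.contDiff.comp contDiff_neg).clm_apply hV).const_smul (1 / 2 : ℝ))

lemma bracket_leftInv (p u v : Pt) : bracket (leftInv p u) v = bracket u v := by
  rw [leftInv_eq, bracket_add_left, bracket_smul_left, bracket_bracket, smul_zero, add_zero]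

lemma leftInv_bracket (p u v : Pt) : leftInv p (bracket u v) = bracket u v := by
  rw [leftInv_eq, bracket_swap p, bracket_bracket, neg_zero, smul_zero, add_zero]

/-- The two shear terms from `fderiv_ofFrame` are each half the Lie bracket and add up to a whole
one. Two-step nilpotency removes the dependence on `p` in them. -/
lemma lieBracket_ofFrame {v w : Pt → Pt} {p : Pt} (hv : DifferentiableAt ℝ v p)
    (hw : DifferentiableAt ℝ w p) :
    VectorField.lieBracket ℝ (ofFrame v) (ofFrame w) p = leftInv p
      (fderiv ℝ w p (ofFrame v p) - fderiv ℝ v p (ofFrame w p) + bracket (v p) (w p)) := by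
  rw [VectorField.lieBracket, fderiv_ofFrame hv, fderiv_ofFrame hw, ofFrame, ofFrame,
    bracket_leftInv, bracket_leftInv, bracket_swap (w p) (v p)]
  simp only [← leftInvL_apply, map_add, map_sub]
  rw [leftInvL_apply p (bracket _ _), leftInv_bracket]
  module

/-- The Nijenhuis tensor of a constant endomorphism of the Lie algebra. -/
def nijenhuis (T : Matrix Idx Idx ℝ) (v w : DD ℝ) : DD ℝ :=
  bracket (T.mulVec v) (T.mulVec w) - T.mulVec (bracket (T.mulVec v) w)
    - T.mulVec (bracket v (T.mulVec w)) - bracket v w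

lemma fderiv_mulVec (T : Matrix Idx Idx ℝ) {v : Pt → Pt} {p : Pt} (hv : DifferentiableAt ℝ v p)
    (h : Pt) : DifferentiableAt ℝ (fun q => T.mulVec (v q)) p ∧
      fderiv ℝ (fun q => T.mulVec (v q)) p h = T.mulVec (fderiv ℝ v p h) := by
  have := ((LinearMap.toContinuousLinearMap (Matrix.toLin' T)).hasFDerivAt.comp p hv.hasFDerivAt)
  have h2 : HasFDerivAt (fun q => T.mulVec (v q)) _ p := this
  exact ⟨h2.differentiableAt, by rw [h2.fderiv]; rfl⟩

/-- All four brackets are computed by `lieBracket_ofFrame`. Since `T` is constant and `T² = -1`, the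
derivatives of `v` and `w` cancel. -/
lemma nijenhuis_leftField {T : Matrix Idx Idx ℝ} (hT : T * T = -1) {v w : Pt → Pt} {p : Pt}
    (hv : DifferentiableAt ℝ v p) (hw : DifferentiableAt ℝ w p) :
    VectorField.lieBracket ℝ (fun q => (leftField T q).mulVec (ofFrame v q))
        (fun q => (leftField T q).mulVec (ofFrame w q)) p
      - (leftField T p).mulVec (VectorField.lieBracket ℝ
          (fun q => (leftField T q).mulVec (ofFrame v q)) (ofFrame w) p)
      - (leftField T p).mulVec (VectorField.lieBracket ℝ (ofFrame v)
          (fun q => (leftField T q).mulVec (ofFrame w q)) p)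
      - VectorField.lieBracket ℝ (ofFrame v) (ofFrame w) p
      = leftInv p (nijenhuis T (v p) (w p)) := by
  have h1 : ∀ v : Pt → Pt, (fun q => (leftField T q).mulVec (ofFrame v q))
      = ofFrame fun q => T.mulVec (v q) := fun v => funext fun q => leftField_mulVec T q (v q)
  have h2 : ∀ u, T.mulVec (T.mulVec u) = -u := fun u => by
    rw [Matrix.mulVec_mulVec, hT, Matrix.neg_mulVec, Matrix.one_mulVec]
  have hTv := fun h => fderiv_mulVec T hv h
  have hTw := fun h => fderiv_mulVec T hw h
  rw [h1, h1, lieBracket_ofFrame (hTv 0).1 (hTw 0).1, lieBracket_ofFrame (hTv 0).1 hw,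
    lieBracket_ofFrame hv (hTw 0).1, lieBracket_ofFrame hv hw, leftField_mulVec, leftField_mulVec]
  simp only [← leftInvL_apply, ← map_sub]
  congr 1
  simp only [(hTv _).2, (hTw _).2, Matrix.mulVec_add, Matrix.mulVec_sub, h2, nijenhuis]
  abel

lemma toC_re_im_inj {x y x' y' : DD ℝ}
    (h : toC x + Complex.I • toC y = toC x' + Complex.I • toC y') : x = x' ∧ y = y' := by
  have h' : ∀ a, x a = x' a ∧ y a = y' a := fun a => by
    simpa [toC, Complex.ext_iff] using congrFun h a
  exact ⟨funext fun a => (h' a).1, funext fun a => (h' a).2⟩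

lemma mem_plusEigen_re_im {T : Matrix Idx Idx ℝ} {x y : DD ℝ} :
    toC x + Complex.I • toC y ∈ plusEigen T ↔ T.mulVec x = -y ∧ T.mulVec y = x := by
  have h : Complex.I • (toC x + Complex.I • toC y) = toC (-y) + Complex.I • toC x := by
    rw [smul_add, smul_smul, Complex.I_mul_I, toC_neg]; module
  rw [mem_plusEigen, Matrix.mulVec_add, Matrix.mulVec_smul, mulVec_toC, mulVec_toC, h]
  refine ⟨toC_re_im_inj, fun h => ?_⟩
  rw [h.1, h.2]

lemma bracket_re_im (x y x' y' : DD ℝ) :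
    bracket (toC x + Complex.I • toC y) (toC x' + Complex.I • toC y')
      = toC (bracket x x' - bracket y y') + Complex.I • toC (bracket x y' + bracket y x') := by
  simp only [← bracketL_apply, map_add, map_smul, LinearMap.add_apply, LinearMap.smul_apply]
  simp only [bracketL_apply, bracket_toC, sub_eq_add_neg, toC_add, toC_neg, smul_add, smul_smul,
    Complex.I_mul_I]
  module

/-- The `√-1`-eigenvectors are `x - √-1 T x` with `x` real, and the eigenvector equation for the
bracket of two of them is the vanishing of the Nijenhuis tensor. -/
lemma closed_iff_nijenhuis {T : Matrix Idx Idx ℝ} (hT : T * T = -1) :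
    (∀ u ∈ plusEigen T, ∀ v ∈ plusEigen T, bracket u v ∈ plusEigen T) ↔
      ∀ v w, nijenhuis T v w = 0 := by
  have h2 : ∀ u, T.mulVec (T.mulVec u) = -u := fun u => by
    rw [Matrix.mulVec_mulVec, hT, Matrix.neg_mulVec, Matrix.one_mulVec]
  have hm : ∀ v, T.mulVec (-v) = -T.mulVec v := fun v => Matrix.mulVec_neg v T
  have hn : ∀ x : DD ℝ, toC x + Complex.I • toC (-T.mulVec x) ∈ plusEigen T := fun x => by
    rw [mem_plusEigen_re_im, neg_neg, hm, h2, neg_neg]; exact ⟨rfl, rfl⟩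
  have hb : ∀ x y : DD ℝ, bracket (-x) y = -bracket x y ∧ bracket y (-x) = -bracket y x :=
    fun x y => by
    simp only [← bracketL_apply, map_neg, LinearMap.neg_apply, and_self]
  constructor
  · intro h v w
    have := h _ (hn v) _ (hn w)
    rw [bracket_re_im, mem_plusEigen_re_im] at this
    have := this.2
    simp only [hb, neg_neg, Matrix.mulVec_add, hm] at this
    rw [nijenhuis, sub_sub, sub_sub, sub_eq_zero]
    rw [eq_sub_iff_add_eq] at this
    rw [← this]
    abel
  · intro h u hu v hv
    obtain ⟨x, y, rfl⟩ := exists_re_im u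
    obtain ⟨x', y', rfl⟩ := exists_re_im v
    rw [mem_plusEigen_re_im] at hu hv
    have h3 := h x x'
    rw [nijenhuis, hu.1, hv.1] at h3
    simp only [hb, neg_neg, hm] at h3
    have h4 : T.mulVec (bracket x y' + bracket y x') = bracket x x' - bracket y y' := by
      rw [Matrix.mulVec_add, ← sub_eq_zero, ← h3]
      abel
    rw [bracket_re_im, mem_plusEigen_re_im]
    refine ⟨?_, h4⟩
    rw [← h4, h2]

lemma IsLieComplex.isEquivariantOrthogonalComplex {T : Matrix Idx Idx ℝ} (hT : IsLieComplex T) :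
    IsEquivariantOrthogonalComplex (leftField T) where
  complex :=
    { smooth := fun a b => by
        have h : ∀ a b, ContDiff ℝ ∞ fun p => frame p a b := fun a b =>
          contDiff_pi.mp (contDiff_leftInv (Pi.single b 1)) a
        simp only [leftField, Matrix.mul_apply]
        exact ContDiff.sum fun c _ => (ContDiff.sum fun d _ => (h a d).mul contDiff_const).mul
          ((h c b).comp contDiff_neg)
      invariant := fun γ _ p => by
        have h : frame (-gmul γ.coord p) = frame (-p) * frame (-γ.coord) := by
          rw [← frame_inv, ← frame_inv, ← frame_inv, frame_gmul, Matrix.mul_inv_rev]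
        rw [leftField, leftField, h, frame_gmul, mul_assoc, mul_assoc (frame (-p)), neg_mul_frame]
        simp only [mul_assoc, mul_one]
      square := fun p => by
        rw [leftField, mul_assoc, ← mul_assoc (frame (-p)), ← mul_assoc (frame (-p)),
          neg_mul_frame, one_mul, mul_assoc, ← mul_assoc T, hT.square]
        simp [frame_mul_neg]
      integrable := fun V W hV hW p => by
        obtain ⟨v, hv, rfl⟩ := exists_eq_ofFrame hV
        obtain ⟨w, hw, rfl⟩ := exists_eq_ofFrame hW
        rw [nijenhuis_leftField hT.square (hv.differentiable (by simp) p)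
          (hw.differentiable (by simp) p), (closed_iff_nijenhuis hT.square).mp hT.closed]
        exact map_zero (leftInvL p) }
  equivariant p g := by rw [inFrame_leftField, inFrame_leftField]
  orthogonal p u v := by
    have h : ∀ u, (frame p)⁻¹.mulVec ((leftField T p).mulVec u)
        = T.mulVec ((frame p)⁻¹.mulVec u) := fun u => by
      rw [frame_inv, Matrix.mulVec_mulVec, Matrix.mulVec_mulVec, leftField, ← mul_assoc,
        ← mul_assoc, neg_mul_frame, one_mul]
    rw [metric, h, h, hT.orthogonal, metric]

lemma IsEquivariantOrthogonalComplex.inFrame_eq {J : Pt → Matrix Idx Idx ℝ}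
    (hJ : IsEquivariantOrthogonalComplex J) (p : Pt) : inFrame J p = inFrame J 0 := by
  have h := hJ.equivariant 0 p
  rwa [zero_gmul] at h

lemma IsEquivariantOrthogonalComplex.isLieComplex {J : Pt → Matrix Idx Idx ℝ}
    (hJ : IsEquivariantOrthogonalComplex J) : IsLieComplex (inFrame J 0) := by
  have h0 : inFrame J 0 = J 0 := by
    rw [inFrame, frame_inv, neg_zero, frame_zero, one_mul, mul_one]
  have hl := leftField_inFrame hJ.inFrame_eq
  have hsq : inFrame J 0 * inFrame J 0 = -1 := by rw [h0, hJ.complex.square]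
  refine ⟨hsq, fun u v => ?_, (closed_iff_nijenhuis hsq).mpr fun v w => ?_⟩
  · have := hJ.orthogonal 0 u v
    simpa [metric, frame_inv, frame_zero, h0] using this
  · have h1 := nijenhuis_leftField (v := fun _ => v) (w := fun _ => w) (p := 0) hsq
      (differentiableAt_const _) (differentiableAt_const _)
    rw [leftInv_zero_left, hl] at h1
    rw [← h1]
    exact hJ.complex.integrable _ _ (contDiff_ofFrame contDiff_const)
      (contDiff_ofFrame contDiff_const) 0

/-- Generalized Calabi-Yau structures on the gerby torus correspond to complex structures on the
nilmanifold. -/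
def gcyEquivComplex : {J : (Fin 4 → ℝ) → Matrix Idx Idx ℝ // IsEquivariantGCY J} ≃
    {J : Pt → Matrix Idx Idx ℝ // IsEquivariantOrthogonalComplex J} where
  toFun J := ⟨leftField (J.1 0), J.2.isLieComplex.isEquivariantOrthogonalComplex⟩
  invFun J := ⟨fun _ => inFrame J.1 0, J.2.isLieComplex.isEquivariantGCY⟩
  left_inv J := Subtype.ext (funext fun x => by
    exact (inFrame_leftField _ 0).trans (J.2.eq_const x).symm)
  right_inv J := Subtype.ext (leftField_inFrame J.2.inFrame_eq)

lemma inFrame_gcyEquivComplex (J : {J : (Fin 4 → ℝ) → Matrix Idx Idx ℝ // IsEquivariantGCY J})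
    (p : Pt) (x : Fin 4 → ℝ) : inFrame (gcyEquivComplex J).1 p = J.1 x := by
  rw [J.2.eq_const x]
  exact inFrame_leftField _ p

/-! ## Fourier series of periodic functions on the box -/

/-- The function `exp (2π√-1 ν·y)`. -/
def echar (ν : Fin 4 → ℤ) (y : Fin 4 → ℝ) : ℂ :=
  Complex.exp (2 * Real.pi * Complex.I * (∑ i, latt ν i * y i : ℝ))

/-- Invariance under the translations by the standard lattice. -/
def LatticePeriodic {E : Type} (h : (Fin 4 → ℝ) → E) : Prop :=
  ∀ i y, h (y + Pi.single i 1) = h y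

lemma LatticePeriodic.add_single {E : Type} {h : (Fin 4 → ℝ) → E} (hh : LatticePeriodic h)
    (i : Fin 4) (n : ℤ) (y : Fin 4 → ℝ) : h (y + Pi.single i (n : ℝ)) = h y := by
  have h1 : ∀ (n : ℕ) y, h (y + Pi.single i (n : ℝ)) = h y := fun n => by
    induction n with
    | zero => intro y; simp
    | succ n ih => intro y; rw [Nat.cast_succ, Pi.single_add, ← add_assoc, hh, ih]
  obtain ⟨n, rfl | rfl⟩ := n.eq_nat_or_neg
  · exact_mod_cast h1 n y
  · rw [← h1 n]
    congr 1
    rw [add_assoc, ← Pi.single_add]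
    simp

lemma LatticePeriodic.add_latt {E : Type} {h : (Fin 4 → ℝ) → E} (hh : LatticePeriodic h)
    (n : Fin 4 → ℤ) (y : Fin 4 → ℝ) : h (y + latt n) = h y := by
  have h1 : latt n = ∑ i, Pi.single i (n i : ℝ) := (Finset.univ_sum_single (latt n)).symm
  rw [h1, Fin.sum_univ_four, ← add_assoc, ← add_assoc, ← add_assoc, hh.add_single, hh.add_single,
    hh.add_single, hh.add_single]

/-- The projection of the vector space to the torus. -/
def torusMk (y : Fin 4 → ℝ) : UnitAddTorus (Fin 4) := fun i => (y i : UnitAddCircle)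

lemma isQuotientMap_torusMk : Topology.IsQuotientMap torusMk :=
  (IsOpenQuotientMap.piMap fun _ : Fin 4 => (QuotientAddGroup.isOpenQuotientMap_mk :
    IsOpenQuotientMap ((↑) : ℝ → UnitAddCircle))).isQuotientMap

lemma LatticePeriodic.exists_torus {h : (Fin 4 → ℝ) → ℂ} (hh : LatticePeriodic h)
    (hc : Continuous h) : ∃ H : C(UnitAddTorus (Fin 4), ℂ), ∀ y, H (torusMk y) = h y := by
  have hs := isQuotientMap_torusMk.surjective
  have h1 : ∀ y, h (Function.surjInv hs (torusMk y)) = h y := fun y => by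
    have h2 := Function.surjInv_eq hs (torusMk y)
    have h3 : ∀ i, ∃ n : ℤ, Function.surjInv hs (torusMk y) i + n = y i := fun i => by
      have h4 := congrFun h2 i
      obtain ⟨n, hn⟩ := AddSubgroup.mem_zmultiples_iff.mp ((QuotientAddGroup.eq).mp h4)
      exact ⟨n, by rw [zsmul_one] at hn; rw [hn]; ring⟩
    choose n hn using h3
    rw [← hh.add_latt n]
    exact congrArg h (funext hn)
  refine ⟨⟨fun z => h (Function.surjInv hs z), ?_⟩, h1⟩
  rw [isQuotientMap_torusMk.continuous_iff]
  exact (congrArg Continuous (funext h1)).mpr hc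

/-! ### Parseval, uniqueness of Fourier coefficients and translation invariance, transferred from
the torus to the unit box. -/

section Torus

open MeasureTheory

local instance : MeasureSpace UnitAddCircle := ⟨AddCircle.haarAddCircle⟩

local instance : IsProbabilityMeasure (volume : Measure UnitAddCircle) :=
  inferInstanceAs (IsProbabilityMeasure AddCircle.haarAddCircle)

lemma ae_eq_box (a : Fin 4 → ℝ) : {x : Fin 4 → ℝ | ∀ i, x i ∈ Set.Ioc (a i) (a i + 1)}
    =ᵐ[volume] Set.Icc a (a + 1) := by
  have h : {x : Fin 4 → ℝ | ∀ i, x i ∈ Set.Ioc (a i) (a i + 1)}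
      = Set.pi Set.univ fun i => Set.Ioc (a i) ((a + 1 : Fin 4 → ℝ) i) := by
    ext x; simp
  rw [h]
  exact Measure.univ_pi_Ioc_ae_eq_Icc

lemma integral_torus {E : Type} [NormedAddCommGroup E] [NormedSpace ℝ E]
    (H : UnitAddTorus (Fin 4) → E) (a : Fin 4 → ℝ) :
    ∫ z, H z = ∫ y in Set.Icc a (a + 1), H (torusMk y) := by
  rw [UnitAddTorus.integral_preimage H a]
  exact setIntegral_congr_set (ae_eq_box a)

lemma mFourier_torusMk (ν : Fin 4 → ℤ) (y : Fin 4 → ℝ) :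
    UnitAddTorus.mFourier ν (torusMk y) = echar ν y := by
  change ∏ i, fourier (ν i) ((y i : ℝ) : UnitAddCircle) = _
  simp only [fourier_coe_apply, echar]
  rw [← Complex.exp_sum]
  congr 1
  push_cast
  rw [Finset.mul_sum]
  refine Finset.sum_congr rfl fun i _ => ?_
  simp [latt]
  ring

/-- The transform here uses `exp (2π√-1 ν·y)` without conjugation, hence the index `-ν`. -/
lemma mFourierCoeff_torusMk (H : UnitAddTorus (Fin 4) → ℂ) (ν : Fin 4 → ℤ) :
    UnitAddTorus.mFourierCoeff H (-ν)
      = ∫ y in Set.Icc (0 : Fin 4 → ℝ) 1, H (torusMk y) * echar ν y := by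
  have h := integral_torus (fun z => UnitAddTorus.mFourier (- -ν) z • H z) 0
  rw [zero_add] at h
  refine Eq.trans h ?_
  simp only [mFourier_torusMk, neg_neg, smul_eq_mul, mul_comm]

lemma LatticePeriodic.hasSum_normSq {h : (Fin 4 → ℝ) → ℂ} (hh : LatticePeriodic h)
    (hc : Continuous h) :
    HasSum (fun ν => ‖∫ y in Set.Icc (0 : Fin 4 → ℝ) 1, h y * echar ν y‖ ^ 2)
      (∫ y in Set.Icc (0 : Fin 4 → ℝ) 1, ‖h y‖ ^ 2) := by
  obtain ⟨H, hH⟩ := hh.exists_torus hc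
  have h1 := UnitAddTorus.hasSum_sq_mFourierCoeff (ContinuousMap.toLp 2 volume ℂ H)
  rw [← (Equiv.neg (Fin 4 → ℤ)).hasSum_iff] at h1
  have h2 : ∫ z, ‖ContinuousMap.toLp (E := ℂ) 2 volume ℂ H z‖ ^ 2 = ∫ z, ‖H z‖ ^ 2 := by
    refine integral_congr_ae ?_
    filter_upwards [ContinuousMap.coeFn_toLp (p := 2) (𝕜 := ℂ) volume H] with z hz
    rw [hz]
  rw [h2, integral_torus (fun z => ‖H z‖ ^ 2) 0, zero_add] at h1
  simp only [hH] at h1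
  convert h1 using 2 with ν
  simp only [Function.comp_apply, Equiv.neg_apply, UnitAddTorus.mFourierCoeff_toLp,
    mFourierCoeff_torusMk, hH]

/-- Vanishing coefficients are summable, so the Fourier series converges pointwise to the continuous
function. -/
lemma LatticePeriodic.eq_zero {h : (Fin 4 → ℝ) → ℂ} (hh : LatticePeriodic h) (hc : Continuous h)
    (h0 : ∀ ν, ∫ y in Set.Icc (0 : Fin 4 → ℝ) 1, h y * echar ν y = 0) (y : Fin 4 → ℝ) :
    h y = 0 := by
  obtain ⟨H, hH⟩ := hh.exists_torus hc
  have h1 : UnitAddTorus.mFourierCoeff (H : UnitAddTorus (Fin 4) → ℂ) = 0 := funext fun ν => by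
    rw [← neg_neg ν, mFourierCoeff_torusMk]
    simp only [hH, h0, Pi.zero_apply]
  have h2 := UnitAddTorus.hasSum_mFourier_series_apply_of_summable (f := H)
    (h1 ▸ summable_zero) (torusMk y)
  rw [h1, hH] at h2
  simp only [Pi.zero_apply, zero_smul] at h2
  exact h2.unique hasSum_zero

lemma LatticePeriodic.integral_add {h : (Fin 4 → ℝ) → ℂ} (hh : LatticePeriodic h)
    (hc : Continuous h) (a : Fin 4 → ℝ) :
    ∫ y in Set.Icc (0 : Fin 4 → ℝ) 1, h (y + a) = ∫ y in Set.Icc (0 : Fin 4 → ℝ) 1, h y := by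
  obtain ⟨H, hH⟩ := hh.exists_torus hc
  have h1 := integral_torus (H : UnitAddTorus (Fin 4) → ℂ) a
  rw [integral_torus _ 0, zero_add] at h1
  simp only [hH] at h1
  have h2 := (measurePreserving_add_right volume a).setIntegral_preimage_emb
    (MeasurableEquiv.addRight a).measurableEmbedding h (Set.Icc a (a + 1))
  rw [h1, ← h2]
  congr 2
  rw [Set.preimage_add_const_Icc, sub_self, add_sub_cancel_left]

end Torus

/-- In the divergence theorem for the field with `h` in direction `k`, opposite faces cancel by
periodicity. It supplies the integration by parts in the fibre. -/
lemma LatticePeriodic.integral_pd {h : (Fin 4 → ℝ) → ℂ} (hh : LatticePeriodic h)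
    (hc : ContDiff ℝ 1 h) (k : Fin 4) :
    ∫ y in Set.Icc (0 : Fin 4 → ℝ) 1, fderiv ℝ h y (Pi.single k 1) = 0 := by
  have hd : Continuous fun y => fderiv ℝ h y (Pi.single k 1) :=
    (hc.continuous_fderiv one_ne_zero).clm_apply continuous_const
  have h1 := MeasureTheory.integral_divergence_of_hasFDerivAt_off_countable' (0 : Fin 4 → ℝ) 1
    zero_le_one (fun i => if i = k then h else 0) (fun i y => if i = k then fderiv ℝ h y else 0) ∅
    Set.countable_empty (fun i => by
      split_ifs
      · exact hc.continuous.continuousOn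
      · exact continuousOn_const)
    (fun y _ i => by
      split_ifs
      · exact (hc.differentiable one_ne_zero y).hasFDerivAt
      · exact hasFDerivAt_const _ _)
    (by
      refine (Continuous.continuousOn ?_).integrableOn_compact isCompact_Icc
      refine continuous_finsetSum _ fun i _ => ?_
      split_ifs with hi
      · subst hi; exact hd
      · exact continuous_const)
  have h2 : ∀ y, (∑ i, (if i = k then fderiv ℝ h y else 0 : (Fin 4 → ℝ) →L[ℝ] ℂ) (Pi.single i 1))
      = fderiv ℝ h y (Pi.single k 1) := fun y => by
    rw [Finset.sum_eq_single k]
    · simp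
    · intro i _ hi; simp [hi]
    · simp
  simp only [h2] at h1
  rw [h1]
  refine Finset.sum_eq_zero fun i _ => ?_
  rw [sub_eq_zero]
  congr 1
  funext y
  split_ifs with hi
  · refine (congrArg h (funext fun j => ?_)).trans (hh i _)
    rcases Fin.eq_self_or_eq_succAbove i j with rfl | ⟨l, rfl⟩
    · simp
    · simp
  · rfl

/-! ## The Fourier transform along the fibres -/

open MeasureTheory in
lemma integrable_box {E : Type} [NormedAddCommGroup E] {g : (Fin 4 → ℝ) → E} (hg : Continuous g) :
    IntegrableOn g (Set.Icc 0 1) :=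
  hg.continuousOn.integrableOn_compact isCompact_Icc

lemma hasFDerivAt_integral_box {G : (Fin 4 → ℝ) × (Fin 4 → ℝ) → ℂ} (hG : ContDiff ℝ 1 G)
    (x : Fin 4 → ℝ) : HasFDerivAt (fun x => ∫ y in Set.Icc (0 : Fin 4 → ℝ) 1, G (x, y))
      (∫ y in Set.Icc (0 : Fin 4 → ℝ) 1,
        (fderiv ℝ G (x, y)).comp (ContinuousLinearMap.inl ℝ (Fin 4 → ℝ) (Fin 4 → ℝ))) x := by
  have hc : Continuous fun p => (fderiv ℝ G p).comp
      (ContinuousLinearMap.inl ℝ (Fin 4 → ℝ) (Fin 4 → ℝ)) :=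
    (hG.continuous_fderiv one_ne_zero).clm_comp continuous_const
  obtain ⟨C, hC⟩ := ((isCompact_closedBall x 1).prod
    (isCompact_Icc : IsCompact (Set.Icc (0 : Fin 4 → ℝ) 1))).exists_bound_of_continuousOn
    hc.continuousOn
  refine hasFDerivAt_integral_of_dominated_of_fderiv_le (𝕜 := ℝ)
    (F := fun x y => G (x, y)) (F' := fun x y => (fderiv ℝ G (x, y)).comp
      (ContinuousLinearMap.inl ℝ (Fin 4 → ℝ) (Fin 4 → ℝ))) (bound := fun _ => C)
    (Metric.closedBall_mem_nhds x one_pos) (Filter.Eventually.of_forall fun x' => ?_) ?_ ?_ ?_ ?_ ?_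
  · exact (hG.continuous.comp (by fun_prop)).aestronglyMeasurable
  · exact integrable_box (hG.continuous.comp (by fun_prop))
  · exact (hc.comp (by fun_prop)).aestronglyMeasurable
  · filter_upwards [MeasureTheory.ae_restrict_mem measurableSet_Icc] with y hy x' hx'
    exact hC (x', y) ⟨hx', hy⟩
  · exact integrable_box continuous_const
  · refine Filter.Eventually.of_forall fun y x' _ => ?_
    exact (hG.differentiable one_ne_zero (x', y)).hasFDerivAt.comp x' (hasFDerivAt_prodMk_left x' y)

lemma contDiff_elim : ContDiff ℝ ∞ fun q : (Fin 4 → ℝ) × (Fin 4 → ℝ) =>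
    (Sum.elim q.2 q.1 : Pt) := by
  rw [contDiff_pi]
  rintro (i | i)
  · simp only [Sum.elim_inl]; fun_prop
  · simp only [Sum.elim_inr]; fun_prop

lemma hasFDerivAt_elim (q : (Fin 4 → ℝ) × (Fin 4 → ℝ)) :
    ∃ D : (Fin 4 → ℝ) × (Fin 4 → ℝ) →L[ℝ] Pt,
      HasFDerivAt (fun q : (Fin 4 → ℝ) × (Fin 4 → ℝ) => (Sum.elim q.2 q.1 : Pt)) D q ∧
      ∀ r, D r = Sum.elim r.2 r.1 := by
  let D : (Fin 4 → ℝ) × (Fin 4 → ℝ) →L[ℝ] Pt := LinearMap.toContinuousLinearMap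
    { toFun := fun q => Sum.elim q.2 q.1
      map_add' := fun q r => by funext a; rcases a with i | i <;> rfl
      map_smul' := fun c q => by funext a; rcases a with i | i <;> rfl }
  exact ⟨D, D.hasFDerivAt, fun _ => rfl⟩

lemma hasFDerivAt_echar (ν : Fin 4 → ℤ) (y : Fin 4 → ℝ) :
    ∃ D : (Fin 4 → ℝ) →L[ℝ] ℂ, HasFDerivAt (echar ν) D y ∧
      ∀ k, D (Pi.single k 1) = 2 * Real.pi * Complex.I * (ν k : ℂ) * echar ν y := by
  let D : (Fin 4 → ℝ) →L[ℝ] ℝ := ∑ i, latt ν i • ContinuousLinearMap.proj i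
  have hD : HasFDerivAt (fun y : Fin 4 → ℝ => ∑ i, latt ν i * y i) D y := by
    have : (fun y : Fin 4 → ℝ => ∑ i, latt ν i * y i) = D := by
      funext y; simp [D]
    rw [this]
    exact D.hasFDerivAt
  refine ⟨_, ((Complex.ofRealCLM.hasFDerivAt.comp y hD).const_mul
    (2 * Real.pi * Complex.I)).cexp, fun k => ?_⟩
  simp [D, latt, echar, Pi.single_apply]
  ring

lemma contDiff_echar (ν : Fin 4 → ℤ) : ContDiff ℝ ∞ (echar ν) := by
  have h : ContDiff ℝ ∞ fun y : Fin 4 → ℝ => ∑ i, latt ν i * y i := by fun_prop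
  exact (contDiff_const.mul (Complex.ofRealCLM.contDiff.comp h)).cexp

lemma echar_add (ν : Fin 4 → ℤ) (y z : Fin 4 → ℝ) : echar ν (y + z) = echar ν y * echar ν z := by
  rw [echar, echar, echar, ← Complex.exp_add]
  congr 1
  simp only [Pi.add_apply, mul_add, Finset.sum_add_distrib]
  push_cast
  ring

lemma echar_single (ν : Fin 4 → ℤ) (i : Fin 4) : echar ν (Pi.single i 1) = 1 := by
  rw [echar, Complex.exp_eq_one_iff]
  refine ⟨ν i, ?_⟩
  simp [latt, Pi.single_apply]
  ring

lemma echar_periodic (ν : Fin 4 → ℤ) : LatticePeriodic (echar ν) := fun i y => by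
  rw [echar_add, echar_single, mul_one]

lemma norm_echar (ν : Fin 4 → ℤ) (y : Fin 4 → ℝ) : ‖echar ν y‖ = 1 := by
  rw [echar, mul_assoc, mul_comm (2 * _ : ℂ), Complex.norm_exp]
  simp

lemma leftInv_single_inl (p : Pt) (k : Fin 4) :
    leftInv p (Pi.single (Sum.inl k) 1) = Pi.single (Sum.inl k) 1 := by
  have h : cross (vec p) (vec (Pi.single (Sum.inl k) 1 : Pt)) = 0 := by
    funext j; fin_cases j <;> simp
  funext a
  rcases a with j | j
  · rw [leftInv_inl, h]; simp
  · rfl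

namespace ZeroX

variable (f : ZeroX)

lemma apply_gmul_single (a : Idx) (p : Pt) : f.1 (gmul (Pi.single a 1) p) = f.1 p :=
  f.2.2 ⟨Pi.single a 1⟩ (Subgroup.subset_closure ⟨a, rfl⟩) p

lemma periodic (x : Fin 4 → ℝ) : LatticePeriodic fun y => f.1 (Sum.elim y x) := fun i y => by
  refine (congrArg f.1 ?_).trans (apply_gmul_single f (Sum.inl i) (Sum.elim y x))
  funext a
  rcases a with j | j
  · have h : cross (vec (Pi.single (Sum.inl i) 1 : Pt)) x = 0 := by
      funext j; fin_cases j <;> simp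
    simp only [gmul_inl, Sum.elim_inl, Pi.add_apply]
    have h2 : vec (Sum.elim y x : Pt) = x := rfl
    rw [h2, h]
    simp [Pi.single_apply, add_comm]
  · simp

/-- Left translation by a base generator moves `x` and shears the fibre; the Fourier transform turns
the shear into the factor of automorphy. -/
lemma apply_add_single (i : Fin 4) (x y : Fin 4 → ℝ) : f.1 (Sum.elim y (x + Pi.single i 1))
    = f.1 (Sum.elim (y - (1 / 2 : ℝ) • cross (Pi.single i 1) x) x) := by
  refine (congrArg f.1 ?_).trans (apply_gmul_single f (Sum.inr i) (Sum.elim (y - _) x))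
  have h : vec (Pi.single (Sum.inr i) 1 : Pt) = Pi.single i 1 := by
    funext j; simp [Pi.single_apply]
  funext a
  rcases a with j | j
  · rw [gmul_inl, h]
    have h2 : ∀ z, vec (Sum.elim z x : Pt) = x := fun _ => rfl
    rw [h2]
    simp
  · simp [add_comm, Pi.single_apply]

lemma contDiff_integrand (ν : Fin 4 → ℤ) :
    ContDiff ℝ ∞ fun q : (Fin 4 → ℝ) × (Fin 4 → ℝ) => f.1 (Sum.elim q.2 q.1) * echar ν q.2 :=
  (f.2.1.comp contDiff_elim).mul ((contDiff_echar ν).comp contDiff_snd)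

lemma continuous_integrand (ν : Fin 4 → ℤ) (x : Fin 4 → ℝ) :
    Continuous fun y => f.1 (Sum.elim y x) * echar ν y :=
  (contDiff_integrand f ν).continuous.comp (by fun_prop : Continuous fun y => (x, y))

lemma integrable_integrand (ν : Fin 4 → ℤ) (x : Fin 4 → ℝ) :
    MeasureTheory.IntegrableOn (fun y => f.1 (Sum.elim y x) * echar ν y) (Set.Icc 0 1) :=
  integrable_box (continuous_integrand f ν x)

lemma fderiv_integrand (ν : Fin 4 → ℤ) (x y : Fin 4 → ℝ) (v : (Fin 4 → ℝ) × (Fin 4 → ℝ)) :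
    fderiv ℝ (fun q : (Fin 4 → ℝ) × (Fin 4 → ℝ) => f.1 (Sum.elim q.2 q.1) * echar ν q.2) (x, y) v
      = fderiv ℝ f.1 (Sum.elim y x) (Sum.elim v.2 v.1) * echar ν y
        + f.1 (Sum.elim y x) * fderiv ℝ (echar ν) y v.2 := by
  obtain ⟨D, hD, hDv⟩ := hasFDerivAt_elim (x, y)
  have h1 := (f.2.1.differentiable (by simp) (Sum.elim y x)).hasFDerivAt.comp (x, y) hD
  have h2 := ((contDiff_echar ν).differentiable (by simp) y).hasFDerivAt.comp (x, y)
    (hasFDerivAt_snd (𝕜 := ℝ) (p := (x, y)))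
  have h3 := h1.mul h2
  have h4 : (fun q : (Fin 4 → ℝ) × (Fin 4 → ℝ) => f.1 (Sum.elim q.2 q.1) * echar ν q.2)
      = (f.1 ∘ fun q : (Fin 4 → ℝ) × (Fin 4 → ℝ) => (Sum.elim q.2 q.1 : Pt))
        * (echar ν ∘ Prod.snd) := rfl
  rw [h4, h3.fderiv]
  simp [hDv]
  ring

lemma fourierCoeff_act_inl (k : Fin 4) (ν : Fin 4 → ℤ) (x : Fin 4 → ℝ) :
    fourierCoeffX (actX (Sum.inl k) f).1 ν x
      = -(2 * Real.pi * Complex.I * (ν k : ℂ)) * fourierCoeffX f.1 ν x := by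
  have hper : LatticePeriodic fun y => f.1 (Sum.elim y x) * echar ν y := fun i y =>
    congrArg₂ (· * ·) (periodic f x i y) (echar_periodic ν i y)
  have hc : ContDiff ℝ 1 fun y => f.1 (Sum.elim y x) * echar ν y :=
    ((contDiff_integrand f ν).comp (contDiff_const.prodMk contDiff_id :
      ContDiff ℝ ∞ fun y => (x, y))).of_le (by simp)
  have h := hper.integral_pd hc k
  have h1 : ∀ y, fderiv ℝ (fun y => f.1 (Sum.elim y x) * echar ν y) y (Pi.single k 1)
      = (actX (Sum.inl k) f).1 (Sum.elim y x) * echar ν y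
        + 2 * Real.pi * Complex.I * (ν k : ℂ) * (f.1 (Sum.elim y x) * echar ν y) := fun y => by
    have h2 := ((contDiff_integrand f ν).differentiable (by simp) (x, y)).hasFDerivAt.comp y
      (hasFDerivAt_prodMk_right x y)
    have h3 : (fun y => f.1 (Sum.elim y x) * echar ν y)
      = (fun q : (Fin 4 → ℝ) × (Fin 4 → ℝ) => f.1 (Sum.elim q.2 q.1) * echar ν q.2)
        ∘ fun y => (x, y) := rfl
    rw [h3, h2.fderiv, ContinuousLinearMap.comp_apply, fderiv_integrand]
    obtain ⟨D, hD, hDv⟩ := hasFDerivAt_echar ν y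
    have h4 : (Pi.single (Sum.inl k) 1 : Pt) = Sum.elim (Pi.single k 1) 0 := by
      funext a; rcases a with j | j <;> simp [Pi.single_apply]
    change _ = fderiv ℝ f.1 (Sum.elim y x) (leftInv _ _) * _ + _
    rw [leftInv_single_inl, h4, hD.fderiv]
    simp [hDv]
    ring
  simp only [h1] at h
  rw [MeasureTheory.integral_add (integrable_integrand _ ν x)
    ((integrable_integrand f ν x).const_mul _), MeasureTheory.integral_const_mul] at h
  rw [neg_mul]
  exact eq_neg_of_add_eq_zero_left h

/-- The coordinate field in direction `i` is the left-invariant field `β_i` minus central fields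
`α^k` with coefficients linear in `x`. The `α^k` act on the coefficient by scalars, and together
they give the connection term. -/
lemma hasFDerivAt_fourierCoeff (ν : Fin 4 → ℤ) (x : Fin 4 → ℝ) :
    ∃ D : (Fin 4 → ℝ) →L[ℝ] ℂ, HasFDerivAt (fourierCoeffX f.1 ν) D x ∧
      ∀ i, D (Pi.single i 1) = fourierCoeffX (actX (Sum.inr i) f).1 ν x
        - Real.pi * Complex.I * (det3 (Pi.single i 1) x (latt ν) : ℝ) * fourierCoeffX f.1 ν x := by
  have hG := contDiff_integrand f ν
  refine ⟨_, hasFDerivAt_integral_box (hG.of_le (by simp)) x, fun i => ?_⟩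
  have hc : Continuous fun y => (fderiv ℝ (fun q : (Fin 4 → ℝ) × (Fin 4 → ℝ) =>
      f.1 (Sum.elim q.2 q.1) * echar ν q.2) (x, y)).comp
      (ContinuousLinearMap.inl ℝ (Fin 4 → ℝ) (Fin 4 → ℝ)) :=
    ((hG.continuous_fderiv (by simp)).comp (by fun_prop : Continuous fun y => (x, y))).clm_comp
      continuous_const
  rw [ContinuousLinearMap.integral_apply (integrable_box hc)]
  have h1 : ∀ y, (Sum.elim 0 (Pi.single i 1) : Pt)
      = leftInv (Sum.elim y x) (Pi.single (Sum.inr i) 1)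
        - ∑ k, (1 / 2 * cross x (Pi.single i 1) k) •
            leftInv (Sum.elim y x) (Pi.single (Sum.inl k) 1) := fun y => by
    simp only [leftInv_single_inl]
    have h : vec (Pi.single (Sum.inr i) 1 : Pt) = Pi.single i 1 := by
      funext j; simp [Pi.single_apply]
    have h' : vec (Sum.elim y x : Pt) = x := rfl
    funext a
    rcases a with j | j
    · rw [Pi.sub_apply, leftInv_inl, h, h', Finset.sum_apply]
      simp [Pi.single_apply]
    · simp [Pi.single_apply]
  have h2 : ∀ y, ((fderiv ℝ (fun q : (Fin 4 → ℝ) × (Fin 4 → ℝ) =>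
      f.1 (Sum.elim q.2 q.1) * echar ν q.2) (x, y)).comp
      (ContinuousLinearMap.inl ℝ (Fin 4 → ℝ) (Fin 4 → ℝ))) (Pi.single i 1)
      = (actX (Sum.inr i) f).1 (Sum.elim y x) * echar ν y
        - ∑ k, ((1 / 2 * cross x (Pi.single i 1) k : ℝ) : ℂ) *
          ((actX (Sum.inl k) f).1 (Sum.elim y x) * echar ν y) := fun y => by
    rw [ContinuousLinearMap.comp_apply, fderiv_integrand]
    simp only [ContinuousLinearMap.inl_apply, map_zero, mul_zero, add_zero]
    rw [h1 y, map_sub, map_sum, sub_mul, Finset.sum_mul]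
    congr 1
    refine Finset.sum_congr rfl fun k _ => ?_
    rw [map_smul, Complex.real_smul, mul_assoc]
    rfl
  simp only [h2]
  rw [MeasureTheory.integral_sub (integrable_integrand _ ν x)
    (MeasureTheory.integrable_finsetSum _ fun k _ => (integrable_integrand _ ν x).const_mul _),
    MeasureTheory.integral_finsetSum _ fun k _ => (integrable_integrand _ ν x).const_mul _]
  simp only [MeasureTheory.integral_const_mul]
  have h3 : ∀ k, ∫ y in Set.Icc (0 : Fin 4 → ℝ) 1,
      (actX (Sum.inl k) f).1 (Sum.elim y x) * echar ν y
      = -(2 * Real.pi * Complex.I * (ν k : ℂ)) * fourierCoeffX f.1 ν x := fun k =>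
    fourierCoeff_act_inl f k ν x
  simp only [h3]
  change fourierCoeffX _ _ _ - _ = _
  congr 1
  rw [det3_swap, det3]
  push_cast
  rw [← Finset.sum_neg_distrib, Finset.mul_sum, Finset.sum_mul]
  refine Finset.sum_congr rfl fun k _ => ?_
  simp only [latt, Complex.ofReal_intCast]
  ring

/-- The first derivatives of a coefficient are again built from coefficients of smooth functions, so
the induction on the order runs over all `f` at once. -/
lemma contDiff_fourierCoeff (ν : Fin 4 → ℤ) : ContDiff ℝ ∞ (fourierCoeffX f.1 ν) := by
  have h : ∀ (n : ℕ) (f : ZeroX), ContDiff ℝ n (fourierCoeffX f.1 ν) := fun n => by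
    induction n with
    | zero =>
      intro f
      exact contDiff_zero.mpr (continuous_iff_continuousAt.mpr fun x =>
        (hasFDerivAt_fourierCoeff f ν x).choose_spec.1.continuousAt)
    | succ n ih =>
      intro f
      choose D hD hDv using hasFDerivAt_fourierCoeff f ν
      have hD2 : D = fun x => ∑ i, (ContinuousLinearMap.proj i : (Fin 4 → ℝ) →L[ℝ] ℝ).smulRight
          (fourierCoeffX (actX (Sum.inr i) f).1 ν x - Real.pi * Complex.I *
            (det3 (Pi.single i 1) x (latt ν) : ℝ) * fourierCoeffX f.1 ν x) := by
        funext x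
        refine ContinuousLinearMap.coe_injective (LinearMap.pi_ext' fun i => ?_)
        refine LinearMap.ext_ring ?_
        simp [hDv, Pi.single_apply, apply_ite Complex.ofReal]
      refine contDiff_succ_iff_hasFDerivAt.mpr ⟨D, ?_, hD⟩
      rw [hD2]
      refine ContDiff.sum fun i _ => ?_
      refine ContDiff.smulRight contDiff_const ?_
      have h2 : ContDiff ℝ n fun x : Fin 4 → ℝ =>
          ((det3 (Pi.single i 1) x (latt ν) : ℝ) : ℂ) :=
        (Complex.ofRealCLM.contDiff.comp (contDiff_det3 i (latt ν))).of_le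
          (by exact_mod_cast le_top)
      exact (ih _).sub ((contDiff_const.mul h2).mul (ih f))
  exact contDiff_infty.mpr fun n => h n f

/-- The fibre integral is invariant under the shear, a translation for fixed `x`, and the character
picks up the phase. -/
lemma fourierCoeff_add_single (ν : Fin 4 → ℤ) (i : Fin 4) (x : Fin 4 → ℝ) :
    fourierCoeffX f.1 ν (x + Pi.single i 1)
      = Complex.exp (Real.pi * Complex.I * (det3 (Pi.single i 1) x (latt ν) : ℝ))
        * fourierCoeffX f.1 ν x := by
  have hper : LatticePeriodic fun y => f.1 (Sum.elim y x) * echar ν y := fun i y =>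
    congrArg₂ (· * ·) (periodic f x i y) (echar_periodic ν i y)
  have h := hper.integral_add (continuous_integrand f ν x)
    (-((1 / 2 : ℝ) • cross (Pi.single i 1) x))
  have h1 : ∀ y, f.1 (Sum.elim y (x + Pi.single i 1)) * echar ν y
      = echar ν ((1 / 2 : ℝ) • cross (Pi.single i 1) x) *
        (f.1 (Sum.elim (y + -((1 / 2 : ℝ) • cross (Pi.single i 1) x)) x) *
          echar ν (y + -((1 / 2 : ℝ) • cross (Pi.single i 1) x))) := fun y => by
    rw [apply_add_single, ← sub_eq_add_neg, mul_left_comm, ← echar_add, add_sub_cancel]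
  change ∫ y in Set.Icc (0 : Fin 4 → ℝ) 1, f.1 (Sum.elim y (x + Pi.single i 1)) * echar ν y = _
  simp only [h1]
  rw [MeasureTheory.integral_const_mul, h]
  change _ * fourierCoeffX f.1 ν x = _
  congr 1
  rw [echar, det3]
  congr 1
  push_cast
  rw [Finset.mul_sum, Finset.mul_sum]
  refine Finset.sum_congr rfl fun k _ => ?_
  simp
  ring

/-- The Fourier coefficient as a section of the line bundle. -/
def fourier (ν : Fin 4 → ℤ) : ZeroX →ₗ[ℂ] sectionsL ν where
  toFun f := ⟨fourierCoeffX f.1 ν, contDiff_fourierCoeff f ν, fourierCoeff_add_single f ν⟩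
  map_add' f g := by
    apply Subtype.ext
    funext x
    change ∫ y in Set.Icc (0 : Fin 4 → ℝ) 1, (f.1 (Sum.elim y x) + g.1 (Sum.elim y x)) * echar ν y
      = (∫ y in Set.Icc (0 : Fin 4 → ℝ) 1, f.1 (Sum.elim y x) * echar ν y)
        + ∫ y in Set.Icc (0 : Fin 4 → ℝ) 1, g.1 (Sum.elim y x) * echar ν y
    rw [← MeasureTheory.integral_add (integrable_integrand f ν x) (integrable_integrand g ν x)]
    simp only [add_mul]
  map_smul' c f := by
    apply Subtype.ext
    funext x
    change ∫ y in Set.Icc (0 : Fin 4 → ℝ) 1, (c * f.1 (Sum.elim y x)) * echar ν y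
      = c * ∫ y in Set.Icc (0 : Fin 4 → ℝ) 1, f.1 (Sum.elim y x) * echar ν y
    rw [← MeasureTheory.integral_const_mul]
    simp only [mul_assoc]

lemma fourier_actX (ν : Fin 4 → ℤ) (a : Idx) :
    fourier ν (actX a f) = actL ν a (fourier ν f) := by
  apply Subtype.ext
  funext x
  rcases a with k | i
  · exact fourierCoeff_act_inl f k ν x
  · obtain ⟨D, hD, hDv⟩ := hasFDerivAt_fourierCoeff f ν x
    change fourierCoeffX (actX (Sum.inr i) f).1 ν x
      = fderiv ℝ (fourierCoeffX f.1 ν) x (Pi.single i 1) + _ * fourierCoeffX f.1 ν x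
    rw [hD.fderiv, hDv]
    ring

lemma wordL_fourier (ν : Fin 4 → ℤ) (w : List Idx) :
    wordL ν w (fourier ν f) = fourier ν ((w.map actX).prod f) := by
  induction w with
  | nil => rfl
  | cons a w ih =>
    simp only [wordL, List.map_cons, List.prod_cons, Module.End.mul_apply] at ih ⊢
    rw [ih, fourier_actX]

-- Parseval holds on each fibre; it is integrated over the base and combined with Fubini.
open MeasureTheory in
lemma hasSum_normSq :
    HasSum (fun ν => normSqL ν (fourier ν f)) (∫ p in Set.Icc (0 : Pt) 1, ‖f.1 p‖ ^ 2) := by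
  have hfc : Continuous fun q : (Fin 4 → ℝ) × (Fin 4 → ℝ) => ‖f.1 (Sum.elim q.2 q.1)‖ ^ 2 :=
    (f.2.1.continuous.comp contDiff_elim.continuous).norm.pow 2
  have h1 : ∀ x, HasSum (fun ν => ‖(fourier ν f).1 x‖ ^ 2)
      (∫ y in Set.Icc (0 : Fin 4 → ℝ) 1, ‖f.1 (Sum.elim y x)‖ ^ 2) := fun x =>
    (periodic f x).hasSum_normSq (f.2.1.continuous.comp
      (contDiff_elim.continuous.comp (by fun_prop : Continuous fun y => (x, y))))
  have hint : IntegrableOn (fun q : (Fin 4 → ℝ) × (Fin 4 → ℝ) => ‖f.1 (Sum.elim q.2 q.1)‖ ^ 2)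
      (Set.Icc 0 1 ×ˢ Set.Icc 0 1) (volume.prod volume) :=
    hfc.continuousOn.integrableOn_compact (isCompact_Icc.prod isCompact_Icc)
  have hint2 : Integrable (fun x => ∫ y in Set.Icc (0 : Fin 4 → ℝ) 1, ‖f.1 (Sum.elim y x)‖ ^ 2)
      (volume.restrict (Set.Icc (0 : Fin 4 → ℝ) 1)) := by
    rw [IntegrableOn, ← Measure.prod_restrict] at hint
    exact hint.integral_prod_left
  -- The terms are nonnegative and serve as their own dominating functions.
  have h2 := hasSum_integral_of_dominated_convergence
    (μ := volume.restrict (Set.Icc (0 : Fin 4 → ℝ) 1))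
    (F := fun ν x => ‖(fourier ν f).1 x‖ ^ 2) (fun ν x => ‖(fourier ν f).1 x‖ ^ 2)
    (fun ν => ((fourier ν f).2.1.continuous.norm.pow 2).aestronglyMeasurable)
    (fun ν => Filter.Eventually.of_forall fun x => by simp)
    (Filter.Eventually.of_forall fun x => (h1 x).summable)
    (by simpa only [(h1 _).tsum_eq] using hint2)
    (Filter.Eventually.of_forall h1)
  have h3 := setIntegral_prod _ hint
  have h4 := ((volume_measurePreserving_sumPiEquivProdPi_symm
    (fun _ : Idx => ℝ))).setIntegral_preimage_emb (MeasurableEquiv.measurableEmbedding _)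
    (fun p : Pt => ‖f.1 p‖ ^ 2) (Set.Icc 0 1)
  have h5 := setIntegral_prod_swap (μ := volume) (ν := volume) (Set.Icc (0 : Fin 4 → ℝ) 1)
    (Set.Icc (0 : Fin 4 → ℝ) 1)
    (fun q : (Fin 4 → ℝ) × (Fin 4 → ℝ) => ‖f.1 (Sum.elim q.2 q.1)‖ ^ 2)
  have h6 : (MeasurableEquiv.sumPiEquivProdPi fun _ : Idx => ℝ).symm ⁻¹' Set.Icc 0 1
      = Set.Icc 0 1 ×ˢ Set.Icc 0 1 := by
    ext q
    constructor
    · intro h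
      exact ⟨⟨fun i => h.1 (Sum.inl i), fun i => h.2 (Sum.inl i)⟩,
        ⟨fun i => h.1 (Sum.inr i), fun i => h.2 (Sum.inr i)⟩⟩
    · intro h
      refine ⟨fun a => ?_, fun a => ?_⟩
      · rcases a with i | i
        · exact h.1.1 i
        · exact h.2.1 i
      · rcases a with i | i
        · exact h.1.2 i
        · exact h.2.2 i
  rw [h6] at h4
  have h7 : ∀ q : (Fin 4 → ℝ) × (Fin 4 → ℝ),
      (MeasurableEquiv.sumPiEquivProdPi fun _ : Idx => ℝ).symm q = Sum.elim q.1 q.2 := fun q => by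
    funext a; rcases a with i | i <;> rfl
  simp only [h7] at h4
  rw [← h4]
  exact (h5.trans h3) ▸ h2

end ZeroX

/-- The Fourier transform along the fibres. -/
def fourierX : ZeroX →ₗ[ℂ] ZeroY where
  toFun f := ⟨fun ν => f.fourier ν, fun w => by
    -- Words act before or after the transform alike, so smoothness of the vector is Parseval for
    -- the derivatives of `f`.
    simp only [ZeroX.wordL_fourier]
    exact (ZeroX.hasSum_normSq _).summable⟩
  map_add' f g := Subtype.ext (funext fun ν => map_add (ZeroX.fourier ν) f g)
  map_smul' c f := Subtype.ext (funext fun ν => map_smul (ZeroX.fourier ν) c f)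

lemma fourierX_actX (a : Idx) (f : ZeroX) : fourierX (actX a f) = actY a (fourierX f) :=
  Subtype.ext (funext fun ν => ZeroX.fourier_actX f ν a)

lemma fourierX_injective : Function.Injective fourierX := by
  rw [injective_iff_map_eq_zero]
  intro f hf
  apply Subtype.ext
  funext p
  have h := (ZeroX.periodic f (vec p)).eq_zero (f.2.1.continuous.comp
    (contDiff_elim.continuous.comp (by fun_prop : Continuous fun y => (vec p, y))))
    (fun ν => congrFun (congrArg Subtype.val (congrFun (congrArg Subtype.val hf) ν)) (vec p))
    (cov p)
  have hp : (Sum.elim (cov p) (vec p) : Pt) = p := by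
    funext a; rcases a with i | i <;> rfl
  rwa [hp] at h

/-! ## A Sobolev inequality for sections of the line bundles -/

section Sobolev

open MeasureTheory

/-- The fundamental theorem of calculus bounds `φ t` by `φ u` and the integral of `φ'`; averaging
over `u` gives the estimate. -/
lemma enorm_le_lintegral_unit {φ φ' : ℝ → ℂ} (hφ : ∀ u, HasDerivAt φ (φ' u) u)
    (hc : Continuous φ') {t : ℝ} (ht : t ∈ Set.Icc (0 : ℝ) 1) :
    ‖φ t‖ₑ ≤ ∫⁻ u in Set.Icc (0 : ℝ) 1, (‖φ u‖ₑ + ‖φ' u‖ₑ) := by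
  have hcφ : Continuous φ := continuous_iff_continuousAt.mpr fun u => (hφ u).continuousAt
  have h1 : ∀ u ∈ Set.Icc (0 : ℝ) 1,
      ‖φ t‖ₑ ≤ ‖φ u‖ₑ + ∫⁻ v in Set.Icc (0 : ℝ) 1, ‖φ' v‖ₑ := fun u hu => by
    have h2 : φ t - φ u = ∫ v in u..t, φ' v :=
      (intervalIntegral.integral_eq_sub_of_hasDerivAt (fun v _ => hφ v)
        (hc.intervalIntegrable _ _)).symm
    have h3 : ‖φ t - φ u‖ₑ ≤ ∫⁻ v in Set.Icc (0 : ℝ) 1, ‖φ' v‖ₑ := by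
      rw [h2, ← ofReal_norm, intervalIntegral.norm_intervalIntegral_eq, ofReal_norm]
      refine (enorm_integral_le_lintegral_enorm _).trans (lintegral_mono_set ?_)
      exact Set.uIoc_subset_uIcc.trans (Set.uIcc_subset_Icc hu ht)
    calc ‖φ t‖ₑ = ‖φ u + (φ t - φ u)‖ₑ := by rw [add_sub_cancel]
      _ ≤ ‖φ u‖ₑ + ‖φ t - φ u‖ₑ := enorm_add_le _ _
      _ ≤ _ := by gcongr
  have h4 : ∀ c : ENNReal, ∫⁻ _ in Set.Icc (0 : ℝ) 1, c = c := fun c => by simp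
  calc ‖φ t‖ₑ = ∫⁻ _ in Set.Icc (0 : ℝ) 1, ‖φ t‖ₑ := (h4 _).symm
    _ ≤ ∫⁻ u in Set.Icc (0 : ℝ) 1, (‖φ u‖ₑ + ∫⁻ v in Set.Icc (0 : ℝ) 1, ‖φ' v‖ₑ) :=
      setLIntegral_mono' measurableSet_Icc h1
    _ = _ := by
      rw [lintegral_add_left hcφ.measurable.enorm, h4, lintegral_add_left hcφ.measurable.enorm]

lemma norm_exp_mul_I (c : ℝ) : ‖Complex.exp (Real.pi * Complex.I * (c : ℂ))‖ = 1 := by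
  have h : (Real.pi * Complex.I * (c : ℂ) : ℂ) = ((Real.pi * c : ℝ) : ℂ) * Complex.I := by
    push_cast; ring
  rw [h, Complex.norm_exp_ofReal_mul_I]

variable {ν : Fin 4 → ℤ}

lemma norm_section_add_single (t : sectionsL ν) (i : Fin 4) (x : Fin 4 → ℝ) :
    ‖t.1 (x + Pi.single i 1)‖ = ‖t.1 x‖ := by
  rw [t.2.2, norm_mul, norm_exp_mul_I, one_mul]

lemma norm_section_add_latt (t : sectionsL ν) (n : Fin 4 → ℤ) (x : Fin 4 → ℝ) :
    ‖t.1 (x + latt n)‖ = ‖t.1 x‖ :=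
  LatticePeriodic.add_latt (h := fun x => ‖t.1 x‖) (norm_section_add_single t) n x

lemma det3_update (i : Fin 4) (x w : Fin 4 → ℝ) (u : ℝ) :
    det3 (Pi.single i 1) (Function.update x i u) w = det3 (Pi.single i 1) x w := by
  fin_cases i <;> simp [det3, Fin.sum_univ_four]

/-- Along the `i`-th line the connection form is constant by `det3_update`, so multiplication by the
phase `e` turns the covariant derivative into an ordinary one without changing norms. -/
lemma enorm_section_le (t : sectionsL ν) (i : Fin 4) (x : Fin 4 → ℝ) :
    ‖t.1 x‖ₑ ≤ ∫⁻ u in Set.Icc (0 : ℝ) 1, (‖t.1 (Function.update x i u)‖ₑ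
      + ‖(actL ν (Sum.inr i) t).1 (Function.update x i u)‖ₑ) := by
  set c := det3 (Pi.single i 1) x (latt ν) with hc
  set e : ℝ → ℂ := fun u => Complex.exp (Real.pi * Complex.I * ((u * c : ℝ) : ℂ)) with he
  have hen : ∀ u, ‖e u‖ₑ = 1 := fun u => by
    rw [← ofReal_norm, he, norm_exp_mul_I, ENNReal.ofReal_one]
  have hup : ∀ u, HasDerivAt (fun u => Function.update x i u) (Pi.single i 1) u := fun u =>
    hasDerivAt_update x i u
  have hupc : Continuous fun u => Function.update x i u :=
    continuous_iff_continuousAt.mpr fun u => (hup u).continuousAt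
  have hed : ∀ u, HasDerivAt e (Real.pi * Complex.I * (c : ℂ) * e u) u := fun u => by
    have h1 : HasDerivAt (fun u : ℝ => u * c) (1 * c) u := (hasDerivAt_id u).mul_const c
    have h2 := ((h1.ofReal_comp).const_mul (Real.pi * Complex.I)).cexp
    convert h2 using 1
    rw [one_mul, mul_comm]
  have hder : ∀ u, HasDerivAt (fun u => e u * t.1 (Function.update x i u))
      (e u * (actL ν (Sum.inr i) t).1 (Function.update x i u)) u := fun u => by
    have h2 := (t.2.1.differentiable (by simp) (Function.update x i u)).hasFDerivAt.comp_hasDerivAt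
      u (hup u)
    refine ((hed u).mul h2).congr_deriv (Eq.symm ?_)
    change _ * (fderiv ℝ t.1 (Function.update x i u) (Pi.single i 1) + Real.pi * Complex.I *
      (det3 (Pi.single i 1) (Function.update x i u) (latt ν) : ℝ) *
        t.1 (Function.update x i u)) = _
    rw [det3_update, ← hc, Function.comp_apply]
    ring
  have hcont : Continuous fun u => e u * (actL ν (Sum.inr i) t).1 (Function.update x i u) :=
    (continuous_iff_continuousAt.mpr fun u => (hed u).continuousAt).mul
      ((actL ν (Sum.inr i) t).2.1.continuous.comp hupc)
  -- Norms of sections are lattice periodic, so `x i` may be replaced by its fractional part.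
  have h := enorm_le_lintegral_unit hder hcont (t := Int.fract (x i))
    ⟨Int.fract_nonneg _, (Int.fract_lt_one _).le⟩
  simp only [enorm_mul, hen, one_mul] at h
  refine le_trans (le_of_eq ?_) h
  have h5 : Function.update x i (Int.fract (x i)) = x + latt (Pi.single i (-⌊x i⌋)) := by
    funext j
    rcases eq_or_ne j i with rfl | hj
    · simp [latt, Int.fract, sub_eq_add_neg]
    · simp [latt, hj]
  rw [h5, ← ofReal_norm, ← ofReal_norm, norm_section_add_latt]

lemma continuous_word (w : List Idx) (t : sectionsL ν) : Continuous (wordL ν w t).1 :=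
  (wordL ν w t).2.1.continuous

/-- The one-variable bound is iterated over the coordinates, doubling the list of words each time.
The words do not depend on `ν`, and neither does the constant. -/
lemma exists_enorm_le_lmarginal (A : Finset (Fin 4)) :
    ∃ (ι : Type) (_ : Fintype ι) (W : ι → List Idx), ∀ ν (t : sectionsL ν) x,
      ‖t.1 x‖ₑ ≤ lmarginal (fun _ : Fin 4 => volume.restrict (Set.Icc (0 : ℝ) 1)) A
        (fun y => ∑ j, ‖(wordL ν (W j) t).1 y‖ₑ) x := by
  induction A using Finset.induction_on with
  | empty =>
    refine ⟨Unit, inferInstance, fun _ => [], fun ν t x => ?_⟩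
    simp [wordL]
  | insert i A hi ih =>
    obtain ⟨ι, _, W, hW⟩ := ih
    refine ⟨ι ⊕ ι, inferInstance, Sum.elim W fun j => Sum.inr i :: W j, fun ν t x => ?_⟩
    have hm : ∀ w, Measurable fun y => ‖(wordL ν w t).1 y‖ₑ := fun w =>
      (continuous_word w t).measurable.enorm
    rw [lmarginal_insert' _ (Finset.measurable_sum _ fun j _ => hm _) hi]
    refine (hW ν t x).trans (lmarginal_mono (fun y => ?_) x)
    have hmu : ∀ w, Measurable fun u => ‖(wordL ν w t).1 (Function.update y i u)‖ₑ := fun w =>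
      (hm w).comp (measurable_update y)
    simp only [Fintype.sum_sum_type, Sum.elim_inl, Sum.elim_inr, ← Finset.sum_add_distrib]
    have hs := lintegral_finsetSum (μ := volume.restrict (Set.Icc (0 : ℝ) 1)) Finset.univ
      (f := fun j u => ‖(wordL ν (W j) t).1 (Function.update y i u)‖ₑ
        + ‖(wordL ν (Sum.inr i :: W j) t).1 (Function.update y i u)‖ₑ)
      fun j _ => (hmu _).add (hmu _)
    rw [hs]
    refine Finset.sum_le_sum fun j _ => ?_
    exact enorm_section_le (wordL ν (W j) t) i y

lemma pi_restrict_box : Measure.pi (fun _ : Fin 4 => volume.restrict (Set.Icc (0 : ℝ) 1))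
    = volume.restrict (Set.Icc (0 : Fin 4 → ℝ) 1) := by
  rw [← Measure.restrict_pi_pi, Set.pi_univ_Icc]
  rfl

lemma integral_box_one : ∫ _ in Set.Icc (0 : Fin 4 → ℝ) 1, (1 : ℝ) = 1 := by
  simp [Measure.real, Real.volume_Icc_pi]

lemma lintegral_section_le (t : sectionsL ν) :
    ∫⁻ y in Set.Icc (0 : Fin 4 → ℝ) 1, ‖t.1 y‖ₑ ≤ ENNReal.ofReal (1 + normSqL ν t) := by
  rw [← ofReal_integral_norm_eq_lintegral_enorm (integrable_box t.2.1.continuous)]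
  refine ENNReal.ofReal_le_ofReal ?_
  have h := integral_add (integrable_box (continuous_const (y := (1 : ℝ)))) (integrable_normSq ν t)
  rw [integral_box_one] at h
  rw [normSqL, ← h]
  refine integral_mono (integrable_box t.2.1.continuous.norm)
    ((integrable_box continuous_const).add (integrable_normSq ν t)) fun y => ?_
  -- The crude bound `a ≤ 1 + a²` takes the place of Cauchy–Schwarz; only finiteness, uniformly in
  -- `ν`, matters later.
  nlinarith [sq_nonneg (‖t.1 y‖ - 1), norm_nonneg (t.1 y)]

/-- A pointwise bound of a section by square integrals of its derivatives. -/
lemma exists_norm_section_le : ∃ (ι : Type) (_ : Fintype ι) (W : ι → List Idx),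
    ∀ ν (t : sectionsL ν) x, ‖t.1 x‖ ≤ ∑ j, (1 + normSqL ν (wordL ν (W j) t)) := by
  obtain ⟨ι, _, W, hW⟩ := exists_enorm_le_lmarginal Finset.univ
  refine ⟨ι, inferInstance, W, fun ν t x => ?_⟩
  have h := hW ν t x
  have h0 : ∀ j, 0 ≤ 1 + normSqL ν (wordL ν (W j) t) := fun j =>
    add_nonneg zero_le_one (normSqL_nonneg ν _)
  rw [lmarginal_univ, pi_restrict_box, lintegral_finsetSum _ fun j _ =>
    (continuous_word (W j) t).measurable.enorm] at h
  have h2 := h.trans (Finset.sum_le_sum fun j _ => lintegral_section_le (wordL ν (W j) t))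
  rw [← ENNReal.ofReal_sum_of_nonneg fun j _ => h0 j, ← ofReal_norm] at h2
  exact (ENNReal.ofReal_le_ofReal_iff (Finset.sum_nonneg fun j _ => h0 j)).mp h2

end Sobolev

/-! ## Decay of smooth vectors -/

/-- Each square integral in the Sobolev bound is one term of a convergent series and so is at most
its sum. -/
lemma ZeroY.exists_norm_le (s : ZeroY) : ∃ K : ℝ, ∀ ν x, ‖(s.1 ν).1 x‖ ≤ K := by
  obtain ⟨ι, _, W, hW⟩ := exists_norm_section_le
  refine ⟨∑ j, (1 + ∑' ν, normSqL ν (wordL ν (W j) (s.1 ν))), fun ν x => ?_⟩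
  refine (hW ν (s.1 ν) x).trans (Finset.sum_le_sum fun j _ => add_le_add_right ?_ 1)
  exact (s.2 (W j)).le_tsum ν fun μ _ => normSqL_nonneg μ _

/-- The operator `1 - (α^i)²`. -/
def massOp (i : Fin 4) : Module.End ℂ ZeroY := 1 - actY (Sum.inl i) * actY (Sum.inl i)

lemma massOp_apply (i : Fin 4) (s : ZeroY) (ν : Fin 4 → ℤ) (x : Fin 4 → ℝ) :
    ((massOp i s).1 ν).1 x = ((1 + (2 * Real.pi * ν i) ^ 2 : ℝ) : ℂ) * (s.1 ν).1 x := by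
  change (s.1 ν).1 x - (-(2 * Real.pi * Complex.I * (ν i : ℂ))) *
    ((-(2 * Real.pi * Complex.I * (ν i : ℂ))) * (s.1 ν).1 x) = _
  push_cast
  linear_combination (-(2 * Real.pi * (ν i : ℂ)) ^ 2 * (s.1 ν).1 x) * Complex.I_sq

/-- The rate of decay of the components of a smooth vector. -/
def decay (ν : Fin 4 → ℤ) : ℝ := ∏ i, (1 + (2 * Real.pi * ν i) ^ 2)⁻¹

/-- Smooth vectors are stable under `massOp`, which multiplies the component `ν` by `1 + (2π ν_i)²`;
the uniform bound for the image is decay for `s`. -/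
lemma ZeroY.exists_norm_le_decay (s : ZeroY) :
    ∃ K : ℝ, ∀ ν x, ‖(s.1 ν).1 x‖ ≤ K * decay ν := by
  obtain ⟨K, hK⟩ := (massOp 0 (massOp 1 (massOp 2 (massOp 3 s)))).exists_norm_le
  refine ⟨K, fun ν x => ?_⟩
  have h := hK ν x
  simp only [massOp_apply] at h
  have hpos : ∀ i, 0 < 1 + (2 * Real.pi * ν i) ^ 2 := fun i => by positivity
  simp only [norm_mul, Complex.norm_real, Real.norm_of_nonneg (hpos _).le, ← mul_assoc] at h
  rw [decay, Finset.prod_inv_distrib, Fin.prod_univ_four, ← div_eq_mul_inv, le_div_iff₀']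
  · exact h
  · have := hpos
    exact mul_pos (mul_pos (mul_pos (this 0) (this 1)) (this 2)) (this 3)

lemma summable_pi_prod {a : ℤ → ℝ} (h0 : ∀ n, 0 ≤ a n) (ha : Summable a) (n : ℕ) :
    Summable fun ν : Fin n → ℤ => ∏ i, a (ν i) := by
  induction n with
  | zero => exact (hasSum_fintype _).summable
  | succ n ih =>
    rw [← (Fin.consEquiv fun _ : Fin (n + 1) => ℤ).summable_iff]
    have h := ha.mul_of_nonneg ih h0 fun ν => Finset.prod_nonneg fun i _ => h0 (ν i)
    refine h.congr fun q => ?_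
    simp [Fin.prod_univ_succ]

lemma summable_decay : Summable decay := by
  refine summable_pi_prod (a := fun n : ℤ => (1 + (2 * Real.pi * n) ^ 2)⁻¹)
    (fun n => by positivity) ?_ 4
  -- The comparison is with `1 / n²`, and the extra summand at `0` covers `n = 0`.
  refine Summable.of_nonneg_of_le (fun n => by positivity) (fun n => ?_)
    ((Real.summable_one_div_int_pow.mpr one_lt_two).add (hasSum_ite_eq (0 : ℤ) (1 : ℝ)).summable)
  split_ifs with hn
  · subst hn; simp
  · have h1 : (0 : ℝ) < (n : ℝ) ^ 2 := by positivity
    rw [add_zero, one_div]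
    refine inv_anti₀ h1 ?_
    have h2 : 1 ≤ 2 * Real.pi := by linarith [Real.pi_gt_three]
    nlinarith [mul_le_mul h2 h2 zero_le_one (by linarith)]

lemma decay_nonneg (ν : Fin 4 → ℤ) : 0 ≤ decay ν :=
  Finset.prod_nonneg fun i _ => by positivity

/-! ## The inverse Fourier transform -/

/-- The dual of the left-invariant frame. -/
def coframe (a : Idx) (p : Pt) : Pt →L[ℝ] ℝ := (ContinuousLinearMap.proj a).comp (leftInvL (-p))

lemma contDiff_coframe (a : Idx) : ContDiff ℝ ∞ (coframe a) := by
  have h : leftInvL = fun p => ContinuousLinearMap.id ℝ Pt + (1 / 2 : ℝ) • bracketCLM p :=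
    funext fun p => ContinuousLinearMap.ext fun u => leftInv_eq p u
  have h1 : ContDiff ℝ ∞ leftInvL := by
    rw [h]
    exact contDiff_const.add (bracketCLM.contDiff.const_smul (1 / 2 : ℝ))
  exact contDiff_const.clm_comp (h1.comp contDiff_neg)

lemma eq_sum_coframe (D : Pt →L[ℝ] ℂ) (p : Pt) :
    D = ∑ a, (coframe a p).smulRight (D (leftInv p (Pi.single a 1))) := by
  refine ContinuousLinearMap.ext fun v => ?_
  have h1 : v = leftInvL p (leftInv (-p) v) := (leftInv_leftInv_neg p v).symm
  have h2 : leftInv (-p) v = ∑ a, leftInv (-p) v a • (Pi.single a 1 : Pt) :=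
    pi_eq_sum_univ' _
  conv_lhs => rw [h1, h2, map_sum, map_sum]
  rw [sum_apply]
  refine Finset.sum_congr rfl fun a _ => ?_
  rw [map_smul, map_smul]
  rfl

lemma fderiv_echar (ν : Fin 4 → ℤ) (y v : Fin 4 → ℝ) : fderiv ℝ (echar ν) y v
    = 2 * Real.pi * Complex.I * ((∑ k, latt ν k * v k : ℝ) : ℂ) * echar ν y := by
  obtain ⟨D, hD, hDv⟩ := hasFDerivAt_echar ν y
  have h : v = ∑ k, v k • (Pi.single k 1 : Fin 4 → ℝ) := pi_eq_sum_univ' v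
  rw [hD.fderiv]
  conv_lhs => rw [h, map_sum]
  simp only [map_smul, hDv, Complex.real_smul]
  push_cast
  rw [Finset.mul_sum, Finset.sum_mul]
  refine Finset.sum_congr rfl fun k _ => ?_
  simp only [latt, Complex.ofReal_intCast]
  ring

lemma integral_echar (ν : Fin 4 → ℤ) :
    ∫ y in Set.Icc (0 : Fin 4 → ℝ) 1, echar ν y = if ν = 0 then 1 else 0 := by
  split_ifs with h
  · subst h
    have : ∀ y, echar 0 y = 1 := fun y => by simp [echar, latt]
    simp [this, MeasureTheory.Measure.real, Real.volume_Icc_pi]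
  · obtain ⟨k, hk⟩ := Function.ne_iff.mp h
    have h1 := (echar_periodic ν).integral_pd ((contDiff_echar ν).of_le (by simp)) k
    have h2 : ∀ y, fderiv ℝ (echar ν) y (Pi.single k 1)
        = 2 * Real.pi * Complex.I * (ν k : ℂ) * echar ν y := fun y => by
      obtain ⟨D, hD, hDv⟩ := hasFDerivAt_echar ν y
      rw [hD.fderiv, hDv]
    simp only [h2] at h1
    rw [MeasureTheory.integral_const_mul] at h1
    refine (mul_eq_zero.mp h1).resolve_left ?_
    simp only [Pi.zero_apply] at hk
    simp [hk, Real.pi_ne_zero]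

lemma contDiff_vec : ContDiff ℝ ∞ (vec : Pt → Fin 4 → ℝ) :=
  contDiff_pi.mpr fun i => contDiff_apply ℝ ℝ (Sum.inr i)

lemma contDiff_cov : ContDiff ℝ ∞ (cov : Pt → Fin 4 → ℝ) :=
  contDiff_pi.mpr fun i => contDiff_apply ℝ ℝ (Sum.inl i)

lemma fderiv_vec (p v : Pt) : fderiv ℝ (vec : Pt → Fin 4 → ℝ) p v = vec v := by
  have h : HasFDerivAt (vec : Pt → Fin 4 → ℝ)
      (ContinuousLinearMap.pi fun i => ContinuousLinearMap.proj (R := ℝ) (Sum.inr i)) p :=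
    (ContinuousLinearMap.pi fun i =>
      (ContinuousLinearMap.proj (Sum.inr i) : Pt →L[ℝ] ℝ)).hasFDerivAt
  rw [h.fderiv]
  rfl

lemma fderiv_cov (p v : Pt) : fderiv ℝ (cov : Pt → Fin 4 → ℝ) p v = cov v := by
  have h : HasFDerivAt (cov : Pt → Fin 4 → ℝ)
      (ContinuousLinearMap.pi fun i => ContinuousLinearMap.proj (R := ℝ) (Sum.inl i)) p :=
    (ContinuousLinearMap.pi fun i =>
      (ContinuousLinearMap.proj (Sum.inl i) : Pt →L[ℝ] ℝ)).hasFDerivAt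
  rw [h.fderiv]
  rfl

namespace ZeroY

variable (s : ZeroY)

/-- A term of the Fourier series along the fibres. -/
def term (ν : Fin 4 → ℤ) (p : Pt) : ℂ := (s.1 ν).1 (vec p) * echar (-ν) (cov p)

lemma contDiff_term (ν : Fin 4 → ℤ) : ContDiff ℝ ∞ (term s ν) :=
  ((s.1 ν).2.1.comp contDiff_vec).mul ((contDiff_echar (-ν)).comp contDiff_cov)

/-- For `β_i`, the fibre component `½ det` of the left-invariant field, paired with the character of
`-ν`, produces exactly the connection term. -/
lemma fderiv_term_leftInv (ν : Fin 4 → ℤ) (p : Pt) (a : Idx) :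
    fderiv ℝ (term s ν) p (leftInv p (Pi.single a 1)) = term (actY a s) ν p := by
  have h1 := ((s.1 ν).2.1.differentiable (by simp) (vec p)).hasFDerivAt.comp p
    (contDiff_vec.differentiable (by simp) p).hasFDerivAt
  have h2 := ((contDiff_echar (-ν)).differentiable (by simp) (cov p)).hasFDerivAt.comp p
    (contDiff_cov.differentiable (by simp) p).hasFDerivAt
  have h3 : term s ν = ((s.1 ν).1 ∘ vec) * (echar (-ν) ∘ cov) := rfl
  rw [h3, (h1.mul h2).fderiv]
  simp only [add_apply, smul_apply, ContinuousLinearMap.comp_apply, fderiv_vec, fderiv_cov,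
    fderiv_echar, Function.comp_apply, smul_eq_mul]
  rcases a with k | i
  · have hv : vec (leftInv p (Pi.single (Sum.inl k) 1)) = 0 := by
      funext j; simp
    rw [hv, map_zero, leftInv_single_inl]
    change _ = (-(2 * Real.pi * Complex.I * (ν k : ℂ))) * (s.1 ν).1 (vec p) * echar (-ν) (cov p)
    simp [latt, Pi.single_apply]
    ring
  · have hv : vec (leftInv p (Pi.single (Sum.inr i) 1)) = Pi.single i 1 := by
      funext j; simp [Pi.single_apply]
    have hv' : vec (Pi.single (Sum.inr i) 1 : Pt) = Pi.single i 1 := by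
      funext j; simp [Pi.single_apply]
    have hc : ∀ k, cov (leftInv p (Pi.single (Sum.inr i) 1)) k
        = 1 / 2 * cross (vec p) (Pi.single i 1) k := fun k => by
      rw [cov_apply, leftInv_inl, hv']; simp
    rw [hv]
    change _ = (fderiv ℝ (s.1 ν).1 (vec p) (Pi.single i 1) + Real.pi * Complex.I *
      (det3 (Pi.single i 1) (vec p) (latt ν) : ℝ) * (s.1 ν).1 (vec p)) * echar (-ν) (cov p)
    have hd : ∑ k, latt (-ν) k * cov (leftInv p (Pi.single (Sum.inr i) 1)) k
        = 1 / 2 * det3 (Pi.single i 1) (vec p) (latt ν) := by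
      rw [det3_swap, det3, ← Finset.sum_neg_distrib, Finset.mul_sum]
      refine Finset.sum_congr rfl fun k _ => ?_
      rw [hc]
      simp [latt]
      ring
    rw [hd]
    push_cast
    ring

lemma exists_norm_term_le : ∃ K : ℝ, 0 ≤ K ∧ ∀ ν p, ‖term s ν p‖ ≤ K * decay ν := by
  obtain ⟨K, hK⟩ := s.exists_norm_le_decay
  refine ⟨|K|, abs_nonneg K, fun ν p => ?_⟩
  rw [term, norm_mul, norm_echar, mul_one]
  exact (hK ν _).trans (mul_le_mul_of_nonneg_right (le_abs_self K) (decay_nonneg ν))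

lemma summable_term (p : Pt) : Summable fun ν => term s ν p := by
  obtain ⟨K, _, hK⟩ := exists_norm_term_le s
  exact Summable.of_norm_bounded (summable_decay.mul_left K) fun ν => hK ν p

/-- The Fourier series along the fibres. -/
def series (p : Pt) : ℂ := ∑' ν, term s ν p

/-- Derivatives of the terms along the frame are terms of `actY a s` and decay summably; the coframe
is bounded on compact balls. This justifies differentiation term by term. -/
lemma hasFDerivAt_series (p : Pt) : ∃ D : Pt →L[ℝ] ℂ, HasFDerivAt (series s) D p ∧
    ∀ a, D (leftInv p (Pi.single a 1)) = series (actY a s) p := by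
  choose K hK0 hK using fun a => exists_norm_term_le (actY a s)
  choose C hC using fun a => (isCompact_closedBall p 1).exists_bound_of_continuousOn
    (contDiff_coframe a).continuous.continuousOn
  have hb : ∀ ν, ∀ q ∈ Metric.ball p 1,
      ‖fderiv ℝ (term s ν) q‖ ≤ (∑ a, C a * K a) * decay ν := fun ν q hq => by
    rw [eq_sum_coframe (fderiv ℝ (term s ν) q) q, Finset.sum_mul]
    refine (norm_sum_le _ _).trans (Finset.sum_le_sum fun a _ => ?_)
    rw [ContinuousLinearMap.norm_smulRight_apply, fderiv_term_leftInv, mul_assoc]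
    have h1 := hC a q (Metric.ball_subset_closedBall hq)
    exact mul_le_mul h1 (hK a ν q) (norm_nonneg _) ((norm_nonneg _).trans h1)
  have hs := summable_decay.mul_left (∑ a, C a * K a)
  have hp := Metric.mem_ball_self (x := p) one_pos
  refine ⟨_, hasFDerivAt_tsum_of_isPreconnected hs Metric.isOpen_ball
    (convex_ball p 1).isPreconnected
    (fun ν q _ => ((contDiff_term s ν).differentiable (by simp) q).hasFDerivAt) hb hp
    (summable_term s p) hp, fun a => ?_⟩
  have hsum : Summable fun ν => fderiv ℝ (term s ν) p :=
    Summable.of_norm_bounded hs fun ν => hb ν p hp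
  have := (ContinuousLinearMap.apply ℝ ℂ (leftInv p (Pi.single a 1))).map_tsum hsum
  refine this.trans (tsum_congr fun ν => ?_)
  exact fderiv_term_leftInv s ν p a

lemma contDiff_series : ContDiff ℝ ∞ (series s) := by
  have h : ∀ (n : ℕ) (s : ZeroY), ContDiff ℝ n (series s) := fun n => by
    induction n with
    | zero =>
      intro s
      exact contDiff_zero.mpr (continuous_iff_continuousAt.mpr fun p =>
        (hasFDerivAt_series s p).choose_spec.1.continuousAt)
    | succ n ih =>
      intro s
      choose D hD hDv using hasFDerivAt_series s
      refine contDiff_succ_iff_hasFDerivAt.mpr ⟨D, ?_, hD⟩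
      have hD2 : D = fun p => ∑ a, (coframe a p).smulRight (series (actY a s) p) := by
        funext p
        rw [eq_sum_coframe (D p) p]
        simp only [hDv]
      rw [hD2]
      exact ContDiff.sum fun a _ => ContDiff.smulRight
        ((contDiff_coframe a).of_le (by exact_mod_cast le_top)) (ih _)
  exact contDiff_infty.mpr fun n => h n s

/-- The phase of the section under a base translation cancels the phase of the character under the
accompanying shear. -/
lemma term_gmul_single (ν : Fin 4 → ℤ) (a : Idx) (p : Pt) :
    term s ν (gmul (Pi.single a 1) p) = term s ν p := by
  rcases a with k | i
  · have hv : vec (gmul (Pi.single (Sum.inl k) 1) p) = vec p := by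
      funext j; simp
    have h : cross (vec (Pi.single (Sum.inl k) 1 : Pt)) (vec p) = 0 := by
      funext j; fin_cases j <;> simp
    have hc : cov (gmul (Pi.single (Sum.inl k) 1) p) = cov p + Pi.single k 1 := by
      funext j
      rw [cov_apply, gmul_inl, h]
      simp [Pi.single_apply, add_comm]
    rw [term, term, hv, hc, echar_periodic]
  · have hv' : vec (Pi.single (Sum.inr i) 1 : Pt) = Pi.single i 1 := by
      funext j; simp [Pi.single_apply]
    have hv : vec (gmul (Pi.single (Sum.inr i) 1) p) = vec p + Pi.single i 1 := by
      funext j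
      simp [Pi.single_apply, add_comm]
    have hc : cov (gmul (Pi.single (Sum.inr i) 1) p)
        = cov p + (1 / 2 : ℝ) • cross (Pi.single i 1) (vec p) := by
      funext j
      rw [cov_apply, gmul_inl, hv']
      simp
    have he : Complex.exp (Real.pi * Complex.I * (det3 (Pi.single i 1) (vec p) (latt ν) : ℝ))
        * echar (-ν) ((1 / 2 : ℝ) • cross (Pi.single i 1) (vec p)) = 1 := by
      rw [echar, ← Complex.exp_add, ← Complex.exp_zero]
      congr 1
      rw [det3]
      push_cast
      rw [Finset.mul_sum, Finset.mul_sum, ← Finset.sum_add_distrib]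
      refine Finset.sum_eq_zero fun k _ => ?_
      simp [latt]
      ring
    rw [term, term, hv, hc, echar_add, (s.1 ν).2.2]
    linear_combination ((s.1 ν).1 (vec p) * echar (-ν) (cov p)) * he

lemma series_invariant (γ : NilGroup) (hγ : γ ∈ lattice) :
    ∀ p, series s (gmul γ.coord p) = series s p := by
  induction hγ using Subgroup.closure_induction with
  | mem γ hγ =>
    obtain ⟨a, rfl⟩ := hγ
    intro p
    exact tsum_congr fun ν => term_gmul_single s ν a p
  | one => intro p; exact congrArg (series s) (zero_gmul p)
  | mul γ δ _ _ hγ hδ =>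
    intro p
    have h : gmul (γ * δ).coord p = gmul γ.coord (gmul δ.coord p) :=
      gmul_assoc γ.coord δ.coord p
    rw [h, hγ, hδ]
  | inv γ _ hγ =>
    intro p
    have h : gmul γ.coord (gmul (γ⁻¹).coord p) = p := by
      rw [← gmul_assoc]
      change gmul (gmul γ.coord (-γ.coord)) p = p
      rw [gmul_neg, zero_gmul]
    rw [← hγ, h]

/-- The inverse Fourier transform of a smooth vector. -/
def toZeroX : ZeroX := ⟨series s, contDiff_series s, series_invariant s⟩

/-- Uniform summability allows integration term by term, and orthogonality of characters selects one
term. -/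
lemma fourierCoeff_series (ν : Fin 4 → ℤ) (x : Fin 4 → ℝ) :
    fourierCoeffX (series s) ν x = (s.1 ν).1 x := by
  obtain ⟨K, hK0, hK⟩ := exists_norm_term_le s
  have h := MeasureTheory.hasSum_integral_of_dominated_convergence
    (μ := MeasureTheory.volume.restrict (Set.Icc (0 : Fin 4 → ℝ) 1))
    (F := fun μ y => (s.1 μ).1 x * echar (-μ) y * echar ν y)
    (f := fun y => series s (Sum.elim y x) * echar ν y)
    (fun μ _ => K * decay μ)
    (fun μ => ((continuous_const.mul (contDiff_echar (-μ)).continuous).mul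
      (contDiff_echar ν).continuous).aestronglyMeasurable)
    (fun μ => Filter.Eventually.of_forall fun y => by
      rw [norm_mul, norm_echar, mul_one]
      exact hK μ (Sum.elim y x))
    (Filter.Eventually.of_forall fun _ => summable_decay.mul_left K)
    (integrable_box continuous_const)
    (Filter.Eventually.of_forall fun y =>
      (summable_term s (Sum.elim y x)).hasSum.mul_right (echar ν y))
  have h1 : ∀ μ, ∫ y in Set.Icc (0 : Fin 4 → ℝ) 1, (s.1 μ).1 x * echar (-μ) y * echar ν y
      = if μ = ν then (s.1 ν).1 x else 0 := fun μ => by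
    have h2 : ∀ y, (s.1 μ).1 x * echar (-μ) y * echar ν y = (s.1 μ).1 x * echar (ν - μ) y :=
      fun y => by
      have h3 : echar (-μ) y * echar ν y = echar (ν - μ) y := by
        rw [echar, echar, echar, ← Complex.exp_add, ← mul_add, ← Complex.ofReal_add,
          ← Finset.sum_add_distrib]
        congr 3
        refine Finset.sum_congr rfl fun k _ => ?_
        simp [latt]
        ring
      rw [mul_assoc, h3]
    simp only [h2]
    rw [MeasureTheory.integral_const_mul, integral_echar]
    by_cases hμ : μ = ν
    · subst hμ; simp
    · rw [if_neg hμ, if_neg fun h => hμ (sub_eq_zero.mp h).symm, mul_zero]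
  simp only [h1] at h
  exact h.unique (hasSum_ite_eq ν _)

end ZeroY

lemma fourierX_toZeroX (s : ZeroY) : fourierX s.toZeroX = s :=
  Subtype.ext (funext fun ν => Subtype.ext (funext fun x => s.fourierCoeff_series ν x))

/-- The Fourier transform along the fibres as an isomorphism. -/
def fourierEquiv : ZeroX ≃ₗ[ℂ] ZeroY :=
  LinearEquiv.ofBijective fourierX ⟨fourierX_injective, fun s => ⟨s.toZeroX, fourierX_toZeroX s⟩⟩

lemma fourierEquiv_actX (a : Idx) (f : ZeroX) :
    fourierEquiv (actX a f) = actY a (fourierEquiv f) :=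
  fourierX_actX a f

end GerbyTorus

end

theorem mainTheorem3 :
    (∀ J : (Fin 4 → ℝ) → Matrix Idx Idx ℝ, IsEquivariantGCY J →
      ∃! S : N2Y, AssociatedY (J 0) S) ∧
    ∃ (C : {J : (Fin 4 → ℝ) → Matrix Idx Idx ℝ // IsEquivariantGCY J} ≃
          {J : Pt → Matrix Idx Idx ℝ // IsEquivariantOrthogonalComplex J})
      (Ψ : ZeroX ≃ₗ[ℂ] ZeroY) (Φ : HX ≃ₗ[ModeAlgebra] HY),
      (∀ J p x, inFrame (C J).1 p = J.1 x) ∧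
      (∀ f ν x, ((Ψ f).1 ν).1 x = fourierCoeffX f.1 ν x) ∧
      (∀ f, HasSum (fun ν => normSqL ν ((Ψ f).1 ν))
        (∫ p in Set.Icc (0 : Pt) 1, ‖f.1 p‖ ^ 2)) ∧
      (∀ f, Φ (inclX f) = inclY (Ψ f)) ∧
      (∀ q v, v ∈ parityX q ↔ Φ v ∈ parityY q) ∧
      ∀ J, (∃! S : N2X, AssociatedX (inFrame (C J).1 0) S) ∧
        ∀ (SX : N2X) (SY : N2Y), AssociatedX (inFrame (C J).1 0) SX → AssociatedY (J.1 0) SY →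
          ∀ (n : ℤ) (v : HX), Φ (SX.L n v) = SY.L n (Φ v) ∧ Φ (SX.J n v) = SY.J n (Φ v) ∧
            Φ (SX.Gp n v) = SY.Gp n (Φ v) ∧ Φ (SX.Gm n v) = SY.Gm n (Φ v) := by
  have hassoc : ∀ J : {J : (Fin 4 → ℝ) → Matrix Idx Idx ℝ // IsEquivariantGCY J},
      inFrame (gcyEquivComplex J).1 0 = J.1 0 := fun J => inFrame_gcyEquivComplex J 0 0
  refine ⟨fun J hJ => hJ.isLieComplex.existsUnique_associated actY, gcyEquivComplex, fourierEquiv,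
    indEquiv fourierEquiv fourierEquiv_actX, inFrame_gcyEquivComplex, fun _ _ _ => rfl,
    ZeroX.hasSum_normSq, fun _ => rfl, fun q v => ⟨?_, fun hv => ?_⟩, fun J => ⟨?_, ?_⟩⟩
  · exact map_mem_parityPart (indEquiv fourierEquiv fourierEquiv_actX).toLinearMap fun _ => rfl
  · have hsymm : ∀ z, (indEquiv fourierEquiv fourierEquiv_actX).symm (inclY z)
        = inclX (fourierEquiv.symm z) := fun z => by
      rw [LinearEquiv.symm_apply_eq, indEquiv_incl, LinearEquiv.apply_symm_apply]
    have h := map_mem_parityPart (indEquiv fourierEquiv fourierEquiv_actX).symm.toLinearMap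
      hsymm hv
    rwa [LinearEquiv.coe_coe, LinearEquiv.symm_apply_apply] at h
  · rw [hassoc]
    exact J.2.isLieComplex.existsUnique_associated actX
  · intro SX SY hX hY
    rw [hassoc] at hX
    obtain ⟨e, e', he⟩ := hX.1
    exact intertwines_of_isGeneratedBy (indEquiv fourierEquiv fourierEquiv_actX).toLinearMap
      (hX.2 e e' he) (hY.2 e e' he)
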